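/- **Setting.** Let $\mathcal W,\mathcal V$ be Hilbertizable complex spaces (complete topological vector spaces whose topology comes from a scalar product; such scalar products are called compatible), with $\mathcal V$ densely and continuously embedded in $\mathcal W$. Let $(\mathcal W,Q)$ be a Krein space: $Q$ is a bounded Hermitian form, written $(v|Qw)$ and antilinear in $v$, and there is a bounded involution $S$ which preserves $Q$ and for which $(v|QSw)$ is a compatible scalar product. Let $-\infty<t_-<t_+<\infty$, $I=\,]t_-,t_+[$ and $I^{\rm cl}=[t_-,t_+]$. Let $B(t)=B_0(t)+V(t)$, $t\in I^{\rm cl}$, where $t\mapsto V(t)\in B(\mathcal W)$ is norm-continuous and the $B_0(t)$ are operators on $\mathcal W$ such that (a) $\mathcal V\subset \mathrm{Dom}(B_0(t))$ and $t\mapsto B_0(t)\in B(\mathcal V,\mathcal W)$ is norm-continuous; (b) there are compatible scalar products $(\cdot|\cdot)_{\mathcal W,t}$ on $\mathcal W$ and $(\cdot|\cdot)_{\mathcal V,t}$ on $\mathcal V$, $t\in I^{\rm cl}$; (c) $B_0(t)$ is (densely defined and) self-adjoint for $(\cdot|\cdot)_{\mathcal W,t}$, and its part in $\mathcal V$ is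 self-adjoint for $(\cdot|\cdot)_{\mathcal V,t}$; (d) for some nonnegative $C\in L^1(I^{\rm cl})$ and all $s,t\in I^{\rm cl}$, $\|w\|_{\mathcal W,t}\le\|w\|_{\mathcal W,s}\exp\left|\int_s^tC(r)\,dr\right|$ for $w\in\mathcal W$ and $\|v\|_{\mathcal V,t}\le\|v\|_{\mathcal V,s}\exp\left|\int_s^tC(r)\,dr\right|$ for $v\in\mathcal V$. Assume that every $B(t)$ is a pseudo-unitary generator, i.e. it is the generator of a strongly continuous one-parameter group $e^{-i\tau B(t)}$ on $\mathcal W$, and $(v|QB(t)w)=(B(t)v|Qw)$ for $v,w\in\mathrm{Dom}(B(t))$. **The evolution.** There is exactly one family $R(t,s)\in B(\mathcal W)$, $t,s\in I^{\rm cl}$, jointly strongly continuous, with $R(t,t)=1$, $R(t,s)R(s,r)=R(t,r)$ and $-i\partial_sR(t,s)v=R(t,s)B(s)v$ for $v\in\mathcal V$ (derivative in $\mathcal W$, one-sided at the end points). It is pseudo-unitary: $(R(t,s)v|QR(t,s)w)=(v|Qw)$. **The operators $E^{(\pm\mp)}$.** Let $\mathcal Z_+^{(+)},\mathcal Z_-^{(-)}$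 be closed subspaces of $\mathcal W$. Put $\mathcal Z_+^{(-)}=(\mathcal Z_+^{(+)})^{\perp Q}$ and $\mathcal Z_-^{(+)}=(\mathcal Z_-^{(-)})^{\perp Q}$, where $\mathcal Z^{\perp Q}=\{w\mid (w|Qv)=0,\ v\in \mathcal Z\}$, and $\mathcal Z_\pm^{(\cdot)}(t)=R(t,t_\pm)\mathcal Z_\pm^{(\cdot)}$. Assume asymptotic complementarity: for some $t\in I$, $\mathcal Z_-^{(-)}(t)\cap\mathcal Z_+^{(+)}(t)=\{0\}$ and $\mathcal Z_-^{(-)}(t)+\mathcal Z_+^{(+)}(t)=\mathcal W$. Then $(\mathcal Z_-^{(+)},\mathcal Z_+^{(-)})$ also satisfies asymptotic complementarity. With $\theta$ the Heaviside function, let $$E^{(+-)}(t,s)=\theta(t-s)R(t,s)\Lambda(s)-\theta(s-t)R(t,s)(1-\Lambda(s)),$$ where $\Lambda(s)$ is the projection onto $\mathcal Z_+^{(+)}(s)$ along $\mathcal Z_-^{(-)}(s)$, and let $E^{(-+)}(t,s)$ be given by the same formula with $\Lambda(s)$ the projection onto $\mathcal Z_+^{(-)}(s)$ along $\mathcal Z_-^{(+)}(s)$.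 Let $E^{(+-)}$, $E^{(-+)}$ be the operators $(Ew)(t)=\int_IE(t,s)w(s)\,ds$. **Conclusion.** 1. $E^{(+-)}$ and $E^{(-+)}$ map $C_{\rm c}(I,\mathcal W)$ to $C(I,\mathcal W)$, and they are left inverses of $\partial_t+iB(t)$: for $v\in C_{\rm c}(I,\mathcal V)\cap C^1_{\rm c}(I,\mathcal W)$, $$E^{(+-)}(\partial_t+iB(t))v=v,\qquad E^{(-+)}(\partial_t+iB(t))v=v .$$ 2. $E^{(+-)}$ and $E^{(-+)}$ extend to bounded operators on $L^2(I,\mathcal W)$, given by the same integral formula, and these have dense range and trivial kernel. 3. Hence $M^{(+-)}=(E^{(+-)})^{-1}$ and $M^{(-+)}=(E^{(-+)})^{-1}$ are well-posed realizations of $\partial_t+iB(t)$ on $L^2(I,\mathcal W)$: they are densely defined and closed, they extend $\partial_t+iB(t)$ defined on $C_{\rm c}(I,\mathcal V)\cap C^1_{\rm c}(I,\mathcal W)$, and $0$ belongs to their resolvent sets. With the $Q$-adjoint taken for the form $(f|Qg)=\int_I(f(t)|Qg(t))\,dt$, $$(M^{(+-)})^{*Q}=-M^{(-+)} .$$ 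-/

import Mathlib

open MeasureTheory Set

noncomputable section

namespace KreinEvolution

/-! Hilbertizable spaces are modelled by complete complex inner product spaces, whose own inner
product serves only as one reference scalar product: every notion below depends only on the
topology. A bounded sesquilinear form (antilinear in the first variable) on `H` is a term of
`H →L⋆[ℂ] H →L[ℂ] ℂ`; every scalar product compatible with `H` is such a form. -/

section Forms

variable {H : Type*} [NormedAddCommGroup H] [InnerProductSpace ℂ H]

/-- The sesquilinear form `G` is Hermitian. -/
def IsHermitianForm (G : H →L⋆[ℂ] H →L[ℂ] ℂ) : Prop :=
  ∀ v w, (starRingEnd ℂ) (G v w) = G w v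

/-- `G` is a scalar product that defines the topology of `H` (the bound from above is the
boundedness of `G`). -/
def IsCompatibleScalarProduct (G : H →L⋆[ℂ] H →L[ℂ] ℂ) : Prop :=
  IsHermitianForm G ∧ ∃ c : ℝ, 0 < c ∧ ∀ v, c * ‖v‖ ^ 2 ≤ (G v v).re

/-- The norm `‖v‖ = √(v|v)` of a scalar product `G`. -/
def formNorm (G : H →L⋆[ℂ] H →L[ℂ] ℂ) (v : H) : ℝ := Real.sqrt (G v v).re

/-- The involution `S` is admissible for `Q`: it is bounded, `S² = 1`, it preserves `Q`, and
`(v|w)_S = (v|QSw)` is a compatible scalar product. -/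
def IsAdmissibleInvolution (Q : H →L⋆[ℂ] H →L[ℂ] ℂ) (S : H →L[ℂ] H) : Prop :=
  S ∘L S = ContinuousLinearMap.id ℂ H ∧ (∀ v w, Q (S v) (S w) = Q v w) ∧
    ∃ G : H →L⋆[ℂ] H →L[ℂ] ℂ, IsCompatibleScalarProduct G ∧ ∀ v w, G v w = Q v (S w)

/-- `(H, Q)` is a Krein space: `Q` is a bounded Hermitian form that possesses an admissible
involution. -/
def IsKrein (Q : H →L⋆[ℂ] H →L[ℂ] ℂ) : Prop :=
  IsHermitianForm Q ∧ ∃ S : H →L[ℂ] H, IsAdmissibleInvolution Q S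

/-- The `Q`-orthogonal complement `{w | (w|Qv) = 0 for all v ∈ Z}`. -/
def qOrthogonal (Q : H →L⋆[ℂ] H →L[ℂ] ℂ) (Z : Submodule ℂ H) : Submodule ℂ H where
  carrier := {w | ∀ v ∈ Z, Q w v = 0}
  zero_mem' := fun v _ => by simp
  add_mem' := fun hx hy v hv => by simp [hx v hv, hy v hv]
  smul_mem' := fun c x hx v hv => by simp [hx v hv]

/-- `N` is the adjoint of the unbounded operator `M` with respect to the form `F`: a vector `v`
is in the domain of `N`, with `N v = u`, if and only if `F u w = F v (M w)` for all `w` in the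
domain of `M`. -/
def IsFormAdjoint (F : H → H → ℂ) (M N : H →ₗ.[ℂ] H) : Prop :=
  ∀ v u, (v, u) ∈ N.graph ↔ ∀ w : M.domain, F u w = F v (M w)

/-- The unbounded operator `B` is densely defined and self-adjoint for the scalar product `G`. -/
def IsSelfAdjointFor (G : H →L⋆[ℂ] H →L[ℂ] ℂ) (B : H →ₗ.[ℂ] H) : Prop :=
  Dense (B.domain : Set H) ∧ IsFormAdjoint (fun v w => G v w) B B

/-- `U` is a strongly continuous one-parameter group of bounded operators and `B` is its
generator, `U τ = exp(-iτB)`: the domain of `B` consists of all `v` for which `τ ↦ U τ v` is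
differentiable at `0`, and the derivative is then `-i B v`. -/
def IsGroupGenerator (B : H →ₗ.[ℂ] H) (U : ℝ → H →L[ℂ] H) : Prop :=
  U 0 = ContinuousLinearMap.id ℂ H ∧ (∀ s t, U (s + t) = U s ∘L U t) ∧
    (∀ v, Continuous fun t => U t v) ∧
    ∀ v u, (v, u) ∈ B.graph ↔ HasDerivAt (fun t => U t v) (-(Complex.I • u)) 0

/-- `B` infinitesimally preserves `Q`: it generates a one-parameter group and
`(v|QBw) = (Bv|Qw)` on its domain. If `(H, Q)` is a Krein space (so that `Q` is non-degenerate),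
then `B` is called a pseudo-unitary generator. -/
def IsPseudoUnitaryGenerator (Q : H →L⋆[ℂ] H →L[ℂ] ℂ) (B : H →ₗ.[ℂ] H) : Prop :=
  (∃ U, IsGroupGenerator B U) ∧ ∀ v w : B.domain, Q v (B w) = Q (B v) w

/-- The resolvent set of an unbounded operator: all `z` for which `M - z` is a bijection of the
domain of `M` onto `H` with bounded inverse `T`. -/
def pmapResolventSet (M : H →ₗ.[ℂ] H) : Set ℂ :=
  {z | ∃ T : H →L[ℂ] H, (∀ f, ∃ h : T f ∈ M.domain, M ⟨T f, h⟩ - z • T f = f) ∧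
    ∀ v : M.domain, T (M v - z • (v : H)) = v}

open Classical in
/-- The value `B v` of an unbounded operator, and `0` for `v` outside of its domain. -/
def pmapApply (B : H →ₗ.[ℂ] H) (v : H) : H :=
  if h : v ∈ B.domain then B ⟨v, h⟩ else 0

open Classical in
/-- The projection onto `X` along `Y`, for complementary subspaces `X`, `Y`. -/
def projAlong (X Y : Submodule ℂ H) : H →ₗ[ℂ] H :=
  if h : IsCompl X Y then Submodule.projection X Y h else 0

end Forms

section Evolution

variable {W V : Type*} [NormedAddCommGroup W] [InnerProductSpace ℂ W]
  [NormedAddCommGroup V] [InnerProductSpace ℂ V]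

/-- The part in `V` of an operator `B` on `W`, where `V` is embedded in `W` by `J`: its graph
consists of the pairs `(v, u)` in `V × V` with `J v` in the domain of `B` and `B (J v) = J u`. -/
def partIn (J : V →L[ℂ] W) (B : W →ₗ.[ℂ] W) : V →ₗ.[ℂ] V :=
  (B.graph.comap ((J : V →ₗ[ℂ] W).prodMap (J : V →ₗ[ℂ] W))).toLinearPMap

/-- Kato's hypotheses on a family `B₀ t`, `t ∈ [a, b]`, of operators on `W`, relative to the space
`V` embedded by `J`: (a) `V` is contained in the domains, and `t ↦ B₀ t ∈ B(V, W)` is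
norm-continuous; (b) there are compatible scalar products `GW t` on `W` and `GV t` on `V`
such that (c) `B₀ t` is self-adjoint for `GW t` and its part in `V` is self-adjoint for `GV t`,
and (d) the norms vary in time in a way that is controlled by an integrable function `C`. -/
def KatoHypotheses (J : V →L[ℂ] W) (a b : ℝ) (B₀ : ℝ → W →ₗ.[ℂ] W) : Prop :=
  (∃ BV : ℝ → V →L[ℂ] W, ContinuousOn BV (Icc a b) ∧
      ∀ t ∈ Icc a b, ∀ v, (J v, BV t v) ∈ (B₀ t).graph) ∧
    ∃ (GW : ℝ → W →L⋆[ℂ] W →L[ℂ] ℂ) (GV : ℝ → V →L⋆[ℂ] V →L[ℂ] ℂ) (C : ℝ → ℝ),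
      (∀ t ∈ Icc a b, IsCompatibleScalarProduct (GW t) ∧ IsCompatibleScalarProduct (GV t)) ∧
      (∀ t ∈ Icc a b,
        IsSelfAdjointFor (GW t) (B₀ t) ∧ IsSelfAdjointFor (GV t) (partIn J (B₀ t))) ∧
      (∀ t ∈ Icc a b, 0 ≤ C t) ∧ IntegrableOn C (Icc a b) ∧
      (∀ s ∈ Icc a b, ∀ t ∈ Icc a b, ∀ w : W,
        formNorm (GW t) w ≤ formNorm (GW s) w * Real.exp |∫ r in s..t, C r|) ∧
      ∀ s ∈ Icc a b, ∀ t ∈ Icc a b, ∀ v : V,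
        formNorm (GV t) v ≤ formNorm (GV s) v * Real.exp |∫ r in s..t, C r|

/-- The perturbed family `B t = B₀ t + P t`, with the domains of `B₀ t`. -/
def perturbed (B₀ : ℝ → W →ₗ.[ℂ] W) (P : ℝ → W →L[ℂ] W) (t : ℝ) : W →ₗ.[ℂ] W :=
  (P t : W →ₗ[ℂ] W) +ᵥ B₀ t

/-- `R` is a strongly continuous evolution on `[a, b]`. -/
structure IsEvolution (a b : ℝ) (R : ℝ → ℝ → W →L[ℂ] W) : Prop where
  refl : ∀ t ∈ Icc a b, R t t = ContinuousLinearMap.id ℂ W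
  comp : ∀ t ∈ Icc a b, ∀ s ∈ Icc a b, ∀ r ∈ Icc a b, R t s ∘L R s r = R t r
  continuousOn : ∀ w, ContinuousOn (fun p : ℝ × ℝ => R p.1 p.2 w) (Icc a b ×ˢ Icc a b)

/-- `R` is the strongly continuous evolution on `[a, b]` generated by the family `B`:
`-i ∂ₛ R(t,s) v = R(t,s) B(s) v` for all `v ∈ V` (one-sided derivatives at the end points). -/
structure IsEvolutionGeneratedBy (J : V →L[ℂ] W) (a b : ℝ) (B : ℝ → W →ₗ.[ℂ] W)
    (R : ℝ → ℝ → W →L[ℂ] W) : Prop extends IsEvolution a b R where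
  hasDerivWithinAt : ∀ t ∈ Icc a b, ∀ s ∈ Icc a b, ∀ (v : V) (u : W), (J v, u) ∈ (B s).graph →
    HasDerivWithinAt (fun r => R t r (J v)) (Complex.I • R t s u) (Icc a b) s

/-- The subspace `Z(t) = R(t, t₀) Z`, where `Z` is a subspace given at the time `t₀`. -/
def transport (R : ℝ → ℝ → W →L[ℂ] W) (t₀ : ℝ) (Z : Submodule ℂ W) (t : ℝ) : Submodule ℂ W :=
  Z.map (R t t₀ : W →ₗ[ℂ] W)

/-- Asymptotic complementarity of the subspace `Zout`, given at the time `b`, and the subspace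
`Zin`, given at the time `a`: for some `t` in `]a, b[` the transported subspaces are
complementary. -/
def AsymptoticComplementarity (R : ℝ → ℝ → W →L[ℂ] W) (a b : ℝ) (Zout Zin : Submodule ℂ W) :
    Prop :=
  ∃ t ∈ Ioo a b, IsCompl (transport R a Zin t) (transport R b Zout t)

/-- The Heaviside function. -/
def heaviside (x : ℝ) : ℂ := if 0 ≤ x then 1 else 0

/-- The temporal integral kernel
`θ(t-s) R(t,s) Λ(s) - θ(s-t) R(t,s) Λ'(s)`, applied to a vector `w`, of the `Zout`-out `Zin`-in
inverse; here `Λ(s)` is the projection onto `Zout(s)` along `Zin(s)`, and `Λ'(s)` is the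
projection onto `Zin(s)` along `Zout(s)`. -/
def inverseKernel (R : ℝ → ℝ → W →L[ℂ] W) (a b : ℝ) (Zout Zin : Submodule ℂ W)
    (t s : ℝ) (w : W) : W :=
  heaviside (t - s) • R t s (projAlong (transport R b Zout s) (transport R a Zin s) w) -
    heaviside (s - t) • R t s (projAlong (transport R a Zin s) (transport R b Zout s) w)

/-- `(E w)(t) = ∫ E(t,s) w(s) ds` over `]a, b[`, for a temporal integral kernel `E(t,s)`. -/
def kernelOp (a b : ℝ) (K : ℝ → ℝ → W → W) (w : ℝ → W) (t : ℝ) : W :=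
  ∫ s in Ioo a b, K t s (w s)

/-- `w ∈ C_c(]a,b[, W)`. -/
structure IsCc (a b : ℝ) (w : ℝ → W) : Prop where
  continuous : Continuous w
  hasCompactSupport : HasCompactSupport w
  tsupport_subset : tsupport w ⊆ Ioo a b

/-- `v ∈ C_c(]a,b[, V) ∩ C¹_c(]a,b[, W)`. -/
def IsTestFunction (J : V →L[ℂ] W) (a b : ℝ) (v : ℝ → V) : Prop :=
  IsCc a b v ∧ ContDiff ℝ 1 fun t => J (v t)

/-- `(∂ₜ + i B(t)) v`. -/
def evolutionOp (J : V →L[ℂ] W) (B : ℝ → W →ₗ.[ℂ] W) (v : ℝ → V) (t : ℝ) : W :=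
  deriv (fun r => J (v r)) t + Complex.I • pmapApply (B t) (J (v t))

/-- The kernel `K` gives an operator from `C_c(]a,b[, W)` to `C(]a,b[, W)`. -/
def MapsCcToC (a b : ℝ) (K : ℝ → ℝ → W → W) : Prop :=
  ∀ w, IsCc a b w → (∀ t ∈ Ioo a b, IntegrableOn (fun s => K t s (w s)) (Ioo a b)) ∧
    ContinuousOn (kernelOp a b K w) (Ioo a b)

/-- The operator with the kernel `K` is a left inverse of `∂ₜ + i B(t)`. -/
def IsLeftInverseKernel (J : V →L[ℂ] W) (a b : ℝ) (B : ℝ → W →ₗ.[ℂ] W) (K : ℝ → ℝ → W → W) :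
    Prop :=
  ∀ v, IsTestFunction J a b v →
    ∀ t ∈ Ioo a b, kernelOp a b K (evolutionOp J B v) t = J (v t)

variable (W) in
/-- The space `L²(]a,b[, W)`. -/
abbrev L2 (a b : ℝ) := Lp W 2 (volume.restrict (Ioo a b))

/-- The form `(f|Qg) = ∫ (f(t)|Qg(t)) dt` on `L²(]a,b[, W)`. -/
def qL2 (Q : W →L⋆[ℂ] W →L[ℂ] ℂ) (a b : ℝ) (f g : L2 W a b) : ℂ :=
  ∫ t in Ioo a b, Q (f t) (g t)

/-- The bounded operator `E` on `L²(]a,b[, W)` is given by the integral kernel `K`. -/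
def HasKernel (a b : ℝ) (K : ℝ → ℝ → W → W) (E : L2 W a b →L[ℂ] L2 W a b) : Prop :=
  ∀ f : L2 W a b, (∀ t ∈ Ioo a b, IntegrableOn (fun s => K t s (f s)) (Ioo a b)) ∧
    ∀ᵐ t ∂volume.restrict (Ioo a b), E f t = kernelOp a b K f t

/-- The unbounded operator `E⁻¹`, with the range of `E` as its domain. -/
def inverseOp {a b : ℝ} (E : L2 W a b →L[ℂ] L2 W a b) : L2 W a b →ₗ.[ℂ] L2 W a b :=
  ((E : L2 W a b →ₗ[ℂ] L2 W a b).toPMap ⊤).inverse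

/-- `M` is a well-posed realization on `L²(]a,b[, W)` of `∂ₜ + i B(t)`: a closed and densely
defined operator with non-empty resolvent set which extends `∂ₜ + i B(t)`, defined on
`C_c(]a,b[, V) ∩ C¹_c(]a,b[, W)`. -/
structure IsWellPosedRealization (J : V →L[ℂ] W) {a b : ℝ} (B : ℝ → W →ₗ.[ℂ] W)
    (M : L2 W a b →ₗ.[ℂ] L2 W a b) : Prop where
  dense_domain : Dense (M.domain : Set (L2 W a b))
  isClosed : M.IsClosed
  resolventSet_nonempty : (pmapResolventSet M).Nonempty
  extends_evolutionOp : ∀ v, IsTestFunction J a b v → ∃ f g : L2 W a b,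
    f =ᵐ[volume.restrict (Ioo a b)] (fun t => J (v t)) ∧
    g =ᵐ[volume.restrict (Ioo a b)] evolutionOp J B v ∧ (f, g) ∈ M.graph

end Evolution

end KreinEvolution

end

open KreinEvolution

/-! The evolution is constructed by Kato's method. Each `B₀ t` generates, by Stone's theorem, a
group that is isometric for the scalar products at the time `t`, on `W` and, by restriction, on `V`.
Freezing `B₀` at the nodes of a partition and multiplying these groups gives approximate evolutions.
Passing from the scalar product of one node to that of the next costs a factor `exp ∫ C` over the
step, so the products and their inverses are bounded on `W` and on `V` uniformly in the partition. A
Duhamel estimate, which uses the bound on `V` and the norm continuity of `B₀` in `B(V, W)`, shows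
that they converge strongly to some `u t` with the inverse `w t` (`KatoHypotheses.exists_limit`).
The bounded perturbation `P` is added in the interaction picture: `x' = -i w P u x` has a bounded,
strongly continuous coefficient, and its fundamental solution `X` with the inverse `Z` yields
`R(t,s) = u t X t Z s w s`.

The limit `u t` is never shown to preserve `V`; only the approximations do. Therefore uniqueness and
pseudo-unitarity rest on a duality principle (`IsKatoLimit.apply_eq_of_hasDerivWithinAt`): if `A t`
satisfies the backward equation on `V`, then `A t u t X t f` is constant in `t`. With `A = R t` for
a second evolution this is uniqueness. With `A t = Q (u t X t f)`, which satisfies the backward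
equation because the generators are `Q`-symmetric, it is the invariance of `Q`.

For the inverses, everything is carried back to the time `a`. Put `U t = R(t,a)`, let `Λ` be the
projection at the time `a` and `h = U⁻¹ f`. Then `(E f)(t) = U t (∫ₐᵗ h - (1 - Λ) ∫ₐᵇ h)`
(`integral_splitKernel`), that is, `E` integrates in the interaction picture and selects the
primitive that starts in the kernel and ends in the range of `Λ`. For `f = (∂ₜ + iB) v` one has `h =
(U⁻¹ v)'`, and `∫ₐᵇ h = 0` by compact support, so `E f = v`. The formula bounds `E` on `L²`, and
differentiation shows that `E` is injective. Since the `Q`-adjoint of `Λ` is `1 - Λ'`, integration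
by parts produces no boundary term (`integral_form_splitPrimitive`), and `-E'` is the `Q`-adjoint of
`E`. Injectivity of one operator is then density of the range of the other, and the assertions on
the inverses follow formally. -/

noncomputable section

namespace KreinEvolution

open Filter Topology

/-! ### Strongly continuous families of operators and limits of derivatives -/

section Analysis

variable {E F : Type*} [NormedAddCommGroup E] [NormedSpace ℂ E]
  [NormedAddCommGroup F] [NormedSpace ℂ F]

/-- A strongly continuous family of bounded operators is bounded on compact sets. -/
theorem exists_norm_le_of_continuousOn [CompleteSpace E] {α : Type*} [TopologicalSpace α]
    {R : α → E →L[ℂ] F} {k : Set α} (hk : IsCompact k)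
    (h : ∀ w, ContinuousOn (fun t => R t w) k) : ∃ M, 0 ≤ M ∧ ∀ t ∈ k, ‖R t‖ ≤ M := by
  obtain ⟨M, hM⟩ := banach_steinhaus (g := fun t : k => R t) (fun x => by
    obtain ⟨C, hC⟩ := hk.exists_bound_of_continuousOn (h x)
    exact ⟨C, fun i => hC i i.2⟩)
  exact ⟨max M 0, le_max_right _ _, fun t ht => (hM ⟨t, ht⟩).trans (le_max_left _ _)⟩

/-- Strong continuity, together with a local bound, gives joint continuity. -/
theorem continuousWithinAt_clm_apply {α : Type*} [TopologicalSpace α] {R : α → E →L[ℂ] F}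
    {x : α → E} {s : Set α} {t : α} {M : ℝ} (hM : ∀ᶠ r in 𝓝[s] t, ‖R r‖ ≤ M)
    (hR : ContinuousWithinAt (fun r => R r (x t)) s t) (hx : ContinuousWithinAt x s t) :
    ContinuousWithinAt (fun r => R r (x r)) s t := by
  have h1 : Tendsto (fun r => R r (x r - x t)) (𝓝[s] t) (𝓝 0) := by
    have h2 : Tendsto (fun r => M * ‖x r - x t‖) (𝓝[s] t) (𝓝 0) := by
      have : Tendsto (fun r => x r - x t) (𝓝[s] t) (𝓝 (x t - x t)) := hx.sub tendsto_const_nhds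
      simpa using this.norm.const_mul M
    refine squeeze_zero_norm' ?_ h2
    filter_upwards [hM] with r hr
    exact (R r).le_of_opNorm_le hr _
  have h3 := h1.add hR
  simpa [ContinuousWithinAt] using h3

/-- The product rule for a strongly differentiable family of bounded operators applied to a
differentiable function. -/
theorem hasDerivWithinAt_clm_apply {R : ℝ → E →L[ℂ] F} {x : ℝ → E} {x' : E} {y : F}
    {s : Set ℝ} {t M : ℝ} (hM : ∀ᶠ r in 𝓝[s] t, ‖R r‖ ≤ M)
    (hR : HasDerivWithinAt (fun r => R r (x t)) y s t)
    (hc : ContinuousWithinAt (fun r => R r x') s t) (hx : HasDerivWithinAt x x' s t) :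
    HasDerivWithinAt (fun r => R r (x r)) (y + R t x') s t := by
  rw [hasDerivWithinAt_iff_isLittleO] at hR hx ⊢
  have h1 : (fun r => R r (x r - x t - (r - t) • x')) =o[𝓝[s] t] fun r => r - t := by
    refine Asymptotics.IsBigO.trans_isLittleO (g := fun r => x r - x t - (r - t) • x') ?_ hx
    refine Asymptotics.IsBigO.of_bound M ?_
    filter_upwards [hM] with r hr
    exact (R r).le_of_opNorm_le hr _
  have h2 : (fun r => (r - t) • (R r x' - R t x')) =o[𝓝[s] t] fun r => r - t := by
    have h3 : (fun r => R r x' - R t x') =o[𝓝[s] t] (fun _ => (1 : ℝ)) := by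
      rw [Asymptotics.isLittleO_one_iff]
      have : Tendsto (fun r => R r x' - R t x') (𝓝[s] t) (𝓝 (R t x' - R t x')) :=
        Tendsto.sub hc tendsto_const_nhds
      simpa using this
    have := (Asymptotics.isBigO_refl (fun r : ℝ => r - t) (𝓝[s] t)).smul_isLittleO h3
    simpa using this
  refine ((h1.add h2).add hR).congr_left fun r => ?_
  have h4 : ∀ (c : ℝ) (z : E), R r (c • z) = c • R r z := fun c z => by
    simp
  simp only [map_sub, h4, smul_sub, smul_add]
  abel

/-- The limit of functions on `[a, b]` whose right derivatives converge uniformly. -/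
theorem hasDerivWithinAt_of_tendstoUniformlyOn {E : Type*} [NormedAddCommGroup E]
    [NormedSpace ℝ E] [CompleteSpace E] {a b : ℝ} (hab : a ≤ b) {g h : ℕ → ℝ → E} {G H : ℝ → E}
    (hgc : ∀ n, ContinuousOn (g n) (Icc a b))
    (hg : ∀ n, ∀ t ∈ Ico a b, HasDerivWithinAt (g n) (h n t) (Ici t) t)
    (hh : TendstoUniformlyOn h H atTop (Ico a b)) (hH : ContinuousOn H (Icc a b))
    (hG : ∀ t ∈ Icc a b, Tendsto (fun n => g n t) atTop (𝓝 (G t))) :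
    ∀ t ∈ Icc a b, HasDerivWithinAt G (H t) (Icc a b) t := by
  set H' : ℝ → E := fun t => H (projIcc a b hab t) with hH'
  have hH'c : Continuous H' :=
    hH.comp_continuous (continuous_subtype_val.comp continuous_projIcc)
      fun t => (projIcc a b hab t).2
  have hH'e : ∀ t ∈ Icc a b, H' t = H t := fun t ht => by
    simp [hH', projIcc_of_mem hab ht]
  set K : ℝ → E := fun t => ∫ s in a..t, H' s with hK
  have hKd : ∀ t, HasDerivAt K (H' t) t := fun t =>
    intervalIntegral.integral_hasDerivAt_right (hH'c.intervalIntegrable _ _)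
      (hH'c.stronglyMeasurableAtFilter _ _) hH'c.continuousAt
  -- The mean value inequality is applied to `g n - K`, whose right derivative `h n - H'` is
  -- uniformly small. The extra `1` in `b - a + 1` covers `a = b` and makes the final inequality
  -- strict.
  have key : ∀ t ∈ Icc a b, G t - G a = K t := by
    intro t ht
    have h1 : Tendsto (fun n => g n t - K t - (g n a - K a)) atTop (𝓝 (G t - K t - (G a - K a))) :=
      ((hG t ht).sub_const _).sub ((hG a (left_mem_Icc.2 hab)).sub_const _)
    have h2 : Tendsto (fun n => g n t - K t - (g n a - K a)) atTop (𝓝 0) := by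
      rw [Metric.tendsto_nhds]
      intro ε hε
      have hε' : 0 < ε / (b - a + 1) := by
        have : 0 < b - a + 1 := by linarith
        positivity
      filter_upwards [Metric.tendstoUniformlyOn_iff.1 hh _ hε'] with n hn
      rw [dist_zero_right]
      have := norm_image_sub_le_of_norm_deriv_right_le_segment (f := fun r => g n r - K r)
        (f' := fun r => h n r - H' r) (C := ε / (b - a + 1)) (a := a) (b := b)
        ((hgc n).sub fun r _ => (hKd r).continuousAt.continuousWithinAt)
        (fun r hr => (hg n r hr).sub (hKd r).hasDerivWithinAt)
        (fun r hr => by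
          rw [hH'e r (Ico_subset_Icc_self hr), ← dist_eq_norm, dist_comm]
          exact (hn r hr).le) t ht
      refine this.trans_lt ?_
      rw [div_mul_eq_mul_div, div_lt_iff₀ (by linarith)]
      have : t - a < b - a + 1 := by linarith [ht.2]
      exact mul_lt_mul_of_pos_left this hε
    have h3 := tendsto_nhds_unique h1 h2
    have h4 : K a = 0 := by simp [hK]
    rw [h4] at h3
    rw [← sub_eq_zero, ← h3]
    abel
  intro t ht
  have h5 : HasDerivWithinAt (fun r => G a + K r) (H t) (Icc a b) t := by
    rw [← hH'e t ht]
    exact ((hKd t).const_add _).hasDerivWithinAt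
  refine h5.congr (fun r hr => ?_) ?_
  · rw [← key r hr]; abel
  · rw [← key t ht]; abel

theorem eq_of_hasDerivWithinAt_zero {E : Type*} [NormedAddCommGroup E]
    [NormedSpace ℝ E] {a b : ℝ} {g : ℝ → E}
    (h : ∀ t ∈ Icc a b, HasDerivWithinAt g 0 (Icc a b) t) :
    ∀ t ∈ Icc a b, ∀ s ∈ Icc a b, g t = g s := by
  have h1 : ∀ t ∈ Icc a b, g t = g a := fun t ht => by
    have := norm_image_sub_le_of_norm_deriv_le_segment' (C := 0) h (by simp) t ht
    rw [zero_mul, norm_le_zero_iff, sub_eq_zero] at this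
    exact this
  intro t ht s hs
  rw [h1 t ht, h1 s hs]

end Analysis

/-! ### Linear differential equations with bounded, strongly continuous coefficients -/

section LinearODE

open scoped BoundedContinuousFunction

variable {W : Type*} [NormedAddCommGroup W] [NormedSpace ℂ W]

/-- Integrating an exponential weight of rate `l` gains a factor `1 / l`. This gain turns the
Volterra operator below into a contraction on the whole line. -/
theorem norm_integral_exp_abs_le {M l t₀ t : ℝ} (hl : 0 < l) (hM : 0 ≤ M) {f : ℝ → W}
    (hf : ∀ s, ‖f s‖ ≤ M * Real.exp (l * |s - t₀|)) :
    ‖∫ s in t₀..t, f s‖ ≤ M / l * Real.exp (l * |t - t₀|) := by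
  rcases le_total t₀ t with h | h
  · have hd : ∀ s, HasDerivAt (fun s => M / l * Real.exp (l * (s - t₀)))
        (M * Real.exp (l * (s - t₀))) s := fun s => by
      have := ((((hasDerivAt_id s).sub_const t₀).const_mul l).exp).const_mul (M / l)
      refine this.congr_deriv ?_
      field_simp
      simp
    have hi := intervalIntegral.integral_eq_sub_of_hasDerivAt (a := t₀) (b := t)
      (fun s _ => hd s) (Continuous.intervalIntegrable (by fun_prop) _ _)
    have := intervalIntegral.norm_integral_le_of_norm_le h (μ := volume) (f := f)
      (g := fun s => M * Real.exp (l * (s - t₀)))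
      (Eventually.of_forall fun s hs => by
        have := hf s
        rwa [abs_of_nonneg (by linarith [hs.1])] at this)
      (Continuous.intervalIntegrable (by fun_prop) _ _)
    rw [hi] at this
    refine this.trans ?_
    rw [abs_of_nonneg (by linarith)]
    have : 0 ≤ M / l * Real.exp (l * (t₀ - t₀)) := by positivity
    linarith
  · have hd : ∀ s, HasDerivAt (fun s => -(M / l) * Real.exp (l * (t₀ - s)))
        (M * Real.exp (l * (t₀ - s))) s := fun s => by
      have := ((((hasDerivAt_id s).const_sub t₀).const_mul l).exp).const_mul (-(M / l))
      refine this.congr_deriv ?_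
      field_simp
      simp
    have hi := intervalIntegral.integral_eq_sub_of_hasDerivAt (a := t) (b := t₀)
      (fun s _ => hd s) (Continuous.intervalIntegrable (by fun_prop) _ _)
    have := intervalIntegral.norm_integral_le_of_norm_le h (μ := volume) (f := f)
      (g := fun s => M * Real.exp (l * (t₀ - s)))
      (Eventually.of_forall fun s hs => by
        have := hf s
        rwa [abs_of_nonpos (by linarith [hs.2]), neg_sub] at this)
      (Continuous.intervalIntegrable (by fun_prop) _ _)
    rw [hi] at this
    rw [intervalIntegral.integral_symm, norm_neg]
    refine this.trans ?_
    rw [abs_of_nonpos (by linarith), neg_sub]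
    have : 0 ≤ M / l * Real.exp (l * (t₀ - t₀)) := by positivity
    linarith

variable {K : ℝ → W →L[ℂ] W} {M : ℝ}

theorem continuous_clm_apply (hK : ∀ w, Continuous fun t => K t w) (hM : ∀ t, ‖K t‖ ≤ M)
    {x : ℝ → W} (hx : Continuous x) : Continuous fun t => K t (x t) := by
  rw [continuous_iff_continuousAt]
  intro t
  rw [← continuousWithinAt_univ]
  exact continuousWithinAt_clm_apply (Eventually.of_forall hM)
    (hK _).continuousWithinAt hx.continuousWithinAt

/-- The rate `2 * M` of the weight is twice the bound of the coefficient, whence the factor one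
half. -/
theorem norm_volterra_apply_le (hM : ∀ t, ‖K t‖ ≤ M) (hM0 : 0 < M) (t₀ : ℝ) (z : ℝ →ᵇ W) (t : ℝ) :
    ‖Real.exp (-(2 * M * |t - t₀|)) •
      ∫ s in t₀..t, Real.exp (2 * M * |s - t₀|) • K s (z s)‖ ≤ 2⁻¹ * ‖z‖ := by
  have h1 := norm_integral_exp_abs_le (t := t) (t₀ := t₀) (l := 2 * M) (M := M * ‖z‖)
    (f := fun s => Real.exp (2 * M * |s - t₀|) • K s (z s)) (by linarith) (by positivity)
    (fun s => by
      rw [norm_smul, Real.norm_of_nonneg (Real.exp_pos _).le, mul_comm]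
      refine mul_le_mul_of_nonneg_right ?_ (Real.exp_pos _).le
      exact (K s).le_of_opNorm_le_of_le (hM s) (z.norm_coe_le_norm s))
  rw [norm_smul, Real.norm_of_nonneg (Real.exp_pos _).le]
  refine (mul_le_mul_of_nonneg_left h1 (Real.exp_pos _).le).trans_eq ?_
  rw [Real.exp_neg]
  field_simp

/-- The Volterra operator of a linear differential equation, with an exponential weight. -/
def volterra (hK : ∀ w, Continuous fun t => K t w) (hM : ∀ t, ‖K t‖ ≤ M) (hM0 : 0 < M) (t₀ : ℝ) :
    (ℝ →ᵇ W) →L[ℂ] (ℝ →ᵇ W) :=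
  have hc : ∀ z : ℝ →ᵇ W, Continuous fun s => Real.exp (2 * M * |s - t₀|) • K s (z s) := fun z =>
    (by fun_prop : Continuous fun s => Real.exp (2 * M * |s - t₀|)).smul
      (continuous_clm_apply hK hM z.continuous)
  LinearMap.mkContinuous
    { toFun := fun z => BoundedContinuousFunction.ofNormedAddCommGroup
        (fun t => Real.exp (-(2 * M * |t - t₀|)) •
          ∫ s in t₀..t, Real.exp (2 * M * |s - t₀|) • K s (z s))
        ((by fun_prop : Continuous fun t => Real.exp (-(2 * M * |t - t₀|))).smul
          (intervalIntegral.continuous_primitive (fun _ _ => (hc z).intervalIntegrable _ _) t₀))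
        (2⁻¹ * ‖z‖) (norm_volterra_apply_le hM hM0 t₀ z)
      map_add' := fun z z' => by
        ext t
        have : (∫ s in t₀..t, Real.exp (2 * M * |s - t₀|) • K s ((z + z') s)) =
            (∫ s in t₀..t, Real.exp (2 * M * |s - t₀|) • K s (z s)) +
            ∫ s in t₀..t, Real.exp (2 * M * |s - t₀|) • K s (z' s) := by
          rw [← intervalIntegral.integral_add ((hc z).intervalIntegrable _ _)
            ((hc z').intervalIntegrable _ _)]
          simp
        simp only [BoundedContinuousFunction.coe_ofNormedAddCommGroup,
          BoundedContinuousFunction.coe_add, Pi.add_apply] at this ⊢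
        rw [this, smul_add]
      map_smul' := fun c z => by
        ext t
        have : (∫ s in t₀..t, Real.exp (2 * M * |s - t₀|) • K s ((c • z) s)) =
            c • ∫ s in t₀..t, Real.exp (2 * M * |s - t₀|) • K s (z s) := by
          rw [← intervalIntegral.integral_smul]
          simp only [BoundedContinuousFunction.coe_smul, map_smul]
          congr 1; ext s; rw [smul_comm]
        simp only [BoundedContinuousFunction.coe_ofNormedAddCommGroup,
          BoundedContinuousFunction.coe_smul, RingHom.id_apply] at this ⊢
        rw [this, smul_comm] } 2⁻¹
    (fun z => (BoundedContinuousFunction.norm_le (by positivity)).2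
      (norm_volterra_apply_le hM hM0 t₀ z))

theorem volterra_apply (hK : ∀ w, Continuous fun t => K t w) (hM : ∀ t, ‖K t‖ ≤ M) (hM0 : 0 < M)
    (t₀ : ℝ) (z : ℝ →ᵇ W) (t : ℝ) : volterra hK hM hM0 t₀ z t =
      Real.exp (-(2 * M * |t - t₀|)) • ∫ s in t₀..t, Real.exp (2 * M * |s - t₀|) • K s (z s) :=
  rfl

theorem norm_volterra_lt_one (hK : ∀ w, Continuous fun t => K t w) (hM : ∀ t, ‖K t‖ ≤ M)
    (hM0 : 0 < M) (t₀ : ℝ) : ‖volterra hK hM hM0 t₀‖ < 1 :=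
  (ContinuousLinearMap.opNorm_le_bound _ (by norm_num : (0 : ℝ) ≤ 2⁻¹) fun z =>
    (BoundedContinuousFunction.norm_le (by positivity)).2
      (norm_volterra_apply_le hM hM0 t₀ z)).trans_lt (by norm_num)

variable [CompleteSpace W]

/-- The solution operator of `x' = K(t) x` with the initial time `t₀`. -/
theorem exists_solutionOperator (hK : ∀ w, Continuous fun t => K t w) (hM : ∀ t, ‖K t‖ ≤ M)
    (hM0 : 0 < M) (t₀ : ℝ) : ∃ Y : ℝ → W →L[ℂ] W, Y t₀ = ContinuousLinearMap.id ℂ W ∧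
      ∀ w t, HasDerivAt (fun r => Y r w) (K t (Y t w)) t := by
  set T := volterra hK hM hM0 t₀ with hT
  -- With the weight factored out, the integral equation reads `(1 - T) z = e w`, and the Neumann
  -- series solves it for all initial values `w` at once, linearly and boundedly.
  set N := Units.oneSub T (norm_volterra_lt_one hK hM hM0 t₀) with hN
  have hbd : ∀ t : ℝ, Real.exp (-(2 * M * |t - t₀|)) ≤ 1 := fun t => by
    rw [Real.exp_le_one_iff]
    have := abs_nonneg (t - t₀)
    nlinarith [mul_nonneg hM0.le this]
  have hc : Continuous fun t : ℝ => Real.exp (-(2 * M * |t - t₀|)) := by fun_prop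
  set e : W →L[ℂ] (ℝ →ᵇ W) := LinearMap.mkContinuous
    { toFun := fun w => BoundedContinuousFunction.ofNormedAddCommGroup
        (fun t => Real.exp (-(2 * M * |t - t₀|)) • w) (hc.smul continuous_const) ‖w‖
        (fun t => by
          rw [norm_smul, Real.norm_of_nonneg (Real.exp_pos _).le]
          exact mul_le_of_le_one_left (norm_nonneg _) (hbd t))
      map_add' := fun x y => by ext t; simp
      map_smul' := fun c x => by ext t; exact smul_comm _ _ _ } 1
    (fun w => by
      rw [one_mul]
      refine (BoundedContinuousFunction.norm_le (norm_nonneg _)).2 fun t => ?_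
      change ‖Real.exp (-(2 * M * |t - t₀|)) • w‖ ≤ ‖w‖
      rw [norm_smul, Real.norm_of_nonneg (Real.exp_pos _).le]
      exact mul_le_of_le_one_left (norm_nonneg _) (hbd t)) with he
  have hea : ∀ w t, e w t = Real.exp (-(2 * M * |t - t₀|)) • w := fun w t => rfl
  set z : W → (ℝ →ᵇ W) := fun w => (↑N⁻¹ : (ℝ →ᵇ W) →L[ℂ] (ℝ →ᵇ W)) (e w) with hz
  have hz1 : ∀ w, z w - T (z w) = e w := fun w => by
    have h1 : (N : (ℝ →ᵇ W) →L[ℂ] (ℝ →ᵇ W)) * (↑N⁻¹ : (ℝ →ᵇ W) →L[ℂ] (ℝ →ᵇ W)) = 1 := N.mul_inv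
    have h2 := congrArg (fun A => A (e w)) h1
    simpa [hN] using h2
  have hz2 : ∀ w t, Real.exp (2 * M * |t - t₀|) • z w t =
      w + ∫ s in t₀..t, K s (Real.exp (2 * M * |s - t₀|) • z w s) := fun w t => by
    have h1 := congrArg (fun f : ℝ →ᵇ W => Real.exp (2 * M * |t - t₀|) • f t) (hz1 w)
    simp only [BoundedContinuousFunction.coe_sub, Pi.sub_apply, hT, volterra_apply, hea, smul_sub,
      smul_smul, ← Real.exp_add, add_neg_cancel, Real.exp_zero, one_smul] at h1
    simp only [ContinuousLinearMap.map_smul_of_tower]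
    rw [eq_add_of_sub_eq h1]
  have hzc : ∀ w, Continuous fun s => K s (Real.exp (2 * M * |s - t₀|) • z w s) := fun w =>
    continuous_clm_apply hK hM ((by fun_prop : Continuous fun s =>
      Real.exp (2 * M * |s - t₀|)).smul (z w).continuous)
  refine ⟨fun t => Real.exp (2 * M * |t - t₀|) •
    (BoundedContinuousFunction.evalCLM ℂ t ∘L ((↑N⁻¹ : (ℝ →ᵇ W) →L[ℂ] (ℝ →ᵇ W)) ∘L e)), ?_, ?_⟩
  · ext w
    have := hz2 w t₀
    simpa using this
  · intro w t
    have h1 : HasDerivAt (fun t => w + ∫ s in t₀..t, K s (Real.exp (2 * M * |s - t₀|) • z w s))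
        (K t (Real.exp (2 * M * |t - t₀|) • z w t)) t :=
      (intervalIntegral.integral_hasDerivAt_right ((hzc w).intervalIntegrable _ _)
        ((hzc w).stronglyMeasurableAtFilter _ _) (hzc w).continuousAt).const_add _
    have h2 : (fun t => w + ∫ s in t₀..t, K s (Real.exp (2 * M * |s - t₀|) • z w s)) =
        fun t => Real.exp (2 * M * |t - t₀|) • z w t := funext fun t => (hz2 w t).symm
    rw [h2] at h1
    exact h1

/-- The fundamental solution of `x' = K(t) x` and its inverse. -/
theorem exists_fundamentalSolution (hK : ∀ w, Continuous fun t => K t w) (hM : ∀ t, ‖K t‖ ≤ M)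
    (a : ℝ) : ∃ X Z : ℝ → W →L[ℂ] W,
      X a = ContinuousLinearMap.id ℂ W ∧ (∀ t w, X t (Z t w) = w) ∧ (∀ t w, Z t (X t w) = w) ∧
      (∀ w t, HasDerivAt (fun r => X r w) (K t (X t w)) t) ∧
      ∀ w t, HasDerivAt (fun r => Z r w) (-Z t (K t w)) t := by
  -- The weight needs a strictly positive bound, so the given one is enlarged.
  obtain ⟨M, hM0, hM⟩ : ∃ M : ℝ, 0 < M ∧ ∀ t, ‖K t‖ ≤ M :=
    ⟨max M 1, by positivity, fun t => (hM t).trans (le_max_left _ _)⟩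
  choose Y hY0 hY using exists_solutionOperator hK hM hM0
  have huniq : ∀ (x y : ℝ → W), (∀ t, HasDerivAt x (K t (x t)) t) →
      (∀ t, HasDerivAt y (K t (y t)) t) → ∀ t₀, x t₀ = y t₀ → x = y := fun x y hx hy t₀ h =>
    ODE_solution_unique_univ (v := fun t x => K t x) (s := fun _ => univ) (K := M.toNNReal)
      (fun t => by
        rw [lipschitzOnWith_univ]
        exact (K t).lipschitz.weaken (by
          rw [← NNReal.coe_le_coe, Real.coe_toNNReal _ hM0.le]
          exact hM t)) (fun t => ⟨hx t, mem_univ _⟩)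
      (fun t => ⟨hy t, mem_univ _⟩) h
  have hcomp : ∀ t s r w, Y s t (Y r s w) = Y r t w := fun t s r w => by
    have := huniq (fun t => Y s t (Y r s w)) (fun t => Y r t w) (hY s _) (hY r w) s
      (by simp [hY0])
    exact congrFun this t
  have hXZ : ∀ t w, Y a t (Y t a w) = w := fun t w => by simp [hcomp, hY0]
  have hZX : ∀ t w, Y t a (Y a t w) = w := fun t w => by simp [hcomp, hY0]
  have hXc : ∀ w, Continuous fun t => Y a t w := fun w =>
    continuous_iff_continuousAt.2 fun t => (hY a w t).continuousAt
  -- Here `r` is the initial time, so no continuity in `r` is available yet. The bound comes from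
  -- Gronwall's inequality, applied to the solution itself if `r ≤ a` and to the time-reversed one
  -- if `a ≤ r`.
  have hZb : ∀ t, ∃ C, ∀ᶠ r in 𝓝 t, ‖Y r a‖ ≤ C := fun t => by
    obtain ⟨C, hC⟩ : ∃ C, ∀ r ∈ Icc (t - 1) (t + 1), ‖Y r a‖ ≤ C := by
      refine (banach_steinhaus (g := fun r : Icc (t - 1) (t + 1) => Y (r : ℝ) a) fun w => ?_).imp
        fun C h r hr => h ⟨r, hr⟩
      refine ⟨‖w‖ * Real.exp (M * (|t| + 1 + |a|)), fun r => ?_⟩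
      obtain ⟨r, hr⟩ := r
      have hd : ∀ u, ‖K u (Y r u w)‖ ≤ M * ‖Y r u w‖ := fun u => (K u).le_of_opNorm_le (hM u) _
      have hr' : |r| ≤ |t| + 1 := by
        rw [abs_le]
        have := abs_le.1 (le_refl |t|)
        constructor <;> linarith [hr.1, hr.2, this.1, this.2]
      rcases le_total r a with h | h
      · have := norm_le_gronwallBound_of_norm_deriv_right_le (f := fun u => Y r u w)
          (f' := fun u => K u (Y r u w)) (δ := ‖w‖) (K := M) (ε := 0) (a := r) (b := a)
          (fun u _ => (hY r w u).continuousAt.continuousWithinAt)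
          (fun u _ => (hY r w u).hasDerivWithinAt) (by simp [hY0])
          (fun u _ => by simpa using hd u) a ⟨h, le_rfl⟩
        refine this.trans ?_
        rw [gronwallBound_ε0]
        gcongr
        linarith [neg_le_abs r, le_abs_self a]
      · have h2 : ∀ u, HasDerivAt (fun u => Y r (-u) w) (-(K (-u) (Y r (-u) w))) u := fun u => by
          have := (hY r w (-u)).scomp u (hasDerivAt_neg u)
          simpa [Function.comp_def] using this
        have := norm_le_gronwallBound_of_norm_deriv_right_le (f := fun u => Y r (-u) w)
          (f' := fun u => -(K (-u) (Y r (-u) w))) (δ := ‖w‖) (K := M) (ε := 0) (a := -r) (b := -a)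
          (fun u _ => (h2 u).continuousAt.continuousWithinAt)
          (fun u _ => (h2 u).hasDerivWithinAt) (by simp [hY0])
          (fun u _ => by simpa using hd (-u)) (-a) ⟨by linarith, le_rfl⟩
        rw [neg_neg] at this
        refine this.trans ?_
        rw [gronwallBound_ε0]
        gcongr
        linarith [le_abs_self r, neg_le_abs a]
    exact ⟨C, by
      filter_upwards [Icc_mem_nhds (by linarith : t - 1 < t) (by linarith : t < t + 1)] with r hr
      exact hC r hr⟩
  -- With `X r = Y a r` and `Z r = Y r a`, the identity `Z r w - Z t w = Z r (X t - X r) (Z t w)`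
  -- reduces continuity of `Z` to that of `X` and the local bound.
  have hZc : ∀ w, Continuous fun t => Y t a w := fun w => by
    rw [continuous_iff_continuousAt]
    intro t
    obtain ⟨C, hC⟩ := hZb t
    have h1 : Tendsto (fun r => Y r a (Y a t (Y t a w) - Y a r (Y t a w))) (𝓝 t) (𝓝 0) := by
      have h2 : Tendsto (fun r => C * ‖Y a t (Y t a w) - Y a r (Y t a w)‖) (𝓝 t) (𝓝 0) := by
        have : Tendsto (fun r => Y a t (Y t a w) - Y a r (Y t a w)) (𝓝 t)
            (𝓝 (Y a t (Y t a w) - Y a t (Y t a w))) :=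
          tendsto_const_nhds.sub ((hXc _).tendsto t)
        simpa using this.norm.const_mul C
      refine squeeze_zero_norm' ?_ h2
      filter_upwards [hC] with r hr
      exact (Y r a).le_of_opNorm_le hr _
    have h3 := h1.add_const (Y t a w)
    rw [zero_add] at h3
    refine h3.congr fun r => ?_
    rw [map_sub, hZX, hXZ]
    abel
  refine ⟨fun t => Y a t, fun t => Y t a, hY0 a, hXZ, hZX, hY a, fun w t => ?_⟩
  obtain ⟨C, hC⟩ := hZb t
  -- By the same identity this function is `Z r w - Z t w`. The vector under `Z r` vanishes at `r =
  -- t`, so the product rule requires only boundedness and strong continuity of `Z`, not its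
  -- derivative.
  have hd : HasDerivAt (fun r => Y r a (Y a t (Y t a w) - Y a r (Y t a w)))
      (-Y t a (K t w)) t := by
    have h1 : HasDerivAt (fun r => Y a t (Y t a w) - Y a r (Y t a w)) (-(K t w)) t := by
      have := (hY a (Y t a w) t).const_sub (Y a t (Y t a w))
      rwa [hXZ t w] at this ⊢
    have := hasDerivWithinAt_clm_apply (R := fun r => Y r a) (s := univ) (t := t) (M := C) (y := 0)
      (x := fun r => Y a t (Y t a w) - Y a r (Y t a w)) (by simpa using hC)
      (by simpa using hasDerivAt_const t (0 : W)) (hZc _).continuousWithinAt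
      h1.hasDerivWithinAt
    simpa using this
  have := hd.add_const (Y t a w)
  refine this.congr_of_eventuallyEq (Eventually.of_forall fun r => ?_)
  simp only [map_sub, hZX, hXZ]
  abel

end LinearODE

end KreinEvolution

namespace KreinEvolution

open Filter Topology

/-! ### Strong limits of bounded families from a dense set of vectors -/

section DenseConvergence

variable {E F : Type*} [NormedAddCommGroup E] [NormedSpace ℂ E]
  [NormedAddCommGroup F] [NormedSpace ℂ F]

/-- For bounded families of operators, uniform convergence on a dense set of vectors implies
uniform convergence for all vectors. -/
theorem uniformCauchySeqOn_of_dense {α : Type*} {g : ℕ → α → E →L[ℂ] F} {s : Set α} {M : ℝ}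
    (hM : ∀ n, ∀ t ∈ s, ‖g n t‖ ≤ M) {D : Set E} (hD : Dense D)
    (h : ∀ v ∈ D, UniformCauchySeqOn (fun n t => g n t v) atTop s) (v : E) :
    UniformCauchySeqOn (fun n t => g n t v) atTop s := by
  rw [Metric.uniformCauchySeqOn_iff]
  intro ε hε
  have hM1 : 0 < |M| + 1 := by positivity
  obtain ⟨w, hw, hvw⟩ := Metric.mem_closure_iff.1 (hD v) (ε / (4 * (|M| + 1))) (by positivity)
  obtain ⟨N, hN⟩ := Metric.uniformCauchySeqOn_iff.1 (h w hw) (ε / 2) (by positivity)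
  refine ⟨N, fun m hm n hn t ht => ?_⟩
  have key : ∀ k, dist (g k t v) (g k t w) < ε / 4 := fun k => by
    rw [dist_eq_norm, ← map_sub]
    have h1 : ‖g k t (v - w)‖ ≤ (|M| + 1) * ‖v - w‖ :=
      (g k t).le_of_opNorm_le ((hM k t ht).trans (by linarith [le_abs_self M])) _
    refine h1.trans_lt ?_
    rw [dist_eq_norm, lt_div_iff₀ (by positivity)] at hvw
    linarith
  have h2 := hN m hm n hn t ht
  have h3 := dist_triangle4 (g m t v) (g m t w) (g n t w) (g n t v)
  have h4 := key m
  have h5 := key n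
  rw [dist_comm] at h5
  linarith

theorem exists_clm_of_cauchySeq [CompleteSpace E] [CompleteSpace F] {g : ℕ → E →L[ℂ] F}
    (h : ∀ v, CauchySeq fun n => g n v) :
    ∃ T : E →L[ℂ] F, ∀ v, Tendsto (fun n => g n v) atTop (𝓝 (T v)) := by
  choose f hf using fun v => cauchySeq_tendsto_of_complete (h v)
  exact ⟨continuousLinearMapOfTendsto g (tendsto_pi_nhds.2 hf), hf⟩

/-- The limit of bounded families of operators. -/
theorem exists_limit_of_dense [CompleteSpace E] [CompleteSpace F] {α : Type*}
    {g : ℕ → α → E →L[ℂ] F} {s : Set α} {M : ℝ}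
    (hM : ∀ n, ∀ t ∈ s, ‖g n t‖ ≤ M) {D : Set E} (hD : Dense D)
    (h : ∀ v ∈ D, UniformCauchySeqOn (fun n t => g n t v) atTop s) :
    ∃ T : α → E →L[ℂ] F, ∀ v,
      TendstoUniformlyOn (fun n t => g n t v) (fun t => T t v) atTop s := by
  have h1 := uniformCauchySeqOn_of_dense hM hD h
  have h2 : ∀ t, ∃ T : E →L[ℂ] F, t ∈ s → ∀ v, Tendsto (fun n => g n t v) atTop (𝓝 (T v)) := by
    intro t
    by_cases ht : t ∈ s
    · obtain ⟨T, hT⟩ := exists_clm_of_cauchySeq (g := fun n => g n t)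
        fun v => (h1 v).cauchySeq ht
      exact ⟨T, fun _ => hT⟩
    · exact ⟨0, fun h => absurd h ht⟩
  choose T hT using h2
  exact ⟨T, fun v => (h1 v).tendstoUniformlyOn_of_tendsto fun t ht => hT t ht v⟩

end DenseConvergence

/-! ### Compatible scalar products and Krein forms in terms of the reference scalar product -/

section Forms

open scoped InnerProductSpace

variable {H : Type*} [NormedAddCommGroup H] [InnerProductSpace ℂ H]
  {G : H →L⋆[ℂ] H →L[ℂ] ℂ}

theorem IsCompatibleScalarProduct.re_nonneg (hG : IsCompatibleScalarProduct G) (v : H) :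
    0 ≤ (G v v).re := by
  obtain ⟨-, c, hc, h⟩ := hG
  exact le_trans (by positivity) (h v)

theorem formNorm_nonneg (G : H →L⋆[ℂ] H →L[ℂ] ℂ) (v : H) : 0 ≤ formNorm G v := Real.sqrt_nonneg _

/-- The norm of a compatible scalar product is equivalent to the norm of the space. -/
theorem IsCompatibleScalarProduct.exists_equiv_norm (hG : IsCompatibleScalarProduct G) :
    ∃ k : ℝ, 0 < k ∧ ∀ v, ‖v‖ ≤ k * formNorm G v ∧ formNorm G v ≤ k * ‖v‖ := by
  have hG' := hG
  obtain ⟨-, c, hc, h⟩ := hG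
  have h1 : ∀ v, ‖v‖ ≤ (Real.sqrt c)⁻¹ * formNorm G v := fun v => by
    rw [← div_eq_inv_mul, le_div_iff₀ (Real.sqrt_pos.2 hc)]
    refine Real.le_sqrt_of_sq_le ?_
    rw [mul_pow, Real.sq_sqrt hc.le, mul_comm]
    exact h v
  have h2 : ∀ v, formNorm G v ≤ Real.sqrt ‖G‖ * ‖v‖ := fun v => by
    refine Real.sqrt_le_iff.2 ⟨by positivity, ?_⟩
    rw [mul_pow, Real.sq_sqrt (by positivity)]
    refine (Complex.re_le_norm _).trans ((G.le_opNorm₂ v v).trans_eq ?_)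
    ring
  have hc' := Real.sqrt_pos.2 hc
  refine ⟨max (Real.sqrt c)⁻¹ (Real.sqrt ‖G‖), lt_max_of_lt_left (by positivity), fun v => ⟨?_, ?_⟩⟩
  · exact (h1 v).trans (mul_le_mul_of_nonneg_right (le_max_left _ _) (formNorm_nonneg _ _))
  · exact (h2 v).trans (mul_le_mul_of_nonneg_right (le_max_right _ _) (norm_nonneg _))

theorem IsCompatibleScalarProduct.eq_zero (hG : IsCompatibleScalarProduct G) {v : H}
    (h : G v v = 0) : v = 0 := by
  obtain ⟨k, -, hk⟩ := hG.exists_equiv_norm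
  have h1 : formNorm G v = 0 := by simp [formNorm, h]
  simpa [h1] using (hk v).1

section Complete

variable [CompleteSpace H]

/-- The form of a compatible scalar product in terms of the reference scalar product. -/
theorem IsCompatibleScalarProduct.exists_equiv (hG : IsCompatibleScalarProduct G) :
    ∃ Γ : H ≃L[ℂ] H, ∀ v w, G v w = ⟪Γ v, w⟫_ℂ := by
  set Γ : H →L[ℂ] H := InnerProductSpace.continuousLinearMapOfBilin G with hΓ
  have hΓa : ∀ v w, G v w = ⟪Γ v, w⟫_ℂ := fun v w =>
    (InnerProductSpace.continuousLinearMapOfBilin_apply G v w).symm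
  obtain ⟨-, c, hc, h⟩ := id hG
  have hb : ∀ v, ‖v‖ ≤ c⁻¹ * ‖Γ v‖ := fun v => by
    rcases eq_or_ne v 0 with rfl | hv
    · simp
    have h1 : c * ‖v‖ ^ 2 ≤ ‖Γ v‖ * ‖v‖ := (h v).trans <| by
      rw [hΓa]
      exact (Complex.re_le_norm _).trans (norm_inner_le_norm _ _)
    have hv' : 0 < ‖v‖ := norm_pos_iff.2 hv
    rw [← div_eq_inv_mul, le_div_iff₀ hc]
    nlinarith
  have hanti : AntilipschitzWith ⟨c⁻¹, by positivity⟩ Γ :=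
    AddMonoidHomClass.antilipschitz_of_bound Γ hb
  -- The Lax–Milgram argument: coercivity bounds `Γ` from below, so its range is closed, and a
  -- vector `x` orthogonal to the range satisfies `G x x = 0`.
  have hclosed : IsClosed (LinearMap.range (Γ : H →ₗ[ℂ] H) : Set H) := by
    have := hanti.isClosed_range Γ.uniformContinuous
    simpa [LinearMap.coe_range] using this
  have hrange : LinearMap.range (Γ : H →ₗ[ℂ] H) = ⊤ := by
    have : CompleteSpace (LinearMap.range (Γ : H →ₗ[ℂ] H)) := hclosed.completeSpace_coe
    rw [← Submodule.orthogonal_eq_bot_iff, Submodule.eq_bot_iff]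
    intro x hx
    refine hG.eq_zero ?_
    rw [hΓa]
    exact hx _ ⟨x, rfl⟩
  exact ⟨ContinuousLinearEquiv.ofBijective Γ (LinearMap.ker_eq_bot.2 hanti.injective) hrange,
    fun v w => by simpa using hΓa v w⟩

/-- The form of a Krein space in terms of the reference scalar product. -/
theorem IsKrein.exists_equiv {Q : H →L⋆[ℂ] H →L[ℂ] ℂ} (hQ : IsKrein Q) :
    ∃ Γ : H ≃L[ℂ] H, ∀ v w, Q v w = ⟪Γ v, w⟫_ℂ := by
  obtain ⟨-, S, hS, -, G, hG, hGQ⟩ := hQ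
  obtain ⟨Γ, hΓ⟩ := hG.exists_equiv
  have hSS : ∀ w, S (S w) = w := fun w => congrArg (fun A : H →L[ℂ] H => A w) hS
  have hS' : ∀ w, S.adjoint (S.adjoint w) = w := fun w => by
    refine ext_inner_right ℂ fun x => ?_
    rw [ContinuousLinearMap.adjoint_inner_left, ContinuousLinearMap.adjoint_inner_left, hSS]
  -- Since `S² = 1`, one has `Q v w = G v (S w) = ⟪S* Γ v, w⟫`, and `S*` is again an involution.
  refine ⟨Γ.trans (ContinuousLinearEquiv.equivOfInverse S.adjoint S.adjoint hS' hS'), fun v w => ?_⟩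
  simp only [ContinuousLinearEquiv.trans_apply, ContinuousLinearEquiv.equivOfInverse_apply,
    ContinuousLinearMap.adjoint_inner_left]
  rw [← hΓ, hGQ, hSS]

end Complete

/-- Conjugation is trivial on real scalars, so a sesquilinear form is bounded and bilinear over `ℝ`,
which suffices for a product rule in a real variable. -/
theorem hasDerivWithinAt_form (G : H →L⋆[ℂ] H →L[ℂ] ℂ) {x y : ℝ → H} {x' y' : H} {s : Set ℝ}
    {t : ℝ} (hx : HasDerivWithinAt x x' s t) (hy : HasDerivWithinAt y y' s t) :
    HasDerivWithinAt (fun r => G (x r) (y r)) (G x' (y t) + G (x t) y') s t := by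
  have hG : IsBoundedBilinearMap ℝ (fun p : H × H => G p.1 p.2) :=
    { add_left := fun x₁ x₂ y => by simp
      smul_left := fun c x y => by
        have := G.map_smulₛₗ (c : ℂ) x
        simp only [Complex.conj_ofReal, Complex.coe_smul] at this
        simp [this]
      add_right := fun x y₁ y₂ => by simp
      smul_right := fun c x y => by simp
      bound := ⟨‖G‖ + 1, by positivity, fun x y => (G.le_opNorm₂ x y).trans (by
        gcongr; linarith)⟩ }
  have h1 := (hG.hasFDerivAt (x t, y t)).comp_hasDerivWithinAt t (hx.prodMk hy)
  refine h1.congr_deriv ?_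
  simp [IsBoundedBilinearMap.deriv, add_comm]

/-- The formulation by graphs avoids elements of the domain as a subtype; all later arguments on
unbounded operators use it. -/
theorem isFormAdjoint_iff {H : Type*} [NormedAddCommGroup H] [InnerProductSpace ℂ H]
    {F : H → H → ℂ} {M N : H →ₗ.[ℂ] H} : IsFormAdjoint F M N ↔
      ∀ v u, (v, u) ∈ N.graph ↔ ∀ w w', (w, w') ∈ M.graph → F u w = F v w' := by
  refine forall₂_congr fun v u => iff_congr Iff.rfl
    ⟨fun h w w' hw => ?_, fun h w => h _ _ (M.mem_graph w)⟩
  obtain ⟨y, rfl, rfl⟩ := M.mem_graph_iff.1 hw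
  exact h y

end Forms

end KreinEvolution

namespace KreinEvolution

open Filter Topology
open scoped InnerProductSpace

/-! ### Unitary groups of bounded symmetric operators -/

section BoundedGroup

variable {H : Type*} [NormedAddCommGroup H] [InnerProductSpace ℂ H] [CompleteSpace H]
  {G : H →L⋆[ℂ] H →L[ℂ] ℂ}

/-- The group `exp(-iτA)` of a bounded operator `A`. -/
def boundedGroup (A : H →L[ℂ] H) (τ : ℝ) : H →L[ℂ] H := NormedSpace.exp (τ • (-(Complex.I • A)))

theorem boundedGroup_zero (A : H →L[ℂ] H) : boundedGroup A 0 = 1 := by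
  simp [boundedGroup]

theorem commute_boundedGroup {A C : H →L[ℂ] H} (h : Commute C A) (τ : ℝ) :
    Commute C (boundedGroup A τ) :=
  (((h.smul_right Complex.I).neg_right).smul_right τ).exp_right

theorem boundedGroup_neg_apply (A : H →L[ℂ] H) (τ : ℝ) (v : H) :
    boundedGroup A (-τ) (boundedGroup A τ v) = v := by
  have h : boundedGroup A (-τ) * boundedGroup A τ = 1 := by
    let _ : NormedAlgebra ℚ (H →L[ℂ] H) := NormedAlgebra.restrictScalars ℚ ℝ (H →L[ℂ] H)
    rw [boundedGroup, boundedGroup, ← NormedSpace.exp_add_of_commute]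
    · simp
    · exact ((Commute.refl _).smul_left _).smul_right _
  exact congrArg (fun B : H →L[ℂ] H => B v) h

theorem hasDerivAt_boundedGroup (A : H →L[ℂ] H) (v : H) (τ : ℝ) :
    HasDerivAt (fun r => boundedGroup A r v) (-(Complex.I • A (boundedGroup A τ v))) τ := by
  have h := hasDerivAt_exp_smul_const' (𝕂 := ℝ) (-(Complex.I • A)) τ
  exact (((ContinuousLinearMap.apply ℂ H v).restrictScalars ℝ).hasFDerivAt.comp_hasDerivAt τ h)

theorem hasDerivAt_boundedGroup' (A : H →L[ℂ] H) (v : H) (τ : ℝ) :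
    HasDerivAt (fun r => boundedGroup A r v) (-(Complex.I • boundedGroup A τ (A v))) τ := by
  have h := hasDerivAt_boundedGroup A v τ
  have h1 : A (boundedGroup A τ v) = boundedGroup A τ (A v) :=
    congrArg (fun B : H →L[ℂ] H => B v) (commute_boundedGroup (Commute.refl A) τ).eq
  rwa [h1] at h

/-- The derivative of the squared norm is `i (G (A x) x - G x (A x))`, which vanishes by symmetry.
-/
theorem boundedGroup_isometry {A : H →L[ℂ] H} (hA : ∀ u v, G (A u) v = G u (A v)) (v : H)
    (τ : ℝ) : G (boundedGroup A τ v) (boundedGroup A τ v) = G v v := by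
  have hd : ∀ r, HasDerivAt (fun r => G (boundedGroup A r v) (boundedGroup A r v)) 0 r := fun r => by
    have h := (hasDerivAt_boundedGroup A v r).hasDerivWithinAt (s := univ)
    have := hasDerivWithinAt_form G h h
    rw [hasDerivWithinAt_univ] at this
    refine this.congr_deriv ?_
    simp [hA]
  have := is_const_of_deriv_eq_zero (fun r => (hd r).differentiableAt) (fun r => (hd r).deriv) τ 0
  simpa [boundedGroup_zero] using this

theorem formNorm_boundedGroup {A : H →L[ℂ] H} (hA : ∀ u v, G (A u) v = G u (A v)) (v : H)
    (τ : ℝ) : formNorm G (boundedGroup A τ v) = formNorm G v := by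
  rw [formNorm, formNorm, boundedGroup_isometry hA]

theorem norm_boundedGroup_apply_le {k : ℝ} (hk0 : 0 < k)
    (hk : ∀ v, ‖v‖ ≤ k * formNorm G v ∧ formNorm G v ≤ k * ‖v‖)
    {A : H →L[ℂ] H} (hA : ∀ u v, G (A u) v = G u (A v)) (v : H) (τ : ℝ) :
    ‖boundedGroup A τ v‖ ≤ k * k * ‖v‖ := by
  refine (hk _).1.trans ?_
  rw [formNorm_boundedGroup hA, mul_assoc]
  exact mul_le_mul_of_nonneg_left (hk v).2 hk0.le

/-- Duhamel's formula: for commuting generators, `exp(iτB) exp(-iτA) v` has a derivative that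
contains only the fixed vector `A v - B v`. Three isometric factors are involved, two in the
derivative and one when `exp(iτB)` is removed, and each costs `k * k` in the reference norm. -/
theorem norm_boundedGroup_sub_le {k : ℝ} (hk0 : 0 < k)
    (hk : ∀ v, ‖v‖ ≤ k * formNorm G v ∧ formNorm G v ≤ k * ‖v‖)
    {A B : H →L[ℂ] H} (hA : ∀ u v, G (A u) v = G u (A v)) (hB : ∀ u v, G (B u) v = G u (B v))
    (hAB : Commute A B) (v : H) (τ : ℝ) :
    ‖boundedGroup A τ v - boundedGroup B τ v‖ ≤ (k * k) ^ 3 * ‖A v - B v‖ * |τ| := by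
  have hd : ∀ r, HasDerivAt (fun r => boundedGroup B (-r) (boundedGroup A r v))
      (-(Complex.I • boundedGroup B (-r) (boundedGroup A r (A v - B v)))) r := fun r => by
    have h1 : HasDerivAt (fun r => boundedGroup B (-r) (boundedGroup A r v))
        (Complex.I • boundedGroup B (-r) (B (boundedGroup A r v)) +
          boundedGroup B (-r) (-(Complex.I • A (boundedGroup A r v)))) r := by
      have h2 := hasDerivWithinAt_clm_apply (R := fun r => boundedGroup B (-r)) (s := univ) (t := r)
        (M := k * k) (x := fun r => boundedGroup A r v)
        (y := Complex.I • boundedGroup B (-r) (B (boundedGroup A r v)))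
        (x' := -(Complex.I • A (boundedGroup A r v)))
        (Eventually.of_forall fun r => ContinuousLinearMap.opNorm_le_bound _ (by positivity)
          fun w => norm_boundedGroup_apply_le hk0 hk hB w _) ?_ ?_
        (hasDerivAt_boundedGroup A v r).hasDerivWithinAt
      · rwa [hasDerivWithinAt_univ] at h2
      · rw [hasDerivWithinAt_univ]
        have := (hasDerivAt_boundedGroup' B (boundedGroup A r v) (-r)).scomp r (hasDerivAt_neg r)
        simpa [Function.comp_def] using this
      · refine ContinuousAt.continuousWithinAt ?_
        exact ((hasDerivAt_boundedGroup B (-(Complex.I • A (boundedGroup A r v))) (-r)).scomp r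
          (hasDerivAt_neg r)).continuousAt
    refine h1.congr_deriv ?_
    have h2 : A (boundedGroup A r v) = boundedGroup A r (A v) :=
      congrArg (fun B : H →L[ℂ] H => B v) (commute_boundedGroup (Commute.refl A) r).eq
    have h3 : B (boundedGroup A r v) = boundedGroup A r (B v) :=
      congrArg (fun B : H →L[ℂ] H => B v) (commute_boundedGroup hAB.symm r).eq
    rw [h2, h3]
    simp only [map_neg, map_smul, map_sub, smul_sub]
    abel
  have hb : ∀ r, ‖-(Complex.I • boundedGroup B (-r) (boundedGroup A r (A v - B v)))‖ ≤
      (k * k) ^ 2 * ‖A v - B v‖ := fun r => by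
    rw [norm_neg, norm_smul, Complex.norm_I, one_mul, sq, mul_assoc]
    exact (norm_boundedGroup_apply_le hk0 hk hB _ _).trans
      (mul_le_mul_of_nonneg_left (norm_boundedGroup_apply_le hk0 hk hA _ _) (by positivity))
  have h1 := (convex_univ).norm_image_sub_le_of_norm_hasDerivWithin_le
    (fun r _ => (hd r).hasDerivWithinAt) (fun r _ => hb r) (mem_univ 0) (mem_univ τ)
  simp only [neg_zero, boundedGroup_zero, one_apply_eq_self, sub_zero,
    Real.norm_eq_abs] at h1
  have h2 : boundedGroup A τ v - boundedGroup B τ v =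
      boundedGroup B τ (boundedGroup B (-τ) (boundedGroup A τ v) - v) := by
    have := boundedGroup_neg_apply B (-τ) (boundedGroup A τ v)
    rw [neg_neg] at this
    rw [map_sub, this]
  rw [h2]
  refine (norm_boundedGroup_apply_le hk0 hk hB _ _).trans
    ((mul_le_mul_of_nonneg_left h1 (by positivity)).trans_eq (by ring))

end BoundedGroup

/-! ### Resolvents of unbounded self-adjoint operators -/

section SelfAdjoint

variable {H : Type*} [NormedAddCommGroup H] [InnerProductSpace ℂ H]
  {G : H →L⋆[ℂ] H →L[ℂ] ℂ} {A : H →ₗ.[ℂ] H}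

theorem IsSelfAdjointFor.symm (hA : IsSelfAdjointFor G A) {v u w x : H} (h : (v, u) ∈ A.graph)
    (h' : (w, x) ∈ A.graph) : G u w = G v x :=
  (isFormAdjoint_iff.1 hA.2 v u).1 h w x h'

theorem IsSelfAdjointFor.mem_graph (hA : IsSelfAdjointFor G A) {v u : H}
    (h : ∀ w x, (w, x) ∈ A.graph → G u w = G v x) : (v, u) ∈ A.graph :=
  (isFormAdjoint_iff.1 hA.2 v u).2 h

theorem IsSelfAdjointFor.mem_graph_of_tendsto (hA : IsSelfAdjointFor G A) {v u : ℕ → H} {v' u' : H}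
    (h : ∀ n, (v n, u n) ∈ A.graph) (hv : Tendsto v atTop (𝓝 v')) (hu : Tendsto u atTop (𝓝 u')) :
    (v', u') ∈ A.graph := by
  refine hA.mem_graph fun w x hw => ?_
  have hc : ∀ y : H, Continuous fun z => G z y := fun y =>
    (ContinuousLinearMap.apply ℂ ℂ y).continuous.comp G.continuous
  refine tendsto_nhds_unique (((hc w).tendsto u').comp hu) ?_
  refine (((hc x).tendsto v').comp hv).congr fun n => ?_
  exact (hA.symm (h n) hw).symm

/-- For a symmetric operator the cross terms cancel: the squared norm of `v + ilu` is that of `v`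
plus `l²` times that of `u`. This gives injectivity and closed range of `1 + ilA`, and the
contraction property of its inverse. -/
theorem IsSelfAdjointFor.formNorm_le (hA : IsSelfAdjointFor G A) (hG : IsCompatibleScalarProduct G)
    (l : ℝ) {v u : H} (h : (v, u) ∈ A.graph) :
    formNorm G v ≤ formNorm G (v + (l * Complex.I) • u) := by
  refine Real.sqrt_le_sqrt ?_
  have h1 := hA.symm h h
  have h2 : G (v + (l * Complex.I) • u) (v + (l * Complex.I) • u) =
      G v v + ((l ^ 2 : ℝ) : ℂ) * G u u := by
    simp only [map_add, map_smulₛₗ, add_apply, RingHom.id_apply,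
      smul_apply, smul_eq_mul, h1, map_mul, Complex.conj_ofReal, Complex.conj_I]
    push_cast
    linear_combination (-(l : ℂ) ^ 2 * G u u) * Complex.I_sq
  rw [h2, Complex.add_re, Complex.re_ofReal_mul]
  have := hG.re_nonneg u
  nlinarith [sq_nonneg l, mul_nonneg (sq_nonneg l) this]

theorem graph_add {v u w x : H} (h : (v, u) ∈ A.graph) (h' : (w, x) ∈ A.graph) :
    (v + w, u + x) ∈ A.graph := A.graph.add_mem h h'

theorem graph_sub {v u w x : H} (h : (v, u) ∈ A.graph) (h' : (w, x) ∈ A.graph) :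
    (v - w, u - x) ∈ A.graph := A.graph.sub_mem h h'

theorem graph_smul (c : ℂ) {v u : H} (h : (v, u) ∈ A.graph) : (c • v, c • u) ∈ A.graph :=
  A.graph.smul_mem c h

/-- `R` is the resolvent `(1 + ilA)⁻¹`, a contraction for `G`. -/
structure IsResolvent (G : H →L⋆[ℂ] H →L[ℂ] ℂ) (A : H →ₗ.[ℂ] H) (l : ℝ) (R : H →L[ℂ] H) :
    Prop where
  mem : ∀ f, ∃ u, (R f, u) ∈ A.graph ∧ R f + (l * Complex.I) • u = f
  apply_eq : ∀ v u, (v, u) ∈ A.graph → R (v + (l * Complex.I) • u) = v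
  formNorm_le : ∀ f, formNorm G (R f) ≤ formNorm G f

variable [CompleteSpace H]

/-- The basic criterion for self-adjointness: the range of `1 + ilA` is closed, and its orthogonal
complement vanishes because a self-adjoint operator has no imaginary eigenvalue. -/
theorem IsSelfAdjointFor.exists_mem_graph_add_eq (hA : IsSelfAdjointFor G A)
    (hG : IsCompatibleScalarProduct G) {l : ℝ} (hl : l ≠ 0) (f : H) :
    ∃ v u, (v, u) ∈ A.graph ∧ v + (l * Complex.I) • u = f := by
  have hl' : (l * Complex.I : ℂ) ≠ 0 := by simp [hl]
  obtain ⟨k, hk0, hk⟩ := hG.exists_equiv_norm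
  set L : H × H →ₗ[ℂ] H := LinearMap.fst ℂ H H + (l * Complex.I) • LinearMap.snd ℂ H H with hL
  set S : Submodule ℂ H := A.graph.map L with hS
  have hmem : ∀ f, f ∈ S ↔ ∃ v u, (v, u) ∈ A.graph ∧ v + (l * Complex.I) • u = f := fun f => by
    simp only [hS, hL, Submodule.mem_map, Prod.exists]
    rfl
  have hclosed : IsClosed (S : Set H) := by
    refine IsSeqClosed.isClosed fun fn f hfn hf => ?_
    choose v u hvu hf' using fun n => (hmem _).1 (hfn n)
    have hvc : CauchySeq v := by
      have hfc := hf.cauchySeq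
      rw [Metric.cauchySeq_iff] at hfc ⊢
      intro ε hε
      obtain ⟨N, hN⟩ := hfc (ε / (k * k)) (by positivity)
      refine ⟨N, fun m hm n hn => ?_⟩
      have h1 := hA.formNorm_le hG l (graph_sub (hvu m) (hvu n))
      have h2 : v m - v n + (l * Complex.I) • (u m - u n) = fn m - fn n := by
        rw [← hf', ← hf', smul_sub]; abel
      rw [h2] at h1
      have h3 := hN m hm n hn
      rw [dist_eq_norm, lt_div_iff₀ (by positivity)] at h3
      rw [dist_eq_norm]
      calc ‖v m - v n‖ ≤ k * formNorm G (v m - v n) := (hk _).1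
        _ ≤ k * (k * ‖fn m - fn n‖) := by gcongr; exact h1.trans (hk _).2
        _ < ε := by linarith
    obtain ⟨v', hv'⟩ := cauchySeq_tendsto_of_complete hvc
    have hu' : Tendsto u atTop (𝓝 ((l * Complex.I : ℂ)⁻¹ • (f - v'))) := by
      refine ((hf.sub hv').const_smul _).congr fun n => ?_
      rw [← hf' n, add_sub_cancel_left, smul_smul, inv_mul_cancel₀ hl', one_smul]
    refine (hmem f).2 ⟨v', _, hA.mem_graph_of_tendsto hvu hv' hu', ?_⟩
    rw [smul_smul, mul_inv_cancel₀ hl', one_smul]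
    abel
  have hS' : S = ⊤ := by
    have : CompleteSpace S := hclosed.completeSpace_coe
    rw [← Submodule.orthogonal_eq_bot_iff, Submodule.eq_bot_iff]
    intro x hx
    obtain ⟨Γ, hΓ⟩ := hG.exists_equiv
    have hx' : ∀ v u, (v, u) ∈ A.graph → G (Γ.symm x) (v + (l * Complex.I) • u) = 0 := fun v u h => by
      rw [hΓ, ContinuousLinearEquiv.apply_symm_apply]
      exact Submodule.inner_left_of_mem_orthogonal ((hmem _).2 ⟨v, u, h, rfl⟩) hx
    set y := Γ.symm x with hy
    -- A vector that is `G`-orthogonal to the range belongs to the domain by self-adjointness, and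
    -- is an eigenvector there. The eigenvalue is not real, so the symmetry relation forces `G y y =
    -- 0`.
    have hyg : (y, (l * Complex.I : ℂ)⁻¹ • y) ∈ A.graph := by
      refine hA.mem_graph fun w z hw => ?_
      have h1 := hx' w z hw
      rw [map_add, map_smul, smul_eq_mul, add_eq_zero_iff_eq_neg] at h1
      rw [map_smulₛₗ, smul_apply, h1]
      simp only [map_inv₀, map_mul, Complex.conj_ofReal, Complex.conj_I, smul_eq_mul]
      have hl2 : (l : ℂ) ≠ 0 := by exact_mod_cast hl
      field_simp
    have h4 := hA.symm hyg hyg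
    have hyy : G y y = 0 := by
      rw [map_smulₛₗ, smul_apply, map_smul, smul_eq_mul, smul_eq_mul,
        ← sub_eq_zero, ← sub_mul] at h4
      rcases mul_eq_zero.1 h4 with h | h
      · exfalso
        simp only [map_inv₀, map_mul, Complex.conj_ofReal, Complex.conj_I, sub_eq_zero,
          inv_inj, mul_neg] at h
        exact hl' (self_eq_neg.1 h.symm)
      · exact h
    have hy0 := hG.eq_zero hyy
    rw [hy] at hy0
    simpa using hy0
  exact (hmem f).1 (hS' ▸ Submodule.mem_top)

theorem IsSelfAdjointFor.exists_isResolvent (hA : IsSelfAdjointFor G A)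
    (hG : IsCompatibleScalarProduct G) {l : ℝ} (hl : l ≠ 0) : ∃ R, IsResolvent G A l R := by
  obtain ⟨k, hk0, hk⟩ := hG.exists_equiv_norm
  choose R U hRU hR using hA.exists_mem_graph_add_eq hG hl
  have huniq : ∀ v u, (v, u) ∈ A.graph → R (v + (l * Complex.I) • u) = v := fun v u h => by
    have h1 := hA.formNorm_le hG l (graph_sub (hRU (v + (l * Complex.I) • u)) h)
    have h2 : R (v + (l * Complex.I) • u) - v + (l * Complex.I) •
        (U (v + (l * Complex.I) • u) - u) = 0 := by
      have := hR (v + (l * Complex.I) • u)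
      rw [← sub_eq_zero.2 this, smul_sub]
      abel
    rw [h2] at h1
    have h3 : formNorm G (0 : H) = 0 := by simp [formNorm]
    have h4 := (hk (R (v + (l * Complex.I) • u) - v)).1
    rw [h3] at h1
    have h5 : ‖R (v + (l * Complex.I) • u) - v‖ ≤ 0 := h4.trans (by nlinarith)
    exact sub_eq_zero.1 (norm_le_zero_iff.1 h5)
  have hle : ∀ f, formNorm G (R f) ≤ formNorm G f := fun f => by
    have := hA.formNorm_le hG l (hRU f)
    rwa [hR] at this
  refine ⟨LinearMap.mkContinuous
    { toFun := R
      map_add' := fun f g => by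
        rw [← huniq _ _ (graph_add (hRU f) (hRU g))]
        congr 1
        conv_lhs => rw [← hR f, ← hR g]
        rw [smul_add]; abel
      map_smul' := fun c f => by
        simp only [RingHom.id_apply]
        rw [← huniq _ _ (graph_smul c (hRU f))]
        congr 1
        conv_lhs => rw [← hR f]
        rw [smul_add, smul_comm] } (k * k) (fun f => ?_), ⟨fun f => ⟨U f, hRU f, hR f⟩, huniq, hle⟩⟩
  rw [mul_assoc]
  exact (hk _).1.trans (mul_le_mul_of_nonneg_left ((hle f).trans (hk f).2) hk0.le)

omit [CompleteSpace H] in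
-- The vector `R (S f)` is in the domain of `A²`, since `S f` and `R (S f)` are both in the domain
-- of `A` and `y` is a multiple of their difference. On it the factors `1 + ilA` and `1 + imA` can
-- be undone in the opposite order.
theorem IsResolvent.commute {l m : ℝ} (hl : l ≠ 0) {R S : H →L[ℂ] H} (hR : IsResolvent G A l R)
    (hS : IsResolvent G A m S) : Commute R S := by
  have hl' : (l * Complex.I : ℂ) ≠ 0 := by simp [hl]
  ext f
  obtain ⟨u, hu, hf⟩ := hS.mem f
  obtain ⟨y, hy, hg⟩ := hR.mem (S f)
  have hy' : y = (l * Complex.I : ℂ)⁻¹ • (S f - R (S f)) := by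
    rw [eq_sub_of_add_eq' hg |>.symm, smul_smul, inv_mul_cancel₀ hl', one_smul]
  have hz := graph_smul (l * Complex.I : ℂ)⁻¹ (graph_sub hu hy)
  rw [← hy'] at hz
  have h1 := hR.apply_eq _ _ (graph_add hy (graph_smul (m * Complex.I) hz))
  have h2 : R (S f) + (m * Complex.I) • y + (l * Complex.I) •
      (y + (m * Complex.I) • ((l * Complex.I : ℂ)⁻¹ • (u - y))) = f := by
    rw [smul_add, smul_comm (l * Complex.I : ℂ) (m * Complex.I : ℂ), smul_smul (l * Complex.I : ℂ),
      mul_inv_cancel₀ hl', one_smul]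
    conv_rhs => rw [← hf, ← hg]
    rw [smul_sub]; abel
  rw [h2] at h1
  have h3 := hS.apply_eq _ _ hy
  rw [← h1] at h3
  exact h3.symm

omit [CompleteSpace H] in
-- The resolvents at `l` and `-l` are adjoint to each other. This makes the approximations in
-- `IsSelfAdjointFor.exists_approx` symmetric.
theorem IsResolvent.symm (hA : IsSelfAdjointFor G A) {l : ℝ} {R S : H →L[ℂ] H}
    (hR : IsResolvent G A l R) (hS : IsResolvent G A (-l) S) (f g : H) : G (R f) g = G f (S g) := by
  obtain ⟨u, hu, hf⟩ := hR.mem f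
  obtain ⟨y, hy, hg⟩ := hS.mem g
  have h1 := hA.symm hu hy
  conv_lhs => rw [← hg]
  conv_rhs => rw [← hf]
  simp only [map_add, map_smulₛₗ, add_apply, RingHom.id_apply,
      smul_apply, smul_eq_mul, h1, map_mul, Complex.conj_ofReal, Complex.conj_I]
  push_cast
  ring

end SelfAdjoint

end KreinEvolution

namespace KreinEvolution

open Filter Topology

/-! ### Uniform convergence along moving vectors -/

section UniformConvergence

variable {E F : Type*} [NormedAddCommGroup E] [NormedSpace ℂ E]
  [NormedAddCommGroup F] [NormedSpace ℂ F]

theorem tendstoUniformlyOn_clm_apply {α : Type*} {g : ℕ → α → E →L[ℂ] F} {T : α → E →L[ℂ] F}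
    {x : ℕ → α → E} {y : α → E} {s : Set α} {M : ℝ} (hM : ∀ n, ∀ t ∈ s, ‖g n t‖ ≤ M)
    (hg : TendstoUniformlyOn (fun n t => g n t (y t)) (fun t => T t (y t)) atTop s)
    (hx : TendstoUniformlyOn x y atTop s) :
    TendstoUniformlyOn (fun n t => g n t (x n t)) (fun t => T t (y t)) atTop s := by
  rw [Metric.tendstoUniformlyOn_iff] at hg hx ⊢
  intro ε hε
  filter_upwards [hg (ε / 2) (by positivity), hx (ε / (2 * (|M| + 1))) (by positivity)]
    with n h1 h2 t ht
  have h3 := h2 t ht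
  have h4 : ‖g n t (y t - x n t)‖ ≤ (|M| + 1) * ‖y t - x n t‖ :=
    (g n t).le_of_opNorm_le ((hM n t ht).trans (by linarith [le_abs_self M])) _
  rw [dist_eq_norm, lt_div_iff₀ (by positivity)] at h3
  have h5 := dist_triangle (T t (y t)) (g n t (y t)) (g n t (x n t))
  have h6 := h1 t ht
  rw [dist_eq_norm (g n t (y t)), ← map_sub] at h5
  linarith

theorem tendsto_clm_of_dense [CompleteSpace E] [CompleteSpace F] {g : ℕ → E →L[ℂ] F}
    {T : E →L[ℂ] F} {M : ℝ} (hM : ∀ n, ‖g n‖ ≤ M) {D : Set E} (hD : Dense D)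
    (h : ∀ v ∈ D, Tendsto (fun n => g n v) atTop (𝓝 (T v))) (v : E) :
    Tendsto (fun n => g n v) atTop (𝓝 (T v)) := by
  have hc := fun v => (uniformCauchySeqOn_of_dense (g := fun n (_ : Unit) => g n) (s := univ)
    (fun n _ _ => hM n) hD (fun v hv => by
      have := (h v hv).tendstoUniformlyOn_const (univ : Set Unit)
      exact this.uniformCauchySeqOn) v).cauchySeq (mem_univ ())
  obtain ⟨T', hT'⟩ := exists_clm_of_cauchySeq hc
  have : T' = T := ContinuousLinearMap.coeFn_injective
    (Continuous.ext_on hD T'.continuous T.continuous fun v hv =>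
      tendsto_nhds_unique (hT' v) (h v hv))
  exact this ▸ hT' v

end UniformConvergence

/-! ### Stone's theorem -/

section Stone

variable {H : Type*} [NormedAddCommGroup H] [InnerProductSpace ℂ H]
  {G : H →L⋆[ℂ] H →L[ℂ] ℂ} {A : H →ₗ.[ℂ] H}

/-- `T τ = exp(-iτA)` is a strongly continuous group of isometries for `G`, generated by the
self-adjoint operator `A`. -/
structure IsIsometryGroup (G : H →L⋆[ℂ] H →L[ℂ] ℂ) (A : H →ₗ.[ℂ] H) (T : ℝ → H →L[ℂ] H) :
    Prop where
  zero : T 0 = ContinuousLinearMap.id ℂ H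
  neg_apply : ∀ τ v, T (-τ) (T τ v) = v
  continuous : ∀ v, Continuous fun τ => T τ v
  formNorm_eq : ∀ τ v, formNorm G (T τ v) = formNorm G v
  hasDerivAt : ∀ v u, (v, u) ∈ A.graph →
    ∀ τ, HasDerivAt (fun r => T r v) (-(Complex.I • T τ u)) τ
  mem_graph : ∀ v u, (v, u) ∈ A.graph → ∀ τ, (T τ v, T τ u) ∈ A.graph

theorem IsIsometryGroup.norm_le {T : ℝ → H →L[ℂ] H} (hT : IsIsometryGroup G A T)
    (hG : IsCompatibleScalarProduct G) : ∃ M, ∀ τ, ‖T τ‖ ≤ M := by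
  obtain ⟨k, hk0, hk⟩ := hG.exists_equiv_norm
  refine ⟨k * k, fun τ => ContinuousLinearMap.opNorm_le_bound _ (by positivity) fun v => ?_⟩
  refine (hk _).1.trans ?_
  rw [hT.formNorm_eq, mul_assoc]
  exact mul_le_mul_of_nonneg_left (hk v).2 hk0.le

theorem continuous_form_left (G : H →L⋆[ℂ] H →L[ℂ] ℂ) (y : H) : Continuous fun z => G z y :=
  (ContinuousLinearMap.apply ℂ ℂ y).continuous.comp G.continuous

theorem continuous_form (G : H →L⋆[ℂ] H →L[ℂ] ℂ) : Continuous fun p : H × H => G p.1 p.2 :=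
  (G.continuous.comp continuous_fst).clm_apply continuous_snd

variable [CompleteSpace H]

/-- On the domain, `R v - v = -il R (A v)` tends to zero with `l`; the contraction property extends
this to all vectors. -/
theorem IsResolvent.tendsto (hA : IsSelfAdjointFor G A) (hG : IsCompatibleScalarProduct G)
    {l : ℕ → ℝ} {R : ℕ → H →L[ℂ] H} (hR : ∀ n, IsResolvent G A (l n) (R n))
    (hl : Tendsto l atTop (𝓝 0)) (f : H) : Tendsto (fun n => R n f) atTop (𝓝 f) := by
  obtain ⟨k, hk0, hk⟩ := hG.exists_equiv_norm
  have hb : ∀ n f, ‖R n f‖ ≤ k * k * ‖f‖ := fun n f => by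
    refine (hk _).1.trans ?_
    rw [mul_assoc]
    exact mul_le_mul_of_nonneg_left (((hR n).formNorm_le f).trans (hk f).2) hk0.le
  refine tendsto_clm_of_dense (T := ContinuousLinearMap.id ℂ H) (M := k * k)
    (fun n => ContinuousLinearMap.opNorm_le_bound _ (by positivity) (hb n)) hA.1 (fun v hv => ?_) f
  obtain ⟨u, hu⟩ := LinearPMap.mem_domain_iff.1 hv
  rw [ContinuousLinearMap.id_apply, tendsto_iff_norm_sub_tendsto_zero]
  have h1 : Tendsto (fun n => |l n| * (k * k * ‖u‖)) atTop (𝓝 0) := by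
    simpa using hl.abs.mul_const (k * k * ‖u‖)
  refine squeeze_zero (fun _ => norm_nonneg _) (fun n => ?_) h1
  have h2 := (hR n).apply_eq v u hu
  rw [map_add, map_smul] at h2
  have h3 : R n v - v = -((l n * Complex.I) • R n u) := by
    nth_rewrite 2 [← h2]; abel
  rw [h3, norm_neg, norm_smul, norm_mul, Complex.norm_I, mul_one, Complex.norm_real,
    Real.norm_eq_abs]
  exact mul_le_mul_of_nonneg_left (hb n u) (abs_nonneg _)

/-- Bounded self-adjoint approximations of a self-adjoint operator. -/
theorem IsSelfAdjointFor.exists_approx (hA : IsSelfAdjointFor G A)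
    (hG : IsCompatibleScalarProduct G) : ∃ Y : ℕ → H →L[ℂ] H,
      (∀ n u v, G (Y n u) v = G u (Y n v)) ∧ (∀ n m, Commute (Y n) (Y m)) ∧
      ∀ v u, (v, u) ∈ A.graph → Tendsto (fun n => Y n v) atTop (𝓝 u) := by
  set e : ℕ → ℝ := fun n => 1 / ((n : ℝ) + 1) with he
  have he0 : ∀ n, e n ≠ 0 := fun n => by
    have : (0 : ℝ) < n + 1 := by positivity
    simp only [he]; positivity
  have helim : Tendsto e atTop (𝓝 0) := tendsto_one_div_add_atTop_nhds_zero_nat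
  choose R hR using fun n => hA.exists_isResolvent hG (he0 n)
  choose S hS using fun n => hA.exists_isResolvent hG (neg_ne_zero.2 (he0 n))
  have hc : ∀ n, (starRingEnd ℂ) (2 * e n * Complex.I)⁻¹ = -(2 * e n * Complex.I)⁻¹ := fun n => by
    have : (starRingEnd ℂ) 2 = 2 := map_ofNat _ 2
    simp [this]
  -- With `R = (1 + ieA)⁻¹` and `S = (1 - ieA)⁻¹` this is `A (1 + e²A²)⁻¹`. It is symmetric because
  -- `R* = S` and the prefactor is imaginary.
  refine ⟨fun n => (2 * e n * Complex.I : ℂ)⁻¹ • (S n - R n), fun n u v => ?_, fun n m => ?_,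
    fun v u h => ?_⟩
  · have h1 := (hR n).symm hA (hS n) u v
    have h2 := (hS n).symm hA ((neg_neg (e n)).symm ▸ hR n) u v
    simp only [smul_apply, sub_apply, map_sub, map_smul, smul_eq_mul, map_smulₛₗ, hc, h1, h2]
    ring
  · have h1 := (hS n).commute (neg_ne_zero.2 (he0 n)) (hS m)
    have h2 := (hS n).commute (neg_ne_zero.2 (he0 n)) (hR m)
    have h3 := (hR n).commute (he0 n) (hS m)
    have h4 := (hR n).commute (he0 n) (hR m)
    exact (((h1.sub_right h2).sub_left (h3.sub_right h4)).smul_left _).smul_right _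
  · have h1 : Tendsto (fun n => (2 : ℂ)⁻¹ • (R n u + S n u)) atTop (𝓝 ((2 : ℂ)⁻¹ • (u + u))) :=
      ((IsResolvent.tendsto hA hG hR helim u).add
        (IsResolvent.tendsto hA hG hS (by simpa using helim.neg) u)).const_smul _
    have h2 : (2 : ℂ)⁻¹ • (u + u) = u := by
      rw [← two_smul ℂ u, smul_smul]; norm_num
    rw [h2] at h1
    refine h1.congr fun n => ?_
    have h3 := (hR n).apply_eq v u h
    have h4 := (hS n).apply_eq v u h
    rw [map_add, map_smul] at h3 h4
    have h5 : S n v - R n v = (e n * Complex.I) • (R n u + S n u) := by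
      rw [eq_sub_of_add_eq h3, eq_sub_of_add_eq h4]
      push_cast
      module
    have h6 : (e n : ℂ) ≠ 0 := by exact_mod_cast he0 n
    simp only [smul_apply, sub_apply]
    rw [h5, smul_smul]
    congr 1
    field_simp

/-- Stone's theorem: a self-adjoint operator generates a group of isometries. -/
theorem IsSelfAdjointFor.exists_group (hA : IsSelfAdjointFor G A)
    (hG : IsCompatibleScalarProduct G) : ∃ T, IsIsometryGroup G A T := by
  obtain ⟨k, hk0, hk⟩ := hG.exists_equiv_norm
  obtain ⟨Y, hYs, hYc, hYt⟩ := hA.exists_approx hG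
  set U : ℕ → ℝ → H →L[ℂ] H := fun n => boundedGroup (Y n) with hU
  have hUb : ∀ n τ, ‖U n τ‖ ≤ k * k := fun n τ =>
    ContinuousLinearMap.opNorm_le_bound _ (by positivity) fun v =>
      norm_boundedGroup_apply_le hk0 hk (hYs n) v τ
  -- On the domain, `norm_boundedGroup_sub_le` bounds the difference of two approximating groups by
  -- that of `Y m v` and `Y n v`, times `|τ|`.
  have hcauchy : ∀ L v, UniformCauchySeqOn (fun n τ => U n τ v) atTop (Icc (-L) L) := fun L v => by
    refine uniformCauchySeqOn_of_dense (fun n τ _ => hUb n τ) hA.1 (fun v hv => ?_) v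
    obtain ⟨u, hu⟩ := LinearPMap.mem_domain_iff.1 hv
    rw [Metric.uniformCauchySeqOn_iff]
    intro ε hε
    have hYv := (hYt v u hu).cauchySeq
    rw [Metric.cauchySeq_iff] at hYv
    obtain ⟨N, hN⟩ := hYv (ε / ((k * k) ^ 3 * (|L| + 1))) (by positivity)
    refine ⟨N, fun m hm n hn τ hτ => ?_⟩
    have h1 := hN m hm n hn
    rw [dist_eq_norm, lt_div_iff₀ (by positivity)] at h1
    have h2 := norm_boundedGroup_sub_le hk0 hk (hYs m) (hYs n) (hYc m n) v τ
    have h3 : |τ| ≤ |L| + 1 := by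
      have := (abs_le.2 hτ).trans (le_abs_self L)
      linarith
    rw [dist_eq_norm]
    refine h2.trans_lt (lt_of_le_of_lt (mul_le_mul_of_nonneg_left h3 (by positivity)) ?_)
    linarith
  have hmem : ∀ τ : ℝ, τ ∈ Icc (-|τ|) |τ| := fun τ => ⟨neg_abs_le τ, le_abs_self τ⟩
  choose T hT using fun τ => exists_clm_of_cauchySeq (g := fun n => U n τ)
    fun v => (hcauchy |τ| v).cauchySeq (hmem τ)
  have hTu : ∀ L v, TendstoUniformlyOn (fun n τ => U n τ v) (fun τ => T τ v) atTop (Icc (-L) L) :=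
    fun L v => (hcauchy L v).tendstoUniformlyOn_of_tendsto fun τ _ => hT τ v
  have hUc : ∀ n v, Continuous fun τ => U n τ v := fun n v =>
    continuous_iff_continuousAt.2 fun τ => (hasDerivAt_boundedGroup (Y n) v τ).continuousAt
  have hnhds : ∀ τ : ℝ, Icc (-(|τ| + 1)) (|τ| + 1) ∈ 𝓝 τ := fun τ =>
    Icc_mem_nhds (by linarith [neg_abs_le τ]) (by linarith [le_abs_self τ])
  have hTc : ∀ v, Continuous fun τ => T τ v := fun v =>
    continuous_iff_continuousAt.2 fun τ => ((hTu (|τ| + 1) v).continuousOn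
      (Eventually.frequently (Eventually.of_forall fun n => (hUc n v).continuousOn))).continuousAt (hnhds τ)
  have hUz : ∀ {z : ℕ → H} {z' : H}, Tendsto z atTop (𝓝 z') → ∀ L,
      TendstoUniformlyOn (fun n τ => U n τ (z n)) (fun τ => T τ z') atTop (Icc (-L) L) :=
    fun {z z'} hz L => tendstoUniformlyOn_clm_apply (y := fun _ => z') (fun n τ _ => hUb n τ)
      (hTu L z') (hz.tendstoUniformlyOn_const _)
  refine ⟨T, ?_, ?_, hTc, ?_, ?_, ?_⟩
  · ext v
    refine tendsto_nhds_unique (hT 0 v) ?_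
    simp [hU, boundedGroup_zero]
  · intro τ v
    have h1 : TendstoUniformlyOn (fun n (_ : Unit) => U n (-τ) (U n τ v))
        (fun _ => T (-τ) (T τ v)) atTop univ :=
      tendstoUniformlyOn_clm_apply (T := fun _ => T (-τ)) (y := fun _ => T τ v)
        (fun n _ _ => hUb n (-τ)) ((hT (-τ) _).tendstoUniformlyOn_const _)
        ((hT τ v).tendstoUniformlyOn_const _)
    refine tendsto_nhds_unique (h1.tendsto_at (mem_univ ())) ?_
    simp only [hU, boundedGroup_neg_apply]
    exact tendsto_const_nhds
  · intro τ v
    have hc : Continuous fun w => formNorm G w := by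
      have h1 : Continuous fun w => G w w := by
        exact (G.continuous.clm_apply continuous_id)
      exact (Complex.continuous_re.comp h1).sqrt
    refine tendsto_nhds_unique ((hc.tendsto _).comp (hT τ v)) ?_
    simp only [Function.comp_def, hU, formNorm_boundedGroup (hYs _)]
    exact tendsto_const_nhds
  · intro v u h τ
    have := hasDerivWithinAt_of_tendstoUniformlyOn (a := -(|τ| + 1)) (b := |τ| + 1)
      (g := fun n τ => U n τ v) (h := fun n τ => -(Complex.I • U n τ (Y n v)))
      (G := fun τ => T τ v) (H := fun τ => -(Complex.I • T τ u)) (by linarith [abs_nonneg τ])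
      (fun n => (hUc n v).continuousOn)
      (fun n r _ => (hasDerivAt_boundedGroup' (Y n) v r).hasDerivWithinAt)
      ((uniformContinuous_id.const_smul Complex.I).neg.comp_tendstoUniformlyOn
        ((hUz (hYt v u h) (|τ| + 1)).mono Ico_subset_Icc_self))
      ((hTc u).const_smul Complex.I).neg.continuousOn (fun r _ => hT r v) τ
      (mem_of_mem_nhds (hnhds τ))
    exact this.hasDerivAt (hnhds τ)
  · intro v u h τ
    -- Invariance of the domain is checked weakly: `G (U n τ (Y n v)) w = G (U n τ v) (Y n w)`
    -- passes to the limit, and self-adjointness does the rest.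
    refine hA.mem_graph fun w x hw => ?_
    have h1 : Tendsto (fun n => G (U n τ (Y n v)) w) atTop (𝓝 (G (T τ u) w)) :=
      ((continuous_form_left G w).tendsto _).comp ((hUz (hYt v u h) |τ|).tendsto_at (hmem τ))
    have h2 : Tendsto (fun n => G (U n τ v) (Y n w)) atTop (𝓝 (G (T τ v) x)) :=
      ((continuous_form G).tendsto (T τ v, x)).comp ((hT τ v).prodMk_nhds (hYt w x hw))
    refine tendsto_nhds_unique h1 (h2.congr fun n => ?_)
    rw [← hYs n]
    congr 2
    exact congrArg (fun B : H →L[ℂ] H => B v) (commute_boundedGroup (Commute.refl (Y n)) τ).eq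

end Stone

end KreinEvolution

namespace KreinEvolution

open Filter Topology

/-! ### Products of frozen groups on the steps of a partition -/

section Kato

variable {W V : Type*} [NormedAddCommGroup W] [InnerProductSpace ℂ W]
  [NormedAddCommGroup V] [InnerProductSpace ℂ V] {J : V →L[ℂ] W}

/-- Injectivity of `J` makes the pulled-back relation single-valued, so that
`Submodule.toLinearPMap` has it as its graph. -/
theorem mem_graph_partIn (hJ : Function.Injective J) (B : W →ₗ.[ℂ] W) (v u : V) :
    (v, u) ∈ (partIn J B).graph ↔ (J v, J u) ∈ B.graph := by
  rw [partIn, Submodule.toLinearPMap_graph_eq]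
  · simp only [Submodule.mem_comap]
    rfl
  · intro x hx hx0
    have h1 : (J x.1, J x.2) ∈ B.graph := hx
    rw [hx0, map_zero] at h1
    have h2 := B.graph_fst_eq_zero_snd h1 rfl
    exact hJ (by simpa using h2)

/-- The group generated by the part in `V` is the restriction of the group. -/
theorem IsIsometryGroup.intertwine (hJ : Function.Injective J) {B : W →ₗ.[ℂ] W}
    {GW : W →L⋆[ℂ] W →L[ℂ] ℂ} {GV : V →L⋆[ℂ] V →L[ℂ] ℂ} (hGW : IsCompatibleScalarProduct GW)
    (hd : Dense ((partIn J B).domain : Set V)) {T : ℝ → W →L[ℂ] W} {TV : ℝ → V →L[ℂ] V}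
    (hT : IsIsometryGroup GW B T) (hTV : IsIsometryGroup GV (partIn J B) TV) (τ : ℝ) (v : V) :
    J (TV τ v) = T τ (J v) := by
  obtain ⟨M, hM⟩ := hT.norm_le hGW
  have h1 : ∀ v ∈ (partIn J B).domain, J (TV τ v) = T τ (J v) := fun v hv => by
    obtain ⟨u, hu⟩ := LinearPMap.mem_domain_iff.1 hv
    -- Both groups have the same generator along `J (TV r v)`, so undoing one by the other gives a
    -- constant.
    have hder : ∀ r, HasDerivAt (fun r => T (-r) (J (TV r v))) 0 r := fun r => by
      have h2 : HasDerivAt (fun r => J (TV r v)) (-(Complex.I • J (TV r u))) r := by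
        have := (J.restrictScalars ℝ).hasFDerivAt.comp_hasDerivAt r (hTV.hasDerivAt v u hu r)
        simpa [Function.comp_def] using this
      have h3 := hasDerivWithinAt_clm_apply (R := fun r => T (-r)) (s := univ) (t := r) (M := M)
        (x := fun r => J (TV r v)) (y := Complex.I • T (-r) (J (TV r u)))
        (Eventually.of_forall fun r => hM _) ?_
        ((hT.continuous _).comp continuous_neg).continuousWithinAt h2.hasDerivWithinAt
      · rw [hasDerivWithinAt_univ] at h3
        refine h3.congr_deriv ?_
        simp
      · rw [hasDerivWithinAt_univ]
        have h4 := (mem_graph_partIn hJ B _ _).1 (hTV.mem_graph v u hu r)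
        have h5 := (hT.hasDerivAt _ _ h4 (-r)).scomp r (hasDerivAt_neg r)
        simpa [Function.comp_def] using h5
    have h6 := is_const_of_deriv_eq_zero (fun r => (hder r).differentiableAt)
      (fun r => (hder r).deriv) τ 0
    simp only [neg_zero, hT.zero, hTV.zero, ContinuousLinearMap.id_apply] at h6
    have h7 := hT.neg_apply (-τ) (J (TV τ v))
    rw [neg_neg, h6] at h7
    exact h7.symm
  exact congrFun (Continuous.ext_on hd (J.continuous.comp (TV τ).continuous)
    ((T τ).continuous.comp J.continuous) h1) v

/-- A product of `k` groups, on successive intervals of the length `h`. The inverse of `u` is `w`,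
and `uV`, `wV` are their restrictions to `V`. -/
structure IsStepEvolution (J : V →L[ℂ] W) (BV : ℝ → V →L[ℂ] W) (GW : ℝ → W →L⋆[ℂ] W →L[ℂ] ℂ)
    (GV : ℝ → V →L⋆[ℂ] V →L[ℂ] ℂ) (C : ℝ → ℝ) (a h : ℝ) (k : ℕ) (u w : ℝ → W →L[ℂ] W)
    (uV wV : ℝ → V →L[ℂ] V) : Prop where
  left : u a = ContinuousLinearMap.id ℂ W
  right_inv : ∀ t f, u t (w t f) = f
  left_inv : ∀ t f, w t (u t f) = f
  comm : ∀ t v, J (uV t v) = u t (J v)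
  comm_inv : ∀ t v, J (wV t v) = w t (J v)
  continuous : ∀ f, Continuous fun t => u t f
  continuous_inv : ∀ f, Continuous fun t => w t f
  norm_inv_le : ∃ M, ∀ t, ‖w t‖ ≤ M
  le : ∀ t f, formNorm (GW (a + k * h)) (u t f) ≤
    Real.exp (∫ r in a..(a + k * h), C r) * formNorm (GW a) f
  ge : ∀ t f, formNorm (GW a) f ≤
    Real.exp (∫ r in a..(a + k * h), C r) * formNorm (GW (a + k * h)) (u t f)
  leV : ∀ t v, formNorm (GV (a + k * h)) (uV t v) ≤
    Real.exp (∫ r in a..(a + k * h), C r) * formNorm (GV a) v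
  geV : ∀ t v, formNorm (GV a) v ≤
    Real.exp (∫ r in a..(a + k * h), C r) * formNorm (GV (a + k * h)) (uV t v)
  const : ∀ t, a + k * h ≤ t → u t = u (a + k * h) ∧ w t = w (a + k * h) ∧ uV t = uV (a + k * h)
  deriv : ∀ j : ℕ, j < k → ∀ t ∈ Ico (a + j * h) (a + (j + 1) * h), ∀ v,
    HasDerivWithinAt (fun r => u r (J v)) (-(Complex.I • BV (a + j * h) (uV t v))) (Ici t) t
  deriv_inv : ∀ j : ℕ, j < k → ∀ t ∈ Ico (a + j * h) (a + (j + 1) * h), ∀ v,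
    HasDerivWithinAt (fun r => w r (J v)) (Complex.I • w t (BV (a + j * h) v)) (Ici t) t

/-- One more step: the group of the generator frozen at the node `a + k * h` is appended. It is
isometric for the scalar products of that node, so the bounds deteriorate only through the change of
scalar product to the next node. These factors multiply to the exponential of one integral of `C`,
whatever the number of steps. -/
theorem IsStepEvolution.succ {BV : ℝ → V →L[ℂ] W} {GW : ℝ → W →L⋆[ℂ] W →L[ℂ] ℂ}
    {GV : ℝ → V →L⋆[ℂ] V →L[ℂ] ℂ} {C : ℝ → ℝ} {a h : ℝ} {k : ℕ} {u w : ℝ → W →L[ℂ] W}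
    {uV wV : ℝ → V →L[ℂ] V} (hu : IsStepEvolution J BV GW GV C a h k u w uV wV) (hh : 0 < h)
    {B : W →ₗ.[ℂ] W} (hB : ∀ v, (J v, BV (a + k * h) v) ∈ B.graph)
    {B' : V →ₗ.[ℂ] V} {T : ℝ → W →L[ℂ] W} {TV : ℝ → V →L[ℂ] V}
    (hT : IsIsometryGroup (GW (a + k * h)) B T) (hTV : IsIsometryGroup (GV (a + k * h)) B' TV)
    (hTT : ∀ τ v, J (TV τ v) = T τ (J v)) {M : ℝ} (hM : ∀ τ, ‖T τ‖ ≤ M)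
    (hC : ∫ r in a..(a + (k + 1 : ℕ) * h), C r =
      (∫ r in a..(a + k * h), C r) + ∫ r in (a + k * h)..(a + (k + 1 : ℕ) * h), C r)
    (hW : ∀ f, formNorm (GW (a + (k + 1 : ℕ) * h)) f ≤ formNorm (GW (a + k * h)) f *
      Real.exp (∫ r in (a + k * h)..(a + (k + 1 : ℕ) * h), C r))
    (hW' : ∀ f, formNorm (GW (a + k * h)) f ≤ formNorm (GW (a + (k + 1 : ℕ) * h)) f *
      Real.exp (∫ r in (a + k * h)..(a + (k + 1 : ℕ) * h), C r))
    (hV : ∀ f, formNorm (GV (a + (k + 1 : ℕ) * h)) f ≤ formNorm (GV (a + k * h)) f *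
      Real.exp (∫ r in (a + k * h)..(a + (k + 1 : ℕ) * h), C r))
    (hV' : ∀ f, formNorm (GV (a + k * h)) f ≤ formNorm (GV (a + (k + 1 : ℕ) * h)) f *
      Real.exp (∫ r in (a + k * h)..(a + (k + 1 : ℕ) * h), C r)) :
    ∃ u w uV wV, IsStepEvolution J BV GW GV C a h (k + 1) u w uV wV := by
  -- The time spent in the new step, clamped to `[0, h]`: the appended factor is trivial before the
  -- node and constant after the end of the step.
  set c : ℝ → ℝ := fun t => min (max (t - (a + k * h)) 0) h with hc
  have hcc : Continuous c := by fun_prop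
  have hc0 : ∀ t, t ≤ a + k * h → c t = 0 := fun t ht => by
    simp only [hc]
    rw [max_eq_right (by linarith), min_eq_left hh.le]
  have hc1 : ∀ t, a + k * h ≤ t → t ≤ a + (k + 1) * h → c t = t - (a + k * h) := fun t ht ht' => by
    simp only [hc]
    rw [max_eq_left (by linarith), min_eq_left (by linarith)]
  have hc2 : ∀ t, a + (k + 1) * h ≤ t → c t = h := fun t ht => by
    simp only [hc]
    rw [max_eq_left (by linarith), min_eq_right (by linarith)]
  have hTT' : ∀ τ f, T τ (T (-τ) f) = f := fun τ f => by
    have := hT.neg_apply (-τ) f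
    rwa [neg_neg] at this
  have hTn : ∀ t f, formNorm (GW (a + k * h)) (T t f) = formNorm (GW (a + k * h)) f := hT.formNorm_eq
  have hkh : a ≤ a + k * h := by
    have : (0 : ℝ) ≤ k * h := by positivity
    linarith
  have hmono : ∀ j : ℕ, j < k → a + (j + 1) * h ≤ a + k * h := fun j hj => by
    have : (j : ℝ) + 1 ≤ k := by exact_mod_cast hj
    nlinarith
  have hcast : ((k + 1 : ℕ) : ℝ) = k + 1 := by push_cast; ring
  have huc : ∀ f, Continuous fun t => T (c t) (u t f) := fun f => by
    exact continuous_clm_apply (K := fun t => T (c t)) (fun f => (hT.continuous f).comp hcc)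
      (fun t => hM _) (hu.continuous f)
  obtain ⟨Mw, hMw⟩ := hu.norm_inv_le
  have hwc : ∀ f, Continuous fun t => w t (T (-c t) f) := fun f =>
    continuous_clm_apply hu.continuous_inv hMw ((hT.continuous f).comp hcc.neg)
  refine ⟨fun t => T (c t) ∘L u t, fun t => w t ∘L T (-c t), fun t => TV (c t) ∘L uV t,
    fun t => wV t ∘L TV (-c t), ?_, ?_, ?_, ?_, ?_, huc, hwc, ⟨Mw * M, fun t => ?_⟩, ?_, ?_, ?_, ?_, ?_, ?_, ?_⟩
  · simp [hc0 a hkh, hT.zero, hu.left]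
  · intro t f
    simp [hu.right_inv, hTT']
  · intro t f
    simp [hu.left_inv, hT.neg_apply]
  · intro t v
    simp [hTT, hu.comm]
  · intro t v
    simp [hTT, hu.comm_inv]
  · exact (ContinuousLinearMap.opNorm_comp_le _ _).trans
      (mul_le_mul (hMw t) (hM _) (norm_nonneg _) ((norm_nonneg _).trans (hMw t)))
  · intro t f
    rw [hC, Real.exp_add]
    refine (hW _).trans ?_
    rw [ContinuousLinearMap.comp_apply, hTn]
    exact (mul_le_mul_of_nonneg_right (hu.le t f) (Real.exp_pos _).le).trans_eq (by ring)
  · intro t f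
    rw [hC, Real.exp_add]
    refine (hu.ge t f).trans ?_
    rw [mul_assoc]
    refine mul_le_mul_of_nonneg_left ?_ (Real.exp_pos _).le
    rw [← hTn (c t)]
    exact (hW' _).trans_eq (mul_comm _ _)
  · intro t f
    rw [hC, Real.exp_add]
    refine (hV _).trans ?_
    rw [ContinuousLinearMap.comp_apply, hTV.formNorm_eq]
    exact (mul_le_mul_of_nonneg_right (hu.leV t f) (Real.exp_pos _).le).trans_eq (by ring)
  · intro t f
    rw [hC, Real.exp_add]
    refine (hu.geV t f).trans ?_
    rw [mul_assoc]
    refine mul_le_mul_of_nonneg_left ?_ (Real.exp_pos _).le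
    rw [← hTV.formNorm_eq (c t)]
    exact (hV' _).trans_eq (mul_comm _ _)
  · intro t ht
    rw [hcast] at ht ⊢
    have h1 : a + k * h ≤ a + (k + 1) * h := by linarith
    obtain ⟨h2, h3, h4⟩ := hu.const t (h1.trans ht)
    obtain ⟨h2', h3', h4'⟩ := hu.const _ h1
    simp only [hc2 t ht, hc2 _ le_rfl, h2, h3, h4, h2', h3', h4', and_self]
  · intro j hj t ht v
    rcases Nat.lt_succ_iff_lt_or_eq.1 hj with hj | rfl
    · have hev : ∀ r ∈ Iio (a + (j + 1) * h), c r = 0 := fun r hr =>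
        hc0 r ((le_of_lt hr).trans (hmono j hj))
      have := hu.deriv j hj t ht v
      refine (this.congr_of_eventuallyEq ?_ ?_).congr_deriv ?_
      · filter_upwards [mem_nhdsWithin_of_mem_nhds (Iio_mem_nhds ht.2)] with r hr
        simp [hev r hr, hT.zero]
      · simp [hev t ht.2, hT.zero]
      · simp [hev t ht.2, hTV.zero]
    · obtain ⟨h2, h3, h4⟩ := hu.const t ht.1
      -- The group commutes with its generator and leaves `V` invariant. Hence the derivative, which
      -- has the form `T (B v)`, can be rewritten with the generator acting last, on a vector of
      -- `V`.
      have h5 := hT.mem_graph _ _ (hB (uV (a + j * h) v)) (t - (a + j * h))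
      have h6 := hB (TV (t - (a + j * h)) (uV (a + j * h) v))
      rw [hTT] at h6
      have h7 := B.mem_graph_snd_inj h5 h6 rfl
      have h8 := (hT.hasDerivAt _ _ (hB (uV (a + j * h) v)) (t - (a + j * h))).comp_sub_const t
        (a + j * h)
      rw [h7] at h8
      refine (h8.hasDerivWithinAt.congr_of_eventuallyEq ?_ ?_).congr_deriv ?_
      · filter_upwards [mem_nhdsWithin_of_mem_nhds (Iio_mem_nhds ht.2), self_mem_nhdsWithin]
          with r hr hr'
        have h9 : a + j * h ≤ r := ht.1.trans hr'
        simp [hc1 r h9 (le_of_lt hr), (hu.const r h9).1, hu.comm]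
      · simp [hc1 t ht.1 ht.2.le, h2, hu.comm]
      · simp [hc1 t ht.1 ht.2.le, h4]
  · intro j hj t ht v
    rcases Nat.lt_succ_iff_lt_or_eq.1 hj with hj | rfl
    · have hev : ∀ r ∈ Iio (a + (j + 1) * h), c r = 0 := fun r hr =>
        hc0 r ((le_of_lt hr).trans (hmono j hj))
      have := hu.deriv_inv j hj t ht v
      refine (this.congr_of_eventuallyEq ?_ ?_).congr_deriv ?_
      · filter_upwards [mem_nhdsWithin_of_mem_nhds (Iio_mem_nhds ht.2)] with r hr
        simp [hev r hr, hT.zero]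
      · simp [hev t ht.2, hT.zero]
      · simp [hev t ht.2, hT.zero]
    · obtain ⟨h2, h3, h4⟩ := hu.const t ht.1
      have h8 := ((hT.hasDerivAt _ _ (hB v) (-(t - (a + j * h)))).scomp (t - (a + j * h))
        (hasDerivAt_neg _)).comp_sub_const t (a + j * h)
      have h9 := ((w (a + j * h)).restrictScalars ℝ).hasFDerivAt.comp_hasDerivAt t h8
      refine (h9.hasDerivWithinAt.congr_of_eventuallyEq ?_ ?_).congr_deriv ?_
      · filter_upwards [mem_nhdsWithin_of_mem_nhds (Iio_mem_nhds ht.2), self_mem_nhdsWithin]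
          with r hr hr'
        have h9 : a + j * h ≤ r := ht.1.trans hr'
        simp [hc1 r h9 (le_of_lt hr), (hu.const r h9).2.1]
      · simp [hc1 t ht.1 ht.2.le, h3]
      · simp [hc1 t ht.1 ht.2.le, h3]

end Kato

end KreinEvolution

namespace KreinEvolution

open Filter Topology

/-! ### Stability and convergence of Kato's approximations -/

section Kato

variable {W V : Type*} [NormedAddCommGroup W] [InnerProductSpace ℂ W]
  [NormedAddCommGroup V] [InnerProductSpace ℂ V] {J : V →L[ℂ] W}

/-- An invertible evolution on `[a, b]` which is bounded by `M` on `W` and `V`, and generated by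
`BV (σ t)`, where `σ t` is `d`-close to `t`. -/
structure IsApproxEvolution (J : V →L[ℂ] W) (BV : ℝ → V →L[ℂ] W) (a b M d : ℝ)
    (u w : ℝ → W →L[ℂ] W) (uV wV : ℝ → V →L[ℂ] V) (σ : ℝ → ℝ) : Prop where
  left : u a = ContinuousLinearMap.id ℂ W
  right_inv : ∀ t f, u t (w t f) = f
  left_inv : ∀ t f, w t (u t f) = f
  comm : ∀ t v, J (uV t v) = u t (J v)
  comm_inv : ∀ t v, J (wV t v) = w t (J v)
  continuous : ∀ f, Continuous fun t => u t f
  continuous_inv : ∀ f, Continuous fun t => w t f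
  norm_le : ∀ t, ‖u t‖ ≤ M
  norm_inv_le : ∀ t, ‖w t‖ ≤ M
  normV_le : ∀ t, ‖uV t‖ ≤ M
  normV_inv_le : ∀ t, ‖wV t‖ ≤ M
  mem : ∀ t ∈ Ico a b, σ t ∈ Icc a b
  near : ∀ t ∈ Ico a b, |σ t - t| ≤ d
  deriv : ∀ t ∈ Ico a b, ∀ v,
    HasDerivWithinAt (fun r => u r (J v)) (-(Complex.I • BV (σ t) (uV t v))) (Ici t) t
  deriv_inv : ∀ t ∈ Ico a b, ∀ v,
    HasDerivWithinAt (fun r => w r (J v)) (Complex.I • w t (BV (σ t) v)) (Ici t) t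

theorem tendstoUniformlyOn_comp_near {X : Type*} [PseudoMetricSpace X] {a b : ℝ} {F : ℝ → X}
    (hF : ContinuousOn F (Icc a b)) {σ : ℕ → ℝ → ℝ} (hσ : ∀ n, ∀ t ∈ Ico a b, σ n t ∈ Icc a b)
    (hσ' : ∀ n : ℕ, ∀ t ∈ Ico a b, |σ n t - t| ≤ (b - a) / (n + 1)) :
    TendstoUniformlyOn (fun n t => F (σ n t)) F atTop (Ico a b) := by
  have hu := isCompact_Icc.uniformContinuousOn_of_continuous hF
  rw [Metric.uniformContinuousOn_iff] at hu
  rw [Metric.tendstoUniformlyOn_iff]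
  intro ε hε
  obtain ⟨δ, hδ, h⟩ := hu ε hε
  have h1 : Tendsto (fun n : ℕ => (b - a) / ((n : ℝ) + 1)) atTop (𝓝 0) := by
    have := (tendsto_one_div_add_atTop_nhds_zero_nat (𝕜 := ℝ)).const_mul (b - a)
    simpa [div_eq_mul_inv] using this
  filter_upwards [h1.eventually (gt_mem_nhds hδ)] with n hn t ht
  refine h t (Ico_subset_Icc_self ht) _ (hσ n t ht) ?_
  rw [dist_comm, Real.dist_eq]
  exact (hσ' n t ht).trans_lt hn

/-- Duhamel's formula for two approximations: the derivative of `w' u (J v)` is `i w' (B(σ') - B(σ))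
u v`. The difference of generators is small only from `V` to `W`, so the bound of `u` on `V` is
needed here. -/
theorem IsApproxEvolution.norm_inv_comp_sub_le {BV : ℝ → V →L[ℂ] W} {a b M d d' ε : ℝ}
    {u w u' w' : ℝ → W →L[ℂ] W} {uV wV uV' wV' : ℝ → V →L[ℂ] V} {σ σ' : ℝ → ℝ}
    (h : IsApproxEvolution J BV a b M d u w uV wV σ)
    (h' : IsApproxEvolution J BV a b M d' u' w' uV' wV' σ')
    (hε : ∀ t ∈ Ico a b, ‖BV (σ' t) - BV (σ t)‖ ≤ ε) (v : V) {t : ℝ} (ht : t ∈ Icc a b) :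
    ‖w' t (u t (J v)) - J v‖ ≤ M * (ε * (M * ‖v‖)) * (b - a) := by
  have hM : 0 ≤ M := (norm_nonneg _).trans (h.norm_le t)
  have hd : ∀ r ∈ Ico a b, HasDerivWithinAt (fun r => w' r (u r (J v)))
      (Complex.I • w' r ((BV (σ' r) - BV (σ r)) (uV r v))) (Ici r) r := fun r hr => by
    have h1 := h'.deriv_inv r hr (uV r v)
    rw [h.comm] at h1
    have := hasDerivWithinAt_clm_apply (Eventually.of_forall h'.norm_inv_le) h1
      (h'.continuous_inv _).continuousWithinAt (h.deriv r hr v)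
    refine this.congr_deriv ?_
    simp [sub_eq_add_neg]
  have h0 : w' a (u a (J v)) = J v := by
    have := h'.left_inv a (J v)
    rw [h'.left] at this
    rw [h.left]
    exact this
  have h2 := norm_image_sub_le_of_norm_deriv_right_le_segment (C := M * (ε * (M * ‖v‖)))
    (f := fun r => w' r (u r (J v)))
    (continuous_clm_apply h'.continuous_inv h'.norm_inv_le (h.continuous _)).continuousOn hd
    (fun r hr => by
      rw [norm_smul, Complex.norm_I, one_mul]
      refine (w' r).le_of_opNorm_le_of_le (h'.norm_inv_le r) ?_
      refine (ContinuousLinearMap.le_of_opNorm_le_of_le _ (hε r hr) ?_)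
      exact (uV r).le_of_opNorm_le (h.normV_le r) v) t ht
  rw [h0] at h2
  refine h2.trans ?_
  rcases eq_or_lt_of_le (ht.1.trans ht.2) with hab | hab
  · have : t = a := le_antisymm (by linarith [ht.2]) ht.1
    simp [this, ← hab]
  · have hε0 : 0 ≤ ε := (norm_nonneg _).trans (hε a ⟨le_rfl, hab⟩)
    have : t - a ≤ b - a := by linarith [ht.2]
    exact mul_le_mul_of_nonneg_left this (by positivity)

variable [CompleteSpace W] [CompleteSpace V]

/-- Kato stability: `M` does not depend on `n`, because the norms are compared along the partition
with a total distortion of `exp ∫ C` over `[a, b]`. -/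
theorem KatoHypotheses.exists_approx (hJ : Function.Injective J) {a b : ℝ} (hab : a < b)
    {B₀ : ℝ → W →ₗ.[ℂ] W} (hB : KatoHypotheses J a b B₀) :
    ∃ (BV : ℝ → V →L[ℂ] W) (M : ℝ), ContinuousOn BV (Icc a b) ∧
      (∀ t ∈ Icc a b, ∀ v, (J v, BV t v) ∈ (B₀ t).graph) ∧
      ∀ n : ℕ, ∃ u w uV wV σ, IsApproxEvolution J BV a b M ((b - a) / (n + 1)) u w uV wV σ := by
  obtain ⟨⟨BV, hBVc, hBV⟩, GW, GV, C, hG, hsa, hC0, hCi, hGW, hGV⟩ := hB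
  have hmema : a ∈ Icc a b := left_mem_Icc.2 hab.le
  have hmemb : b ∈ Icc a b := right_mem_Icc.2 hab.le
  obtain ⟨k₁, hk₁0, hk₁⟩ := (hG a hmema).1.exists_equiv_norm
  obtain ⟨k₂, hk₂0, hk₂⟩ := (hG b hmemb).1.exists_equiv_norm
  obtain ⟨k₃, hk₃0, hk₃⟩ := (hG a hmema).2.exists_equiv_norm
  obtain ⟨k₄, hk₄0, hk₄⟩ := (hG b hmemb).2.exists_equiv_norm
  have hCint : ∀ s ∈ Icc a b, ∀ t ∈ Icc a b, IntervalIntegrable C volume s t := fun s hs t ht =>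
    (hCi.mono_set (uIcc_subset_Icc hs ht)).intervalIntegrable
  have hstep : ∀ (n k : ℕ), k ≤ n + 1 → ∃ u w uV wV,
      IsStepEvolution J BV GW GV C a ((b - a) / (n + 1)) k u w uV wV := by
    intro n k
    set h := (b - a) / ((n : ℝ) + 1) with hh
    have hh0 : 0 < h := by
      have : 0 < b - a := by linarith
      positivity
    have hmem : ∀ k : ℕ, k ≤ n + 1 → a + k * h ∈ Icc a b := fun k hk => by
      have h1 : (k : ℝ) ≤ n + 1 := by exact_mod_cast hk
      have h2 : ((n : ℝ) + 1) * h = b - a := by rw [hh]; field_simp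
      exact ⟨by nlinarith, by nlinarith⟩
    induction k with
    | zero =>
      intro _
      refine ⟨fun _ => ContinuousLinearMap.id ℂ W, fun _ => ContinuousLinearMap.id ℂ W,
        fun _ => ContinuousLinearMap.id ℂ V, fun _ => ContinuousLinearMap.id ℂ V, rfl, ?_, ?_, ?_,
        ?_, ?_, ?_, ⟨_, fun _ => le_rfl⟩, ?_, ?_, ?_, ?_, ?_, ?_, ?_⟩
      all_goals simp [continuous_const]
    | succ k ih =>
      intro hk
      obtain ⟨u, w, uV, wV, hu⟩ := ih (by omega)
      have hm := hmem k (by omega)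
      have hm' := hmem (k + 1) hk
      have hle : a + k * h ≤ a + (k + 1 : ℕ) * h := by push_cast; linarith
      obtain ⟨T, hT⟩ := (hsa _ hm).1.exists_group (hG _ hm).1
      obtain ⟨TV, hTV⟩ := (hsa _ hm).2.exists_group (hG _ hm).2
      obtain ⟨M, hM⟩ := hT.norm_le (hG _ hm).1
      have hpos : 0 ≤ ∫ r in (a + k * h)..(a + (k + 1 : ℕ) * h), C r :=
        intervalIntegral.integral_nonneg hle fun r hr => hC0 r ⟨hm.1.trans hr.1, hr.2.trans hm'.2⟩
      have habs : |∫ r in (a + k * h)..(a + (k + 1 : ℕ) * h), C r| =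
          ∫ r in (a + k * h)..(a + (k + 1 : ℕ) * h), C r := abs_of_nonneg hpos
      have habs' : |∫ r in (a + (k + 1 : ℕ) * h)..(a + k * h), C r| =
          ∫ r in (a + k * h)..(a + (k + 1 : ℕ) * h), C r := by
        rw [intervalIntegral.integral_symm, abs_neg, habs]
      refine hu.succ hh0 (hBV _ hm) hT hTV
        (hT.intertwine hJ (hG _ hm).1 (hsa _ hm).2.1 hTV) hM ?_ ?_ ?_ ?_ ?_
      · rw [intervalIntegral.integral_add_adjacent_intervals (hCint _ hmema _ hm)
          (hCint _ hm _ hm')]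
      · intro f
        have := hGW _ hm _ hm' f
        rwa [habs] at this
      · intro f
        have := hGW _ hm' _ hm f
        rwa [habs'] at this
      · intro f
        have := hGV _ hm _ hm' f
        rwa [habs] at this
      · intro f
        have := hGV _ hm' _ hm f
        rwa [habs'] at this
  set e := Real.exp (∫ r in a..b, C r) with he
  have he0 : 0 < e := Real.exp_pos _
  -- The reference norms are compared with the scalar products at `a` and `b` only, by `k₁`, `k₂` on
  -- `W` and `k₃`, `k₄` on `V`; `e` accounts for everything between.
  refine ⟨BV, max (k₁ * (e * k₂)) (k₃ * (e * k₄)), hBVc, hBV, fun n => ?_⟩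
  obtain ⟨u, w, uV, wV, hu⟩ := hstep n (n + 1) le_rfl
  set h := (b - a) / ((n : ℝ) + 1) with hh
  have hh0 : 0 < h := by
    have : 0 < b - a := by linarith
    positivity
  have hb : a + ((n + 1 : ℕ) : ℝ) * h = b := by
    rw [hh]; push_cast; field_simp; ring
  have hle := hu.le
  have hge := hu.ge
  have hleV := hu.leV
  have hgeV := hu.geV
  rw [hb] at hle hge hleV hgeV
  have hinvV : ∀ t v, uV t (wV t v) = v := fun t v => hJ <| by
    rw [hu.comm, hu.comm_inv, hu.right_inv]
  -- The left node of the step that contains `t`.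
  set σ : ℝ → ℝ := fun t => a + (⌊(t - a) / h⌋₊ : ℝ) * h with hσ
  have hσ1 : ∀ t ∈ Ico a b, t ∈ Ico (σ t) (a + ((⌊(t - a) / h⌋₊ : ℝ) + 1) * h) := fun t ht => by
    have h1 : 0 ≤ (t - a) / h := div_nonneg (by linarith [ht.1]) hh0.le
    have h2 := Nat.floor_le h1
    have h3 := Nat.lt_floor_add_one ((t - a) / h)
    rw [le_div_iff₀ hh0] at h2
    rw [div_lt_iff₀ hh0] at h3
    exact ⟨by simp only [hσ]; linarith, by linarith⟩
  have hσ2 : ∀ t ∈ Ico a b, ⌊(t - a) / h⌋₊ < n + 1 := fun t ht => by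
    have h1 : 0 ≤ (t - a) / h := div_nonneg (by linarith [ht.1]) hh0.le
    rw [Nat.floor_lt h1, div_lt_iff₀ hh0]
    linarith [ht.2]
  refine ⟨u, w, uV, wV, σ, hu.left, hu.right_inv, hu.left_inv, hu.comm, hu.comm_inv, hu.continuous,
    hu.continuous_inv, fun t => ?_, fun t => ?_, fun t => ?_, fun t => ?_, fun t ht => ?_,
    fun t ht => ?_, fun t ht v => ?_, fun t ht v => ?_⟩
  · refine (ContinuousLinearMap.opNorm_le_bound _ (by positivity) fun f => ?_).trans (le_max_left _ _)
    calc ‖u t f‖ ≤ k₂ * formNorm (GW b) (u t f) := (hk₂ _).1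
      _ ≤ k₂ * (e * (k₁ * ‖f‖)) := by
        gcongr
        exact (hle t f).trans (mul_le_mul_of_nonneg_left (hk₁ f).2 he0.le)
      _ = k₁ * (e * k₂) * ‖f‖ := by ring
  · refine (ContinuousLinearMap.opNorm_le_bound _ (by positivity) fun f => ?_).trans (le_max_left _ _)
    calc ‖w t f‖ ≤ k₁ * formNorm (GW a) (w t f) := (hk₁ _).1
      _ ≤ k₁ * (e * (k₂ * ‖f‖)) := by
        gcongr
        refine (hge t _).trans (mul_le_mul_of_nonneg_left ?_ he0.le)
        rw [hu.right_inv]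
        exact (hk₂ f).2
      _ = k₁ * (e * k₂) * ‖f‖ := by ring
  · refine (ContinuousLinearMap.opNorm_le_bound _ (by positivity) fun f => ?_).trans (le_max_right _ _)
    calc ‖uV t f‖ ≤ k₄ * formNorm (GV b) (uV t f) := (hk₄ _).1
      _ ≤ k₄ * (e * (k₃ * ‖f‖)) := by
        gcongr
        exact (hleV t f).trans (mul_le_mul_of_nonneg_left (hk₃ f).2 he0.le)
      _ = k₃ * (e * k₄) * ‖f‖ := by ring
  · refine (ContinuousLinearMap.opNorm_le_bound _ (by positivity) fun f => ?_).trans (le_max_right _ _)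
    calc ‖wV t f‖ ≤ k₃ * formNorm (GV a) (wV t f) := (hk₃ _).1
      _ ≤ k₃ * (e * (k₄ * ‖f‖)) := by
        gcongr
        refine (hgeV t _).trans (mul_le_mul_of_nonneg_left ?_ he0.le)
        rw [hinvV]
        exact (hk₄ f).2
      _ = k₃ * (e * k₄) * ‖f‖ := by ring
  · refine ⟨?_, (hσ1 t ht).1.trans ht.2.le⟩
    have : 0 ≤ (⌊(t - a) / h⌋₊ : ℝ) * h := by positivity
    simp only [hσ]; linarith
  · have := hσ1 t ht
    have h1 := this.2
    rw [abs_sub_comm, abs_of_nonneg (by linarith [this.1])]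
    simp only [hσ]; linarith
  · exact hu.deriv _ (hσ2 t ht) t (hσ1 t ht) v
  · exact hu.deriv_inv _ (hσ2 t ht) t (hσ1 t ht) v

/-- The evolution `u t (w s)` of the unperturbed family, together with the approximations from
which it is obtained as a limit. -/
structure IsKatoLimit (J : V →L[ℂ] W) (BV : ℝ → V →L[ℂ] W) (a b M : ℝ)
    (u w : ℝ → W →L[ℂ] W) (un wn : ℕ → ℝ → W →L[ℂ] W) (uVn wVn : ℕ → ℝ → V →L[ℂ] V)
    (σ : ℕ → ℝ → ℝ) : Prop where
  approx : ∀ n : ℕ,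
    IsApproxEvolution J BV a b M ((b - a) / (n + 1)) (un n) (wn n) (uVn n) (wVn n) (σ n)
  tendsto : ∀ f, TendstoUniformlyOn (fun n t => un n t f) (fun t => u t f) atTop (Icc a b)
  tendsto_inv : ∀ f, TendstoUniformlyOn (fun n t => wn n t f) (fun t => w t f) atTop (Icc a b)

/-- By `IsApproxEvolution.norm_inv_comp_sub_le` the approximations and their inverses are uniformly
Cauchy on the dense range of `J`, and the uniform bound on `W` extends this to all vectors. -/
theorem KatoHypotheses.exists_limit (hJ : Function.Injective J) (hJd : DenseRange J) {a b : ℝ}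
    (hab : a < b) {B₀ : ℝ → W →ₗ.[ℂ] W} (hB : KatoHypotheses J a b B₀) :
    ∃ (BV : ℝ → V →L[ℂ] W) (M : ℝ), ContinuousOn BV (Icc a b) ∧
      (∀ t ∈ Icc a b, ∀ v, (J v, BV t v) ∈ (B₀ t).graph) ∧
      ∃ u w un wn uVn wVn σ, IsKatoLimit J BV a b M u w un wn uVn wVn σ := by
  obtain ⟨BV, M, hBVc, hBV, happ⟩ := hB.exists_approx hJ hab
  choose un wn uVn wVn σ h using happ
  have hM : 0 ≤ M := (norm_nonneg _).trans ((h 0).norm_le a)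
  have hBVu := tendstoUniformlyOn_comp_near hBVc (fun n => (h n).mem) (fun n => (h n).near)
  have hBVs := hBVu.uniformCauchySeqOn
  have key : ∀ v : V, ∀ ε > 0, ∃ N, ∀ m ≥ N, ∀ n ≥ N, ∀ t ∈ Icc a b,
      ‖un m t (J v) - un n t (J v)‖ < ε ∧ ‖wn m t (J v) - wn n t (J v)‖ < ε := by
    intro v ε hε
    have hab' : 0 < b - a := by linarith
    set c := M * M * M * ‖v‖ * (b - a) + 1 with hc
    have hc0 : 0 < c := by positivity
    rw [Metric.uniformCauchySeqOn_iff] at hBVs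
    obtain ⟨N, hN⟩ := hBVs (ε / c) (by positivity)
    refine ⟨N, fun m hm n hn t ht => ?_⟩
    have hlt : M * M * M * ‖v‖ * (b - a) * (ε / c) < ε := by
      rw [mul_div_assoc', div_lt_iff₀ hc0]
      nlinarith
    have hε1 : ∀ r ∈ Ico a b, ‖BV (σ n r) - BV (σ m r)‖ ≤ ε / c := fun r hr => by
      rw [← dist_eq_norm]; exact (hN n hn m hm r hr).le
    constructor
    · have h1 := (h m).norm_inv_comp_sub_le (h n) hε1 v ht
      have h2 : un m t (J v) - un n t (J v) = un n t (wn n t (un m t (J v)) - J v) := by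
        rw [map_sub, (h n).right_inv]
      rw [h2]
      refine ((un n t).le_of_opNorm_le_of_le ((h n).norm_le t) h1).trans_lt ?_
      linarith
    -- Applied to `wVn m t v`, whose image under `un m t` is `J v`, the same estimate compares the
    -- inverses; the price is one more factor `M`.
    · have h1 := (h m).norm_inv_comp_sub_le (h n) hε1 (wVn m t v) ht
      rw [(h m).comm_inv, (h m).right_inv, norm_sub_rev] at h1
      refine h1.trans_lt (lt_of_le_of_lt ?_ hlt)
      have h2 := (wVn m t).le_of_opNorm_le ((h m).normV_inv_le t) v
      calc M * (ε / c * (M * ‖wVn m t v‖)) * (b - a)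
          ≤ M * (ε / c * (M * (M * ‖v‖))) * (b - a) := by gcongr
        _ = _ := by ring
  obtain ⟨u, hu⟩ := exists_limit_of_dense (g := un) (s := Icc a b) (fun n t _ => (h n).norm_le t)
    hJd (fun f ⟨v, hv⟩ => by
      rw [← hv, Metric.uniformCauchySeqOn_iff]
      intro ε hε
      obtain ⟨N, hN⟩ := key v ε hε
      exact ⟨N, fun m hm n hn t ht => by rw [dist_eq_norm]; exact (hN m hm n hn t ht).1⟩)
  obtain ⟨w, hw⟩ := exists_limit_of_dense (g := wn) (s := Icc a b)
    (fun n t _ => (h n).norm_inv_le t) hJd (fun f ⟨v, hv⟩ => by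
      rw [← hv, Metric.uniformCauchySeqOn_iff]
      intro ε hε
      obtain ⟨N, hN⟩ := key v ε hε
      exact ⟨N, fun m hm n hn t ht => by rw [dist_eq_norm]; exact (hN m hm n hn t ht).2⟩)
  exact ⟨BV, M, hBVc, hBV, u, w, un, wn, uVn, wVn, σ, h, hu, hw⟩

end Kato

end KreinEvolution

namespace KreinEvolution

open Filter Topology

/-! ### Uniform convergence and differentiability of bounded families -/

section Families

variable {E F : Type*} [NormedAddCommGroup E] [NormedSpace ℂ E]
  [NormedAddCommGroup F] [NormedSpace ℂ F]

theorem continuousOn_clm_apply_of_norm_le {α : Type*} [TopologicalSpace α] {R : α → E →L[ℂ] F}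
    {x : α → E} {s : Set α} {M : ℝ} (hM : ∀ t ∈ s, ‖R t‖ ≤ M)
    (hR : ∀ w, ContinuousOn (fun t => R t w) s) (hx : ContinuousOn x s) :
    ContinuousOn (fun t => R t (x t)) s := fun t ht =>
  continuousWithinAt_clm_apply (eventually_nhdsWithin_of_forall hM) (hR _ t ht) (hx t ht)

theorem tendstoUniformlyOn_clm_apply_of_norm {α : Type*} {A : ℕ → α → E →L[ℂ] F}
    {T : α → E →L[ℂ] F} {x : ℕ → α → E} {y : α → E} {s : Set α} {M M' : ℝ}
    (hA : TendstoUniformlyOn A T atTop s) (hT : ∀ t ∈ s, ‖T t‖ ≤ M)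
    (hx : TendstoUniformlyOn x y atTop s) (hx' : ∀ n, ∀ t ∈ s, ‖x n t‖ ≤ M') :
    TendstoUniformlyOn (fun n t => A n t (x n t)) (fun t => T t (y t)) atTop s := by
  rw [Metric.tendstoUniformlyOn_iff] at hA hx ⊢
  intro ε hε
  filter_upwards [hA (ε / (2 * (|M'| + 1))) (by positivity),
    hx (ε / (2 * (|M| + 1))) (by positivity)] with n h1 h2 t ht
  have h3 := h1 t ht
  have h4 := h2 t ht
  rw [dist_eq_norm, lt_div_iff₀ (by positivity)] at h3 h4
  have h5 : ‖T t (y t - x n t)‖ ≤ (|M| + 1) * ‖y t - x n t‖ :=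
    (T t).le_of_opNorm_le ((hT t ht).trans (by linarith [le_abs_self M])) _
  have h6 : ‖(T t - A n t) (x n t)‖ ≤ ‖T t - A n t‖ * (|M'| + 1) :=
    ContinuousLinearMap.le_opNorm_of_le _ ((hx' n t ht).trans (by linarith [le_abs_self M']))
  have h7 : T t (y t) - A n t (x n t) = T t (y t - x n t) + (T t - A n t) (x n t) := by
    simp
  rw [dist_eq_norm, h7]
  refine (norm_add_le _ _).trans_lt ?_
  linarith

/-- For bounded families of operators, uniform strong convergence is uniform along curves. -/
theorem tendstoUniformlyOn_clm_apply_of_isCompact {g : ℕ → ℝ → E →L[ℂ] F} {T : ℝ → E →L[ℂ] F}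
    {y : ℝ → E} {k : Set ℝ} (hk : IsCompact k) {M : ℝ} (hM : ∀ n, ∀ t ∈ k, ‖g n t‖ ≤ M)
    (hT : ∀ t ∈ k, ‖T t‖ ≤ M)
    (hg : ∀ f, TendstoUniformlyOn (fun n t => g n t f) (fun t => T t f) atTop k)
    (hy : ContinuousOn y k) :
    TendstoUniformlyOn (fun n t => g n t (y t)) (fun t => T t (y t)) atTop k := by
  rw [← tendstoLocallyUniformlyOn_iff_tendstoUniformlyOn_of_compact hk,
    Metric.tendstoLocallyUniformlyOn_iff]
  intro ε hε t₀ ht₀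
  -- Where `y` is almost constant, the fixed vector `y t₀` may replace `y t` at the cost of the
  -- uniform bounds; compactness makes the local statement global.
  refine ⟨{t | t ∈ k ∧ ‖y t - y t₀‖ < ε / (4 * (|M| + 1))}, ?_, ?_⟩
  · have h1 : ∀ᶠ t in 𝓝[k] t₀, dist (y t) (y t₀) < ε / (4 * (|M| + 1)) :=
      Metric.tendsto_nhds.1 (hy t₀ ht₀) _ (by positivity)
    filter_upwards [h1, self_mem_nhdsWithin] with t ht ht'
    exact ⟨ht', by rwa [← dist_eq_norm]⟩
  · filter_upwards [Metric.tendstoUniformlyOn_iff.1 (hg (y t₀)) (ε / 2) (by positivity)] with n hn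
    rintro t ⟨ht, hty⟩
    rw [lt_div_iff₀ (by positivity)] at hty
    have h2 := hn t ht
    have h3 : ‖T t (y t - y t₀)‖ ≤ (|M| + 1) * ‖y t - y t₀‖ :=
      (T t).le_of_opNorm_le ((hT t ht).trans (by linarith [le_abs_self M])) _
    have h4 : ‖g n t (y t - y t₀)‖ ≤ (|M| + 1) * ‖y t - y t₀‖ :=
      (g n t).le_of_opNorm_le ((hM n t ht).trans (by linarith [le_abs_self M])) _
    have h5 : T t (y t) - g n t (y t) =
        T t (y t - y t₀) - g n t (y t - y t₀) + (T t (y t₀) - g n t (y t₀)) := by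
      simp only [map_sub]; abel
    rw [dist_eq_norm] at h2 ⊢
    rw [h5]
    have h6 := norm_add_le (T t (y t - y t₀) - g n t (y t - y t₀)) (T t (y t₀) - g n t (y t₀))
    have h7 := norm_sub_le (T t (y t - y t₀)) (g n t (y t - y t₀))
    linarith

theorem _root_.HasDerivWithinAt.of_Icc_Ici {E : Type*} [NormedAddCommGroup E] [NormedSpace ℝ E]
    {f : ℝ → E} {f' : E} {a b t : ℝ} (h : HasDerivWithinAt f f' (Icc a b) t) (ht : t ∈ Ico a b) :
    HasDerivWithinAt f f' (Ici t) t :=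
  h.mono_of_mem_nhdsWithin (Icc_mem_nhdsGE_of_mem ht)

/-- Differentiability of a bounded family of operators extends from a dense set of vectors. -/
theorem hasDerivWithinAt_of_dense [CompleteSpace F] {a b M : ℝ} (hab : a ≤ b)
    {A A' : ℝ → E →L[ℂ] F} (hA' : ∀ t ∈ Icc a b, ‖A' t‖ ≤ M)
    (hc : ∀ f, ContinuousOn (fun t => A' t f) (Icc a b)) {D : Set E} (hD : Dense D)
    (h : ∀ v ∈ D, ∀ t ∈ Icc a b, HasDerivWithinAt (fun r => A r v) (A' t v) (Icc a b) t)
    (f : E) : ∀ t ∈ Icc a b, HasDerivWithinAt (fun r => A r f) (A' t f) (Icc a b) t := by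
  obtain ⟨v, hv, hvf⟩ := mem_closure_iff_seq_limit.1 (hD f)
  have hu : TendstoUniformlyOn (fun n t => A' t (v n)) (fun t => A' t f) atTop (Icc a b) :=
    tendstoUniformlyOn_clm_apply (g := fun _ => A') (y := fun _ => f) (fun _ => hA')
      (by
        rw [Metric.tendstoUniformlyOn_iff]
        intro ε hε
        exact Eventually.of_forall fun n t ht => by simpa using hε)
      (hvf.tendstoUniformlyOn_const _)
  exact hasDerivWithinAt_of_tendstoUniformlyOn hab (g := fun n t => A t (v n))
    (h := fun n t => A' t (v n))
    (fun n t ht => (h _ (hv n) t ht).continuousWithinAt)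
    (fun n t ht => (h _ (hv n) t (Ico_subset_Icc_self ht)).of_Icc_Ici ht)
    (hu.mono Ico_subset_Icc_self) (hc f)
    (fun t _ => ((A t).continuous.tendsto f).comp hvf)

end Families

/-! ### The unperturbed evolution as a strong limit -/

section KatoLimit

variable {W V : Type*} [NormedAddCommGroup W] [InnerProductSpace ℂ W]
  [NormedAddCommGroup V] [InnerProductSpace ℂ V] {J : V →L[ℂ] W}
  {BV : ℝ → V →L[ℂ] W} {a b M : ℝ} {u w : ℝ → W →L[ℂ] W} {un wn : ℕ → ℝ → W →L[ℂ] W}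
  {uVn wVn : ℕ → ℝ → V →L[ℂ] V} {σ : ℕ → ℝ → ℝ}

namespace IsKatoLimit

theorem norm_le (h : IsKatoLimit J BV a b M u w un wn uVn wVn σ) {t : ℝ} (ht : t ∈ Icc a b) :
    ‖u t‖ ≤ M :=
  ContinuousLinearMap.opNorm_le_bound _ ((norm_nonneg _).trans ((h.approx 0).norm_le a)) fun f =>
    le_of_tendsto ((h.tendsto f).tendsto_at ht).norm
      (Eventually.of_forall fun n => (un n t).le_of_opNorm_le ((h.approx n).norm_le t) f)

theorem norm_inv_le (h : IsKatoLimit J BV a b M u w un wn uVn wVn σ) {t : ℝ} (ht : t ∈ Icc a b) :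
    ‖w t‖ ≤ M :=
  ContinuousLinearMap.opNorm_le_bound _ ((norm_nonneg _).trans ((h.approx 0).norm_le a)) fun f =>
    le_of_tendsto ((h.tendsto_inv f).tendsto_at ht).norm
      (Eventually.of_forall fun n => (wn n t).le_of_opNorm_le ((h.approx n).norm_inv_le t) f)

theorem continuousOn (h : IsKatoLimit J BV a b M u w un wn uVn wVn σ) (f : W) :
    ContinuousOn (fun t => u t f) (Icc a b) :=
  (h.tendsto f).continuousOn
    (Eventually.frequently (Eventually.of_forall fun n => ((h.approx n).continuous f).continuousOn))

theorem continuousOn_inv (h : IsKatoLimit J BV a b M u w un wn uVn wVn σ) (f : W) :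
    ContinuousOn (fun t => w t f) (Icc a b) :=
  (h.tendsto_inv f).continuousOn (Eventually.frequently
    (Eventually.of_forall fun n => ((h.approx n).continuous_inv f).continuousOn))

theorem right_inv (h : IsKatoLimit J BV a b M u w un wn uVn wVn σ) {t : ℝ} (ht : t ∈ Icc a b)
    (f : W) : u t (w t f) = f := by
  have h1 : TendstoUniformlyOn (fun n (_ : Unit) => un n t (wn n t f)) (fun _ => u t (w t f))
      atTop univ :=
    tendstoUniformlyOn_clm_apply (T := fun _ => u t) (y := fun _ => w t f)
      (fun n _ _ => (h.approx n).norm_le t)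
      (((h.tendsto _).tendsto_at ht).tendstoUniformlyOn_const _)
      (((h.tendsto_inv _).tendsto_at ht).tendstoUniformlyOn_const _)
  refine tendsto_nhds_unique (h1.tendsto_at (mem_univ ())) ?_
  simp only [(h.approx _).right_inv]
  exact tendsto_const_nhds

theorem left_inv (h : IsKatoLimit J BV a b M u w un wn uVn wVn σ) {t : ℝ} (ht : t ∈ Icc a b)
    (f : W) : w t (u t f) = f := by
  have h1 : TendstoUniformlyOn (fun n (_ : Unit) => wn n t (un n t f)) (fun _ => w t (u t f))
      atTop univ :=
    tendstoUniformlyOn_clm_apply (T := fun _ => w t) (y := fun _ => u t f)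
      (fun n _ _ => (h.approx n).norm_inv_le t)
      (((h.tendsto_inv _).tendsto_at ht).tendstoUniformlyOn_const _)
      (((h.tendsto _).tendsto_at ht).tendstoUniformlyOn_const _)
  refine tendsto_nhds_unique (h1.tendsto_at (mem_univ ())) ?_
  simp only [(h.approx _).left_inv]
  exact tendsto_const_nhds

theorem tendsto_near (h : IsKatoLimit J BV a b M u w un wn uVn wVn σ)
    {X : Type*} [PseudoMetricSpace X] {F : ℝ → X} (hF : ContinuousOn F (Icc a b)) :
    TendstoUniformlyOn (fun n t => F (σ n t)) F atTop (Ico a b) :=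
  tendstoUniformlyOn_comp_near hF (fun n => (h.approx n).mem) (fun n => (h.approx n).near)

variable [CompleteSpace W]

/-- The derivative of `wn n t (J v)` contains the generator applied to the fixed vector `v`, not to
an evolved one. It therefore converges by strong convergence on `W` alone. -/
theorem hasDerivWithinAt_inv (h : IsKatoLimit J BV a b M u w un wn uVn wVn σ) (hab : a ≤ b)
    (hBV : ContinuousOn BV (Icc a b)) (v : V) : ∀ t ∈ Icc a b,
      HasDerivWithinAt (fun r => w r (J v)) (Complex.I • w t (BV t v)) (Icc a b) t := by
  have hBVv : ContinuousOn (fun t => BV t v) (Icc a b) := hBV.clm_apply continuousOn_const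
  have hc : ContinuousOn (fun t => w t (BV t v)) (Icc a b) :=
    continuousOn_clm_apply_of_norm_le (fun t ht => h.norm_inv_le ht) h.continuousOn_inv hBVv
  refine hasDerivWithinAt_of_tendstoUniformlyOn hab (g := fun n t => wn n t (J v))
    (h := fun n t => Complex.I • wn n t (BV (σ n t) v))
    (fun n => ((h.approx n).continuous_inv _).continuousOn)
    (fun n t ht => (h.approx n).deriv_inv t ht v) ?_ (hc.const_smul _)
    (fun t ht => (h.tendsto_inv _).tendsto_at ht)
  refine (uniformContinuous_id.const_smul Complex.I).comp_tendstoUniformlyOn ?_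
  exact tendstoUniformlyOn_clm_apply (y := fun t => BV t v)
    (fun n t _ => (h.approx n).norm_inv_le t)
    ((tendstoUniformlyOn_clm_apply_of_isCompact isCompact_Icc
      (fun n t _ => (h.approx n).norm_inv_le t) (fun t ht => h.norm_inv_le ht) h.tendsto_inv
      hBVv).mono Ico_subset_Icc_self) (h.tendsto_near hBVv)

end IsKatoLimit

end KatoLimit

end KreinEvolution

namespace KreinEvolution

open Filter Topology

theorem exists_norm_le_of_continuousOn_norm {E : Type*} [SeminormedAddCommGroup E] {a b : ℝ}
    {P : ℝ → E} (hP : ContinuousOn P (Icc a b)) : ∃ M, ∀ t ∈ Icc a b, ‖P t‖ ≤ M :=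
  isCompact_Icc.exists_bound_of_continuousOn hP

/-- The vectors need only be bounded. This is what is known of `uVn n t v`, for which no convergence
in `V` is established. -/
theorem tendstoUniformlyOn_sub_apply {E F : Type*} [NormedAddCommGroup E] [NormedSpace ℂ E]
    [NormedAddCommGroup F] [NormedSpace ℂ F] {α : Type*} {A : ℕ → α → E →L[ℂ] F}
    {T : α → E →L[ℂ] F} {x : ℕ → α → E} {s : Set α} {M : ℝ}
    (hA : TendstoUniformlyOn A T atTop s) (hx : ∀ n, ∀ t ∈ s, ‖x n t‖ ≤ M) :
    TendstoUniformlyOn (fun n t => (T t - A n t) (x n t)) (fun _ => 0) atTop s := by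
  rw [Metric.tendstoUniformlyOn_iff] at hA ⊢
  intro ε hε
  filter_upwards [hA (ε / (|M| + 1)) (by positivity)] with n h1 t ht
  have h3 := h1 t ht
  rw [dist_eq_norm, lt_div_iff₀ (by positivity)] at h3
  rw [dist_zero_left]
  refine lt_of_le_of_lt ?_ h3
  exact ContinuousLinearMap.le_opNorm_of_le _ ((hx n t ht).trans (by linarith [le_abs_self M]))

/-! ### The bounded perturbation in the interaction picture -/

section Perturbation

variable {W V : Type*} [NormedAddCommGroup W] [InnerProductSpace ℂ W]
  [NormedAddCommGroup V] [InnerProductSpace ℂ V] {J : V →L[ℂ] W}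
  {BV : ℝ → V →L[ℂ] W} {a b M : ℝ} {u w : ℝ → W →L[ℂ] W} {un wn : ℕ → ℝ → W →L[ℂ] W}
  {uVn wVn : ℕ → ℝ → V →L[ℂ] V} {σ : ℕ → ℝ → ℝ} {P : ℝ → W →L[ℂ] W}

namespace IsKatoLimit

/-- If a family of operators solves the backward equation of the perturbed family, then its
composition with the unperturbed evolution solves the backward equation of the interaction
picture. -/
theorem hasDerivWithinAt_comp (h : IsKatoLimit J BV a b M u w un wn uVn wVn σ)
    (hJd : DenseRange J) (hab : a ≤ b)
    (hBV : ContinuousOn BV (Icc a b)) (hP : ContinuousOn P (Icc a b))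
    {F : Type*} [NormedAddCommGroup F] [NormedSpace ℂ F] [CompleteSpace F]
    {A : ℝ → W →L[ℂ] F} {MA : ℝ} (hA : ∀ t ∈ Icc a b, ‖A t‖ ≤ MA)
    (hAc : ∀ f, ContinuousOn (fun t => A t f) (Icc a b))
    (hAd : ∀ v, ∀ t ∈ Icc a b, HasDerivWithinAt (fun r => A r (J v))
      (Complex.I • A t (BV t v + P t (J v))) (Icc a b) t) (f : W) :
    ∀ t ∈ Icc a b, HasDerivWithinAt (fun r => A r (u r f))
      (Complex.I • A t (P t (u t f))) (Icc a b) t := by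
  obtain ⟨MP, hMP⟩ := exists_norm_le_of_continuousOn_norm hP
  have hPu : ∀ f, ContinuousOn (fun t => P t (u t f)) (Icc a b) := fun f =>
    hP.clm_apply (h.continuousOn f)
  have hc : ∀ f, ContinuousOn (fun t => Complex.I • A t (P t (u t f))) (Icc a b) := fun f =>
    (continuousOn_clm_apply_of_norm_le hA hAc (hPu f)).const_smul _
  refine hasDerivWithinAt_of_dense (M := MA * (MP * M)) hab (A := fun t => A t ∘L u t)
    (A' := fun t => Complex.I • (A t ∘L P t ∘L u t)) (fun t ht => ?_) hc hJd ?_ f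
  · rw [norm_smul, Complex.norm_I, one_mul]
    have h1 := hA t ht
    have h2 := hMP t ht
    refine (ContinuousLinearMap.opNorm_comp_le _ _).trans
      (mul_le_mul h1 ?_ (norm_nonneg _) ((norm_nonneg _).trans h1))
    exact (ContinuousLinearMap.opNorm_comp_le _ _).trans
      (mul_le_mul h2 (h.norm_le ht) (norm_nonneg _) ((norm_nonneg _).trans h2))
  rintro _ ⟨v, rfl⟩
  refine hasDerivWithinAt_of_tendstoUniformlyOn hab (g := fun n t => A t (un n t (J v)))
    (h := fun n t => Complex.I •
      A t ((BV t - BV (σ n t)) (uVn n t v) + P t (un n t (J v))))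
    (fun n => continuousOn_clm_apply_of_norm_le hA hAc ((h.approx n).continuous _).continuousOn)
    (fun n t ht => ?_) ?_ (hc (J v)) (fun t ht => ?_)
  · have ht' := Ico_subset_Icc_self ht
    have h1 := (hAd (uVn n t v) t ht').of_Icc_Ici ht
    rw [(h.approx n).comm] at h1
    have h2 : ContinuousWithinAt (fun r => A r (-(Complex.I • BV (σ n t) (uVn n t v)))) (Ici t) t :=
      (hAc _ t ht').mono_of_mem_nhdsWithin (Icc_mem_nhdsGE_of_mem ht)
    have h3 := hasDerivWithinAt_clm_apply (M := MA) (by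
      filter_upwards [Icc_mem_nhdsGE_of_mem ht] with r hr using hA r hr) h1 h2
      ((h.approx n).deriv t ht v)
    refine h3.congr_deriv ?_
    simp only [map_neg, map_smul, map_add, sub_apply, map_sub, smul_add, smul_sub]
    abel
  · refine (uniformContinuous_id.const_smul Complex.I).comp_tendstoUniformlyOn ?_
    -- The backward equation of `A` contributes the generator at `t`, the approximation the one at
    -- `σ n t`. Their difference tends to zero in norm, so the bound of `uVn n t v` in `V` is
    -- enough, and only `P` survives.
    have h1 := tendstoUniformlyOn_sub_apply (x := fun n t => uVn n t v) (M := M * ‖v‖)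
      (h.tendsto_near hBV) (fun n t _ => (uVn n t).le_of_opNorm_le ((h.approx n).normV_le t) v)
    have h2 : TendstoUniformlyOn (fun n t => P t (un n t (J v))) (fun t => P t (u t (J v))) atTop
        (Ico a b) :=
      tendstoUniformlyOn_clm_apply (g := fun _ => P) (y := fun t => u t (J v)) (M := MP)
        (fun n t ht => hMP t (Ico_subset_Icc_self ht))
        (by
          rw [Metric.tendstoUniformlyOn_iff]
          exact fun ε hε => Eventually.of_forall fun n t ht => by simpa using hε)
        ((h.tendsto _).mono Ico_subset_Icc_self)
    have h3 : TendstoUniformlyOn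
        (fun n t => (BV t - BV (σ n t)) (uVn n t v) + P t (un n t (J v)))
        (fun t => P t (u t (J v))) atTop (Ico a b) := by
      have := h1.add h2
      refine this.congr_right fun t _ => ?_
      simp
    exact tendstoUniformlyOn_clm_apply (g := fun _ => A) (y := fun t => P t (u t (J v))) (M := MA)
        (fun n t ht => hA t (Ico_subset_Icc_self ht))
        (by
          rw [Metric.tendstoUniformlyOn_iff]
          exact fun ε hε => Eventually.of_forall fun n t ht => by simpa using hε) h3
  · exact ((A t).continuous.tendsto _).comp ((h.tendsto _).tendsto_at ht)

/-- The weak forward equation of the unperturbed evolution. -/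
theorem hasDerivWithinAt_form (h : IsKatoLimit J BV a b M u w un wn uVn wVn σ)
    (hJd : DenseRange J) (hab : a ≤ b)
    (hBV : ContinuousOn BV (Icc a b)) (hP : ContinuousOn P (Icc a b)) (Q : W →L⋆[ℂ] W →L[ℂ] ℂ)
    (hQ : ∀ t ∈ Icc a b, ∀ v v' : V,
      Q (J v) (BV t v' + P t (J v')) = Q (BV t v + P t (J v)) (J v')) (v : V) (f : W) :
    ∀ t ∈ Icc a b, HasDerivWithinAt (fun r => Q (J v) (u r f))
      (-(Complex.I * (Q (BV t v + P t (J v)) (u t f) - Q (J v) (P t (u t f))))) (Icc a b) t := by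
  obtain ⟨MP, hMP⟩ := exists_norm_le_of_continuousOn_norm hP
  set c : ℝ → W := fun t => BV t v + P t (J v) with hc
  have hcc : ContinuousOn c (Icc a b) :=
    (hBV.clm_apply continuousOn_const).add (hP.clm_apply continuousOn_const)
  have hQc : ContinuousOn (fun t => Q (c t)) (Icc a b) := Q.continuous.comp_continuousOn hcc
  obtain ⟨MQ, hMQ⟩ := exists_norm_le_of_continuousOn_norm hQc
  have hcont : ∀ f, ContinuousOn (fun t => -(Complex.I * (Q (c t) (u t f) - Q (J v) (P t (u t f)))))
      (Icc a b) := fun f =>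
    (continuousOn_const.mul ((hQc.clm_apply (h.continuousOn f)).sub
      ((Q (J v)).continuous.comp_continuousOn (hP.clm_apply (h.continuousOn f))))).neg
  refine hasDerivWithinAt_of_dense (M := MQ * M + ‖Q (J v)‖ * (MP * M)) hab
    (A := fun t => Q (J v) ∘L u t)
    (A' := fun t => -(Complex.I • (Q (c t) ∘L u t - Q (J v) ∘L P t ∘L u t))) (fun t ht => ?_)
    hcont hJd ?_ f
  · rw [norm_neg, norm_smul, Complex.norm_I, one_mul]
    refine (norm_sub_le _ _).trans (add_le_add ?_ ?_)
    · have h1 := hMQ t ht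
      exact (ContinuousLinearMap.opNorm_comp_le _ _).trans
        (mul_le_mul h1 (h.norm_le ht) (norm_nonneg _) ((norm_nonneg _).trans h1))
    · have h2 := hMP t ht
      refine (ContinuousLinearMap.opNorm_comp_le _ _).trans
        (mul_le_mul_of_nonneg_left ?_ (norm_nonneg _))
      exact (ContinuousLinearMap.opNorm_comp_le _ _).trans
        (mul_le_mul h2 (h.norm_le ht) (norm_nonneg _) ((norm_nonneg _).trans h2))
  rintro _ ⟨v', rfl⟩
  have hunb : ∀ n, ∀ t ∈ Ico a b, ‖un n t (J v')‖ ≤ M * ‖J v'‖ := fun n t _ =>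
    (un n t).le_of_opNorm_le ((h.approx n).norm_le t) _
  have hun := (h.tendsto (J v')).mono (Ico_subset_Icc_self)
  refine hasDerivWithinAt_of_tendstoUniformlyOn hab (g := fun n t => Q (J v) (un n t (J v')))
    (h := fun n t => -(Complex.I * (Q (c (σ n t)) (un n t (J v')) -
      Q (J v) (P (σ n t) (un n t (J v'))))))
    (fun n => ((Q (J v)).continuous.comp ((h.approx n).continuous _)).continuousOn)
    (fun n t ht => ?_) ?_ (hcont (J v')) (fun t ht => ?_)
  · have h1 := ((Q (J v)).restrictScalars ℝ).hasFDerivAt.comp_hasDerivWithinAt t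
      ((h.approx n).deriv t ht v')
    refine h1.congr_deriv ?_
    -- Symmetry at the frozen time moves the generator to the fixed vector `v`; the remaining terms
    -- involve only quantities that converge in `W`.
    have h2 := hQ _ ((h.approx n).mem t ht) v (uVn n t v')
    rw [(h.approx n).comm, map_add] at h2
    rw [hc, ← h2]
    simp
  · have hmul : UniformContinuous fun z : ℂ => -(Complex.I * z) :=
      (uniformContinuous_id.const_smul Complex.I).neg
    refine hmul.comp_tendstoUniformlyOn (TendstoUniformlyOn.sub ?_ ?_)
    · exact tendstoUniformlyOn_clm_apply_of_norm (T := fun t => Q (c t))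
        (y := fun t => u t (J v')) (h.tendsto_near hQc)
        (fun t ht => hMQ t (Ico_subset_Icc_self ht)) hun hunb
    · exact (Q (J v)).uniformContinuous.comp_tendstoUniformlyOn
        (tendstoUniformlyOn_clm_apply_of_norm (y := fun t => u t (J v')) (h.tendsto_near hP)
        (fun t ht => hMP t (Ico_subset_Icc_self ht)) hun hunb)
  · exact ((Q (J v)).continuous.tendsto _).comp ((h.tendsto _).tendsto_at ht)

end IsKatoLimit

/-- The evolution of the interaction picture and its inverse. -/
structure IsInteraction (u w P : ℝ → W →L[ℂ] W) (a b : ℝ) (X Z : ℝ → W →L[ℂ] W) : Prop where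
  right_inv : ∀ t f, X t (Z t f) = f
  left_inv : ∀ t f, Z t (X t f) = f
  deriv : ∀ f, ∀ t ∈ Icc a b, HasDerivWithinAt (fun r => X r f)
    (-(Complex.I • w t (P t (u t (X t f))))) (Icc a b) t
  deriv_inv : ∀ f, ∀ t ∈ Icc a b, HasDerivWithinAt (fun r => Z r f)
    (Complex.I • Z t (w t (P t (u t f)))) (Icc a b) t

variable [CompleteSpace W]

namespace IsKatoLimit

/-- The coefficient `-i w P u` is bounded and strongly continuous on `[a, b]`. Composing it with the
projection of the line onto the interval makes the global existence theorem applicable. -/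
theorem exists_interaction (h : IsKatoLimit J BV a b M u w un wn uVn wVn σ)
    (hab : a ≤ b) (hP : ContinuousOn P (Icc a b)) : ∃ X Z, IsInteraction u w P a b X Z := by
  obtain ⟨MP, hMP⟩ := exists_norm_le_of_continuousOn_norm hP
  have hc : ∀ f, ContinuousOn (fun t => w t (P t (u t f))) (Icc a b) := fun f =>
    continuousOn_clm_apply_of_norm_le (fun t ht => h.norm_inv_le ht) h.continuousOn_inv
      (hP.clm_apply (h.continuousOn f))
  set p : ℝ → ℝ := fun t => projIcc a b hab t with hp
  have hpc : Continuous p := continuous_subtype_val.comp continuous_projIcc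
  have hpm : ∀ t, p t ∈ Icc a b := fun t => (projIcc a b hab t).2
  have hpe : ∀ t ∈ Icc a b, p t = t := fun t ht => by simp [hp, projIcc_of_mem hab ht]
  obtain ⟨X, Z, -, hXZ, hZX, hXd, hZd⟩ := exists_fundamentalSolution
    (K := fun t => -(Complex.I • (w (p t) ∘L P (p t) ∘L u (p t)))) (M := M * (MP * M))
    (fun f => (((hc f).comp_continuous hpc hpm).const_smul Complex.I).neg) (fun t => by
      rw [norm_neg, norm_smul, Complex.norm_I, one_mul]
      have h1 := h.norm_inv_le (hpm t)
      have h2 := hMP _ (hpm t)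
      refine (ContinuousLinearMap.opNorm_comp_le _ _).trans
        (mul_le_mul h1 ?_ (norm_nonneg _) ((norm_nonneg _).trans h1))
      exact (ContinuousLinearMap.opNorm_comp_le _ _).trans
        (mul_le_mul h2 (h.norm_le (hpm t)) (norm_nonneg _) ((norm_nonneg _).trans h2))) a
  refine ⟨X, Z, hXZ, hZX, fun f t ht => ?_, fun f t ht => ?_⟩
  · have := (hXd f t).hasDerivWithinAt (s := Icc a b)
    rw [hpe t ht] at this
    simpa using this
  · have := (hZd f t).hasDerivWithinAt (s := Icc a b)
    rw [hpe t ht] at this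
    simpa using this

variable {X Z : ℝ → W →L[ℂ] W}

/-- The derivative is `i A P u X f` from the backward equation, plus `A u (-i w P u X f)` from the
interaction picture. These cancel since `u w = 1`. -/
theorem apply_eq_of_hasDerivWithinAt (h : IsKatoLimit J BV a b M u w un wn uVn wVn σ)
    (hX : IsInteraction u w P a b X Z)
    (hJd : DenseRange J) (hab : a ≤ b)
    (hBV : ContinuousOn BV (Icc a b)) (hP : ContinuousOn P (Icc a b))
    {F : Type*} [NormedAddCommGroup F] [NormedSpace ℂ F] [CompleteSpace F]
    {A : ℝ → W →L[ℂ] F}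
    (hAc : ∀ f, ContinuousOn (fun t => A t f) (Icc a b))
    (hAd : ∀ v, ∀ t ∈ Icc a b, HasDerivWithinAt (fun r => A r (J v))
      (Complex.I • A t (BV t v + P t (J v))) (Icc a b) t) (f : W) :
    ∀ t ∈ Icc a b, ∀ s ∈ Icc a b, A t (u t (X t f)) = A s (u s (X s f)) := by
  obtain ⟨MA, hMA, hA⟩ := exists_norm_le_of_continuousOn isCompact_Icc hAc
  refine eq_of_hasDerivWithinAt_zero fun t ht => ?_
  have h1 := hasDerivWithinAt_clm_apply (R := fun t => A t ∘L u t) (M := MA * M)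
    (eventually_nhdsWithin_of_forall fun r hr =>
      (ContinuousLinearMap.opNorm_comp_le _ _).trans
        (mul_le_mul (hA r hr) (h.norm_le hr) (norm_nonneg _) hMA))
    (h.hasDerivWithinAt_comp hJd hab hBV hP hA hAc hAd (X t f) t ht)
    (continuousOn_clm_apply_of_norm_le hA hAc (h.continuousOn _) t ht) (hX.deriv f t ht)
  refine h1.congr_deriv ?_
  simp [h.right_inv ht]

/-- The perturbed evolution, with the initial time `a`, preserves every form for which the
generators are symmetric. -/
theorem form_eq (h : IsKatoLimit J BV a b M u w un wn uVn wVn σ)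
    (hX : IsInteraction u w P a b X Z)
    (hJd : DenseRange J) (hab : a ≤ b)
    (hBV : ContinuousOn BV (Icc a b)) (hP : ContinuousOn P (Icc a b)) {Q : W →L⋆[ℂ] W →L[ℂ] ℂ}
    (hQh : IsHermitianForm Q) (hQ : ∀ t ∈ Icc a b, ∀ v v' : V,
      Q (J v) (BV t v' + P t (J v')) = Q (BV t v + P t (J v)) (J v')) (f g : W) :
    ∀ t ∈ Icc a b, ∀ s ∈ Icc a b,
      Q (u t (X t f)) (u t (X t g)) = Q (u s (X s f)) (u s (X s g)) := by
  have huX : ContinuousOn (fun t => u t (X t f)) (Icc a b) :=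
    continuousOn_clm_apply_of_norm_le (fun t ht => h.norm_le ht) h.continuousOn
      fun t ht => (hX.deriv f t ht).continuousWithinAt
  -- The functional `Q (u t (X t f))` solves the backward equation: in the weak forward equation the
  -- two contributions of `P` cancel, and conjugation by Hermiticity puts the evolved vector in the
  -- first variable.
  refine h.apply_eq_of_hasDerivWithinAt hX hJd hab hBV hP (A := fun t => Q (u t (X t f)))
    (fun g => (Q.continuous.comp_continuousOn huX).clm_apply continuousOn_const)
    (fun v t ht => ?_) g
  have h1 := hasDerivWithinAt_clm_apply (R := fun t => Q (J v) ∘L u t) (M := ‖Q (J v)‖ * M)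
    (eventually_nhdsWithin_of_forall fun r hr =>
      (ContinuousLinearMap.opNorm_comp_le _ _).trans
        (mul_le_mul_of_nonneg_left (h.norm_le hr) (norm_nonneg _)))
    (h.hasDerivWithinAt_form hJd hab hBV hP Q hQ v (X t f) t ht)
    ((Q (J v)).continuous.comp_continuousOn (h.continuousOn _) t ht) (hX.deriv f t ht)
  have h2 := Complex.conjCLE.toContinuousLinearMap.hasFDerivAt.comp_hasDerivWithinAt t h1
  have h3 : (fun r => Q (u r (X r f)) (J v)) =
      Complex.conjCLE.toContinuousLinearMap ∘ fun r => (Q (J v) ∘L u r) (X r f) := by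
    ext r
    simpa using (hQh _ _).symm
  rw [h3]
  refine h2.congr_deriv ?_
  rw [← hQh (BV t v + P t (J v))]
  simp [h.right_inv ht]
  ring

end IsKatoLimit

end Perturbation

end KreinEvolution

namespace KreinEvolution

open Filter Topology

/-! ### Existence, uniqueness and pseudo-unitarity of the evolution -/

section Evolution

variable {W V : Type*} [NormedAddCommGroup W] [InnerProductSpace ℂ W]
  [NormedAddCommGroup V] [InnerProductSpace ℂ V] {J : V →L[ℂ] W}

theorem mem_graph_perturbed {B₀ : ℝ → W →ₗ.[ℂ] W} {P : ℝ → W →L[ℂ] W} {t : ℝ} {x y : W} :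
    (x, y) ∈ (perturbed B₀ P t).graph ↔ (x, y - P t x) ∈ (B₀ t).graph := by
  simp only [LinearPMap.mem_graph_iff]
  constructor
  · rintro ⟨z, rfl, rfl⟩
    refine ⟨z, rfl, ?_⟩
    simp only [perturbed]
    exact (add_sub_cancel_left (P t z) (B₀ t z)).symm
  · rintro ⟨z, rfl, hz⟩
    refine ⟨z, rfl, ?_⟩
    simp only [perturbed, LinearPMap.vadd_apply]
    rw [add_comm]
    exact eq_sub_iff_add_eq.1 hz

theorem IsPseudoUnitaryGenerator.symm {Q : W →L⋆[ℂ] W →L[ℂ] ℂ} {B : W →ₗ.[ℂ] W}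
    (hB : IsPseudoUnitaryGenerator Q B) {v u w x : W} (h : (v, u) ∈ B.graph)
    (h' : (w, x) ∈ B.graph) : Q v x = Q u w := by
  obtain ⟨y, rfl, rfl⟩ := B.mem_graph_iff.1 h
  obtain ⟨z, rfl, rfl⟩ := B.mem_graph_iff.1 h'
  exact hB.2 y z

variable [CompleteSpace W] {BV : ℝ → V →L[ℂ] W} {a b M : ℝ} {u w : ℝ → W →L[ℂ] W}
  {un wn : ℕ → ℝ → W →L[ℂ] W} {uVn wVn : ℕ → ℝ → V →L[ℂ] V} {σ : ℕ → ℝ → ℝ}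
  {B₀ : ℝ → W →ₗ.[ℂ] W} {P X Z : ℝ → W →L[ℂ] W}

namespace IsKatoLimit

/-- The dependence on `s` is in `Z s w s`, and the product rule gives the two parts of the
generator: `BV` from `w`, and `P` from `Z`, where `u w = 1` removes the conjugation. -/
theorem isEvolutionGeneratedBy (h : IsKatoLimit J BV a b M u w un wn uVn wVn σ)
    (hX : IsInteraction u w P a b X Z) (hab : a ≤ b) (hBV : ContinuousOn BV (Icc a b))
    (hB : ∀ t ∈ Icc a b, ∀ v, (J v, BV t v) ∈ (B₀ t).graph) :
    IsEvolutionGeneratedBy J a b (perturbed B₀ P) fun t s => u t ∘L X t ∘L Z s ∘L w s := by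
  have hXc : ∀ f, ContinuousOn (fun t => X t f) (Icc a b) := fun f t ht =>
    (hX.deriv f t ht).continuousWithinAt
  have hZc : ∀ f, ContinuousOn (fun t => Z t f) (Icc a b) := fun f t ht =>
    (hX.deriv_inv f t ht).continuousWithinAt
  obtain ⟨MX, hMX, hXb⟩ := exists_norm_le_of_continuousOn isCompact_Icc hXc
  obtain ⟨MZ, hMZ, hZb⟩ := exists_norm_le_of_continuousOn isCompact_Icc hZc
  have h1 : ∀ f, ContinuousOn (fun t => u t (X t f)) (Icc a b) := fun f =>
    continuousOn_clm_apply_of_norm_le (fun t ht => h.norm_le ht) h.continuousOn (hXc f)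
  have h2 : ∀ f, ContinuousOn (fun t => Z t (w t f)) (Icc a b) := fun f =>
    continuousOn_clm_apply_of_norm_le hZb hZc (h.continuousOn_inv f)
  refine ⟨⟨fun t ht => ?_, fun t _ s hs r _ => ?_, fun f => ?_⟩, fun t _ s hs v x hx => ?_⟩
  · ext f
    simp [hX.right_inv, h.right_inv ht]
  · ext f
    simp [hX.left_inv, h.left_inv hs]
  · refine continuousOn_clm_apply_of_norm_le (R := fun p : ℝ × ℝ => u p.1 ∘L X p.1)
      (x := fun p : ℝ × ℝ => Z p.2 (w p.2 f)) (M := M * MX) (fun p hp => ?_) (fun g => ?_) ?_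
    · exact (ContinuousLinearMap.opNorm_comp_le _ _).trans
        (mul_le_mul (h.norm_le hp.1) (hXb _ hp.1) (norm_nonneg _)
          ((norm_nonneg _).trans (h.norm_le hp.1)))
    · exact (h1 g).comp continuousOn_fst fun p hp => hp.1
    · exact (h2 f).comp continuousOn_snd fun p hp => hp.2
  · have hx' : x = BV s v + P s (J v) :=
      (perturbed B₀ P s).mem_graph_snd_inj hx
        (mem_graph_perturbed.2 (by simpa using hB s hs v)) rfl
    have h3 := hasDerivWithinAt_clm_apply (eventually_nhdsWithin_of_forall hZb)
      (hX.deriv_inv (w s (J v)) s hs) (hZc _ s hs) (h.hasDerivWithinAt_inv hab hBV v s hs)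
    have h4 := ((u t ∘L X t).restrictScalars ℝ).hasFDerivAt.comp_hasDerivWithinAt s h3
    refine h4.congr_deriv ?_
    rw [hx']
    simp [h.right_inv hs, add_comm]

/-- For a fixed `t`, the family `R t` solves the backward equation, so `R t r` composed with `u r X
r` is constant in `r`. Its values at `r = t` and `r = s` are compared. -/
theorem eq_of_isEvolutionGeneratedBy (h : IsKatoLimit J BV a b M u w un wn uVn wVn σ)
    (hX : IsInteraction u w P a b X Z) (hJd : DenseRange J) (hab : a ≤ b)
    (hBV : ContinuousOn BV (Icc a b)) (hP : ContinuousOn P (Icc a b))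
    (hB : ∀ t ∈ Icc a b, ∀ v, (J v, BV t v) ∈ (B₀ t).graph) {R : ℝ → ℝ → W →L[ℂ] W}
    (hR : IsEvolutionGeneratedBy J a b (perturbed B₀ P) R) {t s : ℝ} (ht : t ∈ Icc a b)
    (hs : s ∈ Icc a b) (f : W) : R t s f = u t (X t (Z s (w s f))) := by
  have h1 := h.apply_eq_of_hasDerivWithinAt hX hJd hab hBV hP (A := fun r => R t r)
    (fun f => (hR.continuousOn f).comp (by fun_prop : Continuous fun r : ℝ => (t, r)).continuousOn
      fun r hr => ⟨ht, hr⟩)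
    (fun v r hr => hR.hasDerivWithinAt t ht r hr v _
      (mem_graph_perturbed.2 (by simpa using hB r hr v))) (Z s (w s f)) t ht s hs
  rw [hR.refl t ht, hX.right_inv, h.right_inv hs] at h1
  exact h1.symm

end IsKatoLimit

variable [CompleteSpace V]

/-- A family that satisfies Kato's hypotheses, plus a bounded perturbation, generates exactly one
evolution, and this evolution is pseudo-unitary if the family consists of pseudo-unitary
generators. -/
theorem KatoHypotheses.evolution (hJ : Function.Injective J) (hJd : DenseRange J) (hab : a < b)
    {Q : W →L⋆[ℂ] W →L[ℂ] ℂ} (hQ : IsHermitianForm Q) (hB₀ : KatoHypotheses J a b B₀)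
    (hP : ContinuousOn P (Icc a b))
    (hB : ∀ t ∈ Icc a b, IsPseudoUnitaryGenerator Q (perturbed B₀ P t)) :
    (∃ R, IsEvolutionGeneratedBy J a b (perturbed B₀ P) R) ∧
    (∀ R R', IsEvolutionGeneratedBy J a b (perturbed B₀ P) R →
      IsEvolutionGeneratedBy J a b (perturbed B₀ P) R' →
      ∀ t ∈ Icc a b, ∀ s ∈ Icc a b, R t s = R' t s) ∧
    ∀ R, IsEvolutionGeneratedBy J a b (perturbed B₀ P) R →
      ∀ t ∈ Icc a b, ∀ s ∈ Icc a b, ∀ v w, Q (R t s v) (R t s w) = Q v w := by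
  obtain ⟨BV, M, hBV, hBVg, u, w, un, wn, uVn, wVn, σ, h⟩ := hB₀.exists_limit hJ hJd hab
  obtain ⟨X, Z, hX⟩ := h.exists_interaction hab.le hP
  have heq : ∀ R, IsEvolutionGeneratedBy J a b (perturbed B₀ P) R → ∀ {t s}, t ∈ Icc a b →
      s ∈ Icc a b → ∀ f, R t s f = u t (X t (Z s (w s f))) := fun R hR {t s} ht hs f =>
    h.eq_of_isEvolutionGeneratedBy hX hJd hab.le hBV hP hBVg hR ht hs f
  have hg : ∀ t ∈ Icc a b, ∀ v, (J v, BV t v + P t (J v)) ∈ (perturbed B₀ P t).graph :=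
    fun t ht v => mem_graph_perturbed.2 (by simpa using hBVg t ht v)
  refine ⟨⟨_, h.isEvolutionGeneratedBy hX hab.le hBV hBVg⟩, fun R R' hR hR' t ht s hs => ?_,
    fun R hR t ht s hs f g => ?_⟩
  · ext f
    rw [heq R hR ht hs, heq R' hR' ht hs]
  · rw [heq R hR ht hs, heq R hR ht hs, h.form_eq hX hJd hab.le hBV hP hQ
      (fun r hr v v' => (hB r hr).symm (hg r hr v) (hg r hr v')) _ _ t ht s hs]
    simp only [hX.right_inv, h.right_inv hs]

end Evolution

end KreinEvolution

namespace KreinEvolution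

open Filter Topology

/-! ### Complementary subspaces and their `Q`-orthogonal complements -/

section Projections

open scoped InnerProductSpace

variable {H : Type*} [NormedAddCommGroup H] [InnerProductSpace ℂ H] {X Y : Submodule ℂ H}

theorem projAlong_eq (h : IsCompl X Y) {x y : H} (hy : y ∈ X) (hxy : x - y ∈ Y) :
    projAlong X Y x = y := by
  have h1 : projAlong X Y = Submodule.projection X Y h := dif_pos h
  have h2 : x = y + (x - y) := by abel
  rw [h1, h2, map_add, Submodule.projection_apply_of_mem_left h hy,
    Submodule.projection_apply_of_mem_right h hxy, add_zero]

theorem projAlong_mem (h : IsCompl X Y) (x : H) : projAlong X Y x ∈ X := by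
  have h1 : projAlong X Y = Submodule.projection X Y h := dif_pos h
  rw [h1]
  exact Submodule.projection_apply_mem h x

theorem sub_projAlong_mem (h : IsCompl X Y) (x : H) : x - projAlong X Y x ∈ Y := by
  obtain ⟨y, hy, z, hz, rfl⟩ := Submodule.mem_sup.1 (h.sup_eq_top ▸ Submodule.mem_top (x := x))
  rw [projAlong_eq h hy (by simpa using hz)]
  simpa using hz

theorem projAlong_symm (h : IsCompl X Y) (x : H) : projAlong Y X x = x - projAlong X Y x :=
  projAlong_eq h.symm (sub_projAlong_mem h x) (by simpa using projAlong_mem h x)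

/-- The projection onto a closed subspace along a closed complement is bounded. -/
theorem exists_clm_eq_projAlong [CompleteSpace H] (h : IsCompl X Y) (hX : IsClosed (X : Set H))
    (hY : IsClosed (Y : Set H)) : ∃ Λ : H →L[ℂ] H, ∀ x, Λ x = projAlong X Y x := by
  refine ⟨X.subtypeL ∘L Submodule.projectionOntoL X Y 
    (Submodule.IsCompl.isTopCompl_of_isClosed h hX hY), fun x => ?_⟩
  have h1 : projAlong X Y = Submodule.projection X Y h := dif_pos h
  rw [h1]
  rfl

theorem isCompl_of_forall (h0 : ∀ x ∈ X, x ∈ Y → x = 0) (h : ∀ x, ∃ y ∈ X, x - y ∈ Y) :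
    IsCompl X Y := by
  refine isCompl_iff.2 ⟨Submodule.disjoint_def.2 h0, codisjoint_iff.2 (eq_top_iff.2 fun x _ => ?_)⟩
  obtain ⟨y, hy, hxy⟩ := h x
  exact Submodule.mem_sup.2 ⟨y, hy, x - y, hxy, by abel⟩

theorem IsCompl.map_equiv (h : IsCompl X Y) (e : H ≃L[ℂ] H) :
    IsCompl (X.map (e : H →ₗ[ℂ] H)) (Y.map (e : H →ₗ[ℂ] H)) := by
  refine isCompl_of_forall ?_ fun x => ?_
  · rintro _ ⟨x, hx, rfl⟩ ⟨y, hy, hxy⟩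
    have : y = x := e.injective hxy
    subst this
    simp [Submodule.disjoint_def.1 h.disjoint y hx hy]
  · refine ⟨_, ⟨_, projAlong_mem h (e.symm x), rfl⟩, _, sub_projAlong_mem h (e.symm x), ?_⟩
    simp

theorem projAlong_map_equiv (h : IsCompl X Y) (e : H ≃L[ℂ] H) (x : H) :
    projAlong (X.map (e : H →ₗ[ℂ] H)) (Y.map (e : H →ₗ[ℂ] H)) x = e (projAlong X Y (e.symm x)) := by
  refine projAlong_eq (IsCompl.map_equiv h e) ⟨_, projAlong_mem h _, rfl⟩
    ⟨_, sub_projAlong_mem h (e.symm x), ?_⟩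
  simp

theorem isClosed_map_equiv (hX : IsClosed (X : Set H)) (e : H ≃L[ℂ] H) :
    IsClosed (X.map (e : H →ₗ[ℂ] H) : Set H) := by
  rw [Submodule.map_coe]
  exact e.toHomeomorph.isClosedMap _ hX

variable {Q : H →L⋆[ℂ] H →L[ℂ] ℂ}

theorem isClosed_qOrthogonal (Q : H →L⋆[ℂ] H →L[ℂ] ℂ) (X : Submodule ℂ H) :
    IsClosed (qOrthogonal Q X : Set H) := by
  have : (qOrthogonal Q X : Set H) = ⋂ v ∈ X, {w | Q w v = 0} := by
    ext w
    simp only [mem_iInter]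
    exact Iff.rfl
  rw [this]
  exact isClosed_biInter fun v _ => isClosed_eq (continuous_form_left Q v) continuous_const

/-- The orthogonal complements of two complementary closed subspaces are complementary. -/
theorem isCompl_qOrthogonal [CompleteSpace H] (hQ : IsKrein Q) (h : IsCompl X Y)
    (hX : IsClosed (X : Set H)) (hY : IsClosed (Y : Set H)) :
    IsCompl (qOrthogonal Q X) (qOrthogonal Q Y) := by
  obtain ⟨Γ, hΓ⟩ := hQ.exists_equiv
  obtain ⟨Λ, hΛ⟩ := exists_clm_eq_projAlong h hX hY
  have hnd : ∀ v, (∀ w, Q v w = 0) → v = 0 := fun v hv => by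
    have : Γ v = 0 := ext_inner_right ℂ fun w => by rw [← hΓ, hv, inner_zero_left]
    simpa using this
  -- The operator `Γ⁻¹ Λ* Γ` is the `Q`-adjoint of `Λ`. It maps into the complement of `Y`, and `1`
  -- minus it maps into the complement of `X`, which gives the decomposition.
  have hA : ∀ v w, Q (Γ.symm (Λ.adjoint (Γ v))) w = Q v (Λ w) := fun v w => by
    rw [hΓ, hΓ, ContinuousLinearEquiv.apply_symm_apply, ContinuousLinearMap.adjoint_inner_left]
  have hmemX : ∀ w, Λ w ∈ X := fun w => hΛ w ▸ projAlong_mem h w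
  have hmemY : ∀ w, w - Λ w ∈ Y := fun w => hΛ w ▸ sub_projAlong_mem h w
  have hX1 : ∀ w ∈ X, Λ w = w := fun w hw => by
    rw [hΛ, projAlong_eq h hw (by simp)]
  have hY1 : ∀ w ∈ Y, Λ w = 0 := fun w hw => by
    rw [hΛ, projAlong_eq h X.zero_mem (by simpa using hw)]
  refine isCompl_of_forall (fun x hx hx' => hnd x fun w => ?_) fun x =>
    ⟨x - Γ.symm (Λ.adjoint (Γ x)), fun v hv => ?_, fun v hv => ?_⟩
  · have h1 := hx _ (hmemX w)
    have h2 := hx' _ (hmemY w)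
    rwa [map_sub, h1, sub_zero] at h2
  · rw [map_sub, sub_apply, hA, hX1 v hv, sub_self]
  · rw [sub_sub_cancel, hA, hY1 v hv, map_zero]

theorem qOrthogonal_map_equiv (e : H ≃L[ℂ] H) (he : ∀ v w, Q (e v) (e w) = Q v w)
    (X : Submodule ℂ H) : qOrthogonal Q (X.map (e : H →ₗ[ℂ] H)) =
      (qOrthogonal Q X).map (e : H →ₗ[ℂ] H) := by
  ext w
  constructor
  · intro hw
    refine ⟨e.symm w, fun v hv => ?_, by simp⟩
    rw [← he]
    simpa using hw _ ⟨v, hv, rfl⟩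
  · rintro ⟨x, hx, rfl⟩ _ ⟨v, hv, rfl⟩
    exact (he x v).trans (hx v hv)

end Projections

/-! ### Transport of subspaces and projections by the evolution -/

section Evolution

variable {W : Type*} [NormedAddCommGroup W] [InnerProductSpace ℂ W] {a b : ℝ}
  {R : ℝ → ℝ → W →L[ℂ] W} {Zout Zin : Submodule ℂ W}

namespace IsEvolution

theorem apply_apply (hR : IsEvolution a b R) {t s r : ℝ} (ht : t ∈ Icc a b) (hs : s ∈ Icc a b)
    (hr : r ∈ Icc a b) (w : W) : R t s (R s r w) = R t r w := by
  rw [← hR.comp t ht s hs r hr]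
  rfl

theorem apply_self (hR : IsEvolution a b R) {t : ℝ} (ht : t ∈ Icc a b) (w : W) : R t t w = w := by
  rw [hR.refl t ht]
  rfl

theorem exists_equiv (hR : IsEvolution a b R) {t s : ℝ} (ht : t ∈ Icc a b) (hs : s ∈ Icc a b) :
    ∃ e : W ≃L[ℂ] W, (∀ w, e w = R t s w) ∧ ∀ w, e.symm w = R s t w :=
  ⟨ContinuousLinearEquiv.equivOfInverse (R t s) (R s t)
    (fun w => (hR.apply_apply hs ht hs w).trans (hR.apply_self hs w))
    (fun w => (hR.apply_apply ht hs ht w).trans (hR.apply_self ht w)), fun _ => rfl, fun _ => rfl⟩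

theorem transport_transport (hR : IsEvolution a b R) {t s r : ℝ} (ht : t ∈ Icc a b)
    (hs : s ∈ Icc a b) (hr : r ∈ Icc a b) (Z : Submodule ℂ W) :
    transport R s (transport R r Z s) t = transport R r Z t := by
  simp only [transport]
  rw [← Submodule.map_comp]
  congr 1
  ext w
  exact hR.apply_apply ht hs hr w

theorem transport_qOrthogonal (hR : IsEvolution a b R) {t s : ℝ} (ht : t ∈ Icc a b)
    (hs : s ∈ Icc a b) {Q : W →L⋆[ℂ] W →L[ℂ] ℂ} (hQ : ∀ v w, Q (R t s v) (R t s w) = Q v w)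
    (Z : Submodule ℂ W) :
    transport R s (qOrthogonal Q Z) t = qOrthogonal Q (transport R s Z t) := by
  obtain ⟨e, he, -⟩ := hR.exists_equiv ht hs
  have h1 : (R t s : W →ₗ[ℂ] W) = (e : W →ₗ[ℂ] W) := by
    ext w
    exact (he w).symm
  simp only [transport, h1]
  exact (qOrthogonal_map_equiv e (fun v w => by rw [he, he, hQ]) Z).symm

/-- An evolution acts by isomorphisms, so complementarity at one time spreads to all of `[a, b]`,
including the end points. In particular a single projection at the time `a` can serve for every
time. -/
theorem isCompl_transport (hR : IsEvolution a b R) (hab : a ≤ b)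
    (h : AsymptoticComplementarity R a b Zout Zin) {t : ℝ} (ht : t ∈ Icc a b) :
    IsCompl (transport R b Zout t) (transport R a Zin t) := by
  obtain ⟨s, hs, hc⟩ := h
  have hs' := Ioo_subset_Icc_self hs
  obtain ⟨e, he, -⟩ := hR.exists_equiv ht hs'
  have h1 : (e : W →ₗ[ℂ] W) = (R t s : W →ₗ[ℂ] W) := by
    ext w
    exact he w
  have h2 := IsCompl.map_equiv hc.symm e
  rw [h1] at h2
  rw [← hR.transport_transport ht hs' (right_mem_Icc.2 hab),
    ← hR.transport_transport ht hs' (left_mem_Icc.2 hab)]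
  exact h2

theorem isClosed_transport (hR : IsEvolution a b R) {t s : ℝ} (ht : t ∈ Icc a b)
    (hs : s ∈ Icc a b) {Z : Submodule ℂ W} (hZ : IsClosed (Z : Set W)) :
    IsClosed (transport R s Z t : Set W) := by
  obtain ⟨e, he, -⟩ := hR.exists_equiv ht hs
  have h1 : (R t s : W →ₗ[ℂ] W) = (e : W →ₗ[ℂ] W) := by
    ext w
    exact (he w).symm
  simp only [transport, h1]
  exact isClosed_map_equiv hZ e

theorem projAlong_transport (hR : IsEvolution a b R) (hab : a ≤ b)
    (h : AsymptoticComplementarity R a b Zout Zin) {t : ℝ} (ht : t ∈ Icc a b) (w : W) :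
    projAlong (transport R b Zout t) (transport R a Zin t) w =
      R t a (projAlong (transport R b Zout a) (transport R a Zin a) (R a t w)) := by
  have ha := left_mem_Icc.2 hab
  obtain ⟨e, he, he'⟩ := hR.exists_equiv ht ha
  have h1 : (R t a : W →ₗ[ℂ] W) = (e : W →ₗ[ℂ] W) := by
    ext w
    exact (he w).symm
  have h2 : ∀ {r} (_ : r ∈ Icc a b) Z, transport R r Z t =
      (transport R r Z a).map (e : W →ₗ[ℂ] W) := fun hr Z => by
    rw [← hR.transport_transport ht ha hr, ← h1]
    rfl
  rw [h2 (right_mem_Icc.2 hab), h2 ha, projAlong_map_equiv (hR.isCompl_transport hab h ha), he, he']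

/-- The kernel in terms of one bounded projection at the time `a`. -/
theorem exists_projection [CompleteSpace W] (hR : IsEvolution a b R) (hab : a ≤ b)
    (h : AsymptoticComplementarity R a b Zout Zin) (hZout : IsClosed (Zout : Set W))
    (hZin : IsClosed (Zin : Set W)) : ∃ Λ : W →L[ℂ] W,
      (∀ w, Λ w ∈ transport R b Zout a) ∧ (∀ w, w - Λ w ∈ transport R a Zin a) ∧
      ∀ t ∈ Icc a b, ∀ s ∈ Icc a b, ∀ w, inverseKernel R a b Zout Zin t s w =
        R t a (heaviside (t - s) • Λ (R a s w) - heaviside (s - t) • (R a s w - Λ (R a s w))) := by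
  have ha := left_mem_Icc.2 hab
  obtain ⟨Λ, hΛ⟩ := exists_clm_eq_projAlong (hR.isCompl_transport hab h ha)
    (hR.isClosed_transport ha (right_mem_Icc.2 hab) hZout) (hR.isClosed_transport ha ha hZin)
  refine ⟨Λ, fun w => hΛ w ▸ projAlong_mem (hR.isCompl_transport hab h ha) w,
    fun w => hΛ w ▸ sub_projAlong_mem (hR.isCompl_transport hab h ha) w, fun t ht s hs w => ?_⟩
  rw [inverseKernel, projAlong_symm (hR.isCompl_transport hab h hs),
    hR.projAlong_transport hab h hs,
    ← hΛ, map_sub (R t s), hR.apply_apply ht hs ha, map_sub (R t a), map_smul, map_smul,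
    map_sub (R t a), hR.apply_apply ht ha hs]

theorem asymptoticComplementarity_qOrthogonal [CompleteSpace W] {Q : W →L⋆[ℂ] W →L[ℂ] ℂ}
    (hR : IsEvolution a b R) (hab : a ≤ b) (hQ : IsKrein Q)
    (hU : ∀ t ∈ Icc a b, ∀ s ∈ Icc a b, ∀ v w, Q (R t s v) (R t s w) = Q v w)
    (h : AsymptoticComplementarity R a b Zout Zin) (hZout : IsClosed (Zout : Set W))
    (hZin : IsClosed (Zin : Set W)) :
    AsymptoticComplementarity R a b (qOrthogonal Q Zout) (qOrthogonal Q Zin) := by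
  obtain ⟨t, ht, hc⟩ := h
  have ht' := Ioo_subset_Icc_self ht
  have ha := left_mem_Icc.2 hab
  have hb := right_mem_Icc.2 hab
  refine ⟨t, ht, ?_⟩
  rw [hR.transport_qOrthogonal ht' ha (hU t ht' a ha),
    hR.transport_qOrthogonal ht' hb (hU t ht' b hb)]
  exact isCompl_qOrthogonal hQ hc (hR.isClosed_transport ht' ha hZin)
    (hR.isClosed_transport ht' hb hZout)

end IsEvolution

end Evolution

end KreinEvolution

namespace KreinEvolution

open Filter Topology

/-! ### The integral kernel as an operator on `L²` -/

section Transition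

variable {W : Type*} [NormedAddCommGroup W] [InnerProductSpace ℂ W]

/-- `U t` is a bounded, strongly continuous family of invertible operators with the inverses
`Z t`, and these have the same properties. -/
structure IsTransition (U Z : ℝ → W →L[ℂ] W) (M : ℝ) : Prop where
  continuous : ∀ w, Continuous fun t => U t w
  continuous_inv : ∀ w, Continuous fun t => Z t w
  right_inv : ∀ t w, U t (Z t w) = w
  left_inv : ∀ t w, Z t (U t w) = w
  norm_le : ∀ t, ‖U t‖ ≤ M
  norm_inv_le : ∀ t, ‖Z t‖ ≤ M

variable {U Z : ℝ → W →L[ℂ] W} {M a b : ℝ} {h : ℝ → W} {Λ : W →L[ℂ] W}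

theorem IsTransition.symm (hU : IsTransition U Z M) : IsTransition Z U M :=
  ⟨hU.continuous_inv, hU.continuous, hU.left_inv, hU.right_inv, hU.norm_inv_le, hU.norm_le⟩

/-- The family `R(t,a)` is continued by its boundary values outside `[a, b]`, so that continuity,
measurability and bounds hold on the whole line. -/
theorem IsEvolution.exists_isTransition [CompleteSpace W] {R : ℝ → ℝ → W →L[ℂ] W}
    (hR : IsEvolution a b R) (hab : a ≤ b) : ∃ U Z M, IsTransition U Z M ∧
      ∀ t ∈ Icc a b, U t = R t a ∧ Z t = R a t := by
  have ha := left_mem_Icc.2 hab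
  obtain ⟨M, -, hM⟩ := exists_norm_le_of_continuousOn (R := fun p : ℝ × ℝ => R p.1 p.2)
    (isCompact_Icc.prod isCompact_Icc) hR.continuousOn
  have hmem : ∀ t : ℝ, (projIcc a b hab t : ℝ) ∈ Icc a b := fun t => (projIcc a b hab t).2
  have hc : Continuous fun t : ℝ => (projIcc a b hab t : ℝ) :=
    continuous_subtype_val.comp continuous_projIcc
  refine ⟨fun t => R (projIcc a b hab t) a, fun t => R a (projIcc a b hab t), M,
    ⟨fun w => ?_, fun w => ?_, fun t w => ?_, fun t w => ?_, fun t => hM (_, _) ⟨hmem t, ha⟩,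
      fun t => hM (_, _) ⟨ha, hmem t⟩⟩, fun t ht => ?_⟩
  · exact (hR.continuousOn w).comp_continuous (hc.prodMk continuous_const)
      fun t => ⟨hmem t, ha⟩
  · exact (hR.continuousOn w).comp_continuous (continuous_const.prodMk hc)
      fun t => ⟨ha, hmem t⟩
  · rw [hR.apply_apply (hmem t) ha (hmem t), hR.apply_self (hmem t)]
  · rw [hR.apply_apply ha (hmem t) ha, hR.apply_self ha]
  · simp [projIcc_of_mem hab ht]

theorem IsTransition.continuousOn_apply (hU : IsTransition U Z M) {x : ℝ → W} {s : Set ℝ}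
    (hx : ContinuousOn x s) : ContinuousOn (fun t => U t (x t)) s :=
  continuousOn_clm_apply_of_norm_le (fun t _ => hU.norm_le t)
    (fun w => (hU.continuous w).continuousOn) hx

/-- Strong continuity and the uniform bound make `(t, w) ↦ U t w` jointly continuous, so
measurability is preserved. -/
theorem IsTransition.aestronglyMeasurable_apply (hU : IsTransition U Z M) {μ : Measure ℝ}
    {x : ℝ → W} (hx : AEStronglyMeasurable x μ) :
    AEStronglyMeasurable (fun t => U t (x t)) μ := by
  have hc : Continuous fun p : ℝ × W => U p.1 p.2 := by
    rw [← continuousOn_univ]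
    exact continuousOn_clm_apply_of_norm_le (R := fun p : ℝ × W => U p.1)
      (fun p _ => hU.norm_le p.1)
      (fun w => ((hU.continuous w).comp continuous_fst).continuousOn) continuous_snd.continuousOn
  exact hc.comp_aestronglyMeasurable
    ((continuous_id.aestronglyMeasurable (μ := μ)).prodMk hx)

theorem IsTransition.norm_apply_le (hU : IsTransition U Z M) (t : ℝ) (w : W) :
    ‖U t w‖ ≤ M * ‖w‖ := (U t).le_of_opNorm_le (hU.norm_le t) w

theorem IsTransition.integrable_apply (hU : IsTransition U Z M) {μ : Measure ℝ}
    {x : ℝ → W} (hx : Integrable x μ) : Integrable (fun t => U t (x t)) μ :=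
  (hx.norm.const_mul M).mono' (hU.aestronglyMeasurable_apply hx.1)
    (Eventually.of_forall fun t => hU.norm_apply_le t _)

/-- The primitive `∫ₐᵗ h - (1 - Λ) ∫ₐᵇ h` of `h`. For a projection `Λ`, its values at `a` and `b`
are in the kernel and in the range of `Λ`. -/
def splitPrimitive (Λ : W →L[ℂ] W) (a b : ℝ) (h : ℝ → W) (t : ℝ) : W :=
  (∫ s in a..t, h s) - ((∫ s in a..b, h s) - Λ (∫ s in a..b, h s))

theorem continuousOn_primitive_of_Ioo (hab : a ≤ b) (hh : IntegrableOn h (Ioo a b)) :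
    ContinuousOn (fun t => ∫ s in a..t, h s) (Icc a b) := by
  have h1 : IntegrableOn h (uIcc a b) := by
    rw [uIcc_of_le hab]
    exact (integrableOn_Icc_iff_integrableOn_Ioo (by simp) (by simp)).2 hh
  have := intervalIntegral.continuousOn_primitive_interval h1
  rwa [uIcc_of_le hab] at this

theorem continuousOn_splitPrimitive (hab : a ≤ b) (hh : IntegrableOn h (Ioo a b)) :
    ContinuousOn (splitPrimitive Λ a b h) (Icc a b) :=
  (continuousOn_primitive_of_Ioo hab hh).sub continuousOn_const

theorem memLp_two_of_continuousOn (hh : ContinuousOn h (Icc a b)) :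
    MemLp h 2 (volume.restrict (Ioo a b)) := by
  obtain ⟨C, hC⟩ := isCompact_Icc.exists_bound_of_continuousOn hh
  refine MemLp.of_bound ((hh.mono Ioo_subset_Icc_self).aestronglyMeasurable measurableSet_Ioo) C ?_
  filter_upwards [ae_restrict_mem measurableSet_Ioo] with t ht
  exact hC t (Ioo_subset_Icc_self ht)

theorem intervalIntegral_eq_integral_indicator {t : ℝ} (ht : t ∈ Ioo a b) (h : ℝ → W) :
    ∫ s in a..t, h s = ∫ s in Ioo a b, (Iic t).indicator h s := by
  rw [intervalIntegral.integral_of_le ht.1.le, integral_indicator measurableSet_Iic,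
    Measure.restrict_restrict measurableSet_Iic]
  congr 2
  ext s
  simp only [mem_Ioc, mem_inter_iff, mem_Iic, mem_Ioo]
  exact ⟨fun hs => ⟨hs.2, hs.1, hs.2.trans_lt ht.2⟩, fun hs => ⟨hs.2.1, hs.1⟩⟩

theorem intervalIntegral_eq_integral_Ioo (hab : a ≤ b) (h : ℝ → W) :
    ∫ s in a..b, h s = ∫ s in Ioo a b, h s := by
  rw [intervalIntegral.integral_of_le hab, integral_Ioc_eq_integral_Ioo]

/-- For `s ≠ t`, the combination `θ(t-s) Λ - θ(s-t) (1 - Λ)` equals the indicator of `s ≤ t` minus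
`1 - Λ`, and the second term no longer depends on `t`. On the diagonal both Heaviside factors are
`1`, but it is a null set. -/
theorem integral_splitKernel [CompleteSpace W] (hh : IntegrableOn h (Ioo a b)) {t : ℝ}
    (ht : t ∈ Ioo a b) (A : W →L[ℂ] W) :
    IntegrableOn (fun s => A (heaviside (t - s) • Λ (h s) -
      heaviside (s - t) • (h s - Λ (h s)))) (Ioo a b) ∧
    ∫ s in Ioo a b, A (heaviside (t - s) • Λ (h s) - heaviside (s - t) • (h s - Λ (h s))) =
      A (splitPrimitive Λ a b h t) := by
  have h1 : IntegrableOn (fun s => (Iic t).indicator h s - (h s - Λ (h s))) (Ioo a b) :=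
    (hh.indicator measurableSet_Iic).sub (hh.sub (Λ.integrable_comp hh))
  have h2 : (fun s => A ((Iic t).indicator h s - (h s - Λ (h s)))) =ᵐ[volume.restrict (Ioo a b)]
      fun s => A (heaviside (t - s) • Λ (h s) - heaviside (s - t) • (h s - Λ (h s))) := by
    have h3 : ∀ᵐ s ∂volume.restrict (Ioo a b), s ≠ t := by
      exact ae_restrict_of_ae (by simp [ae_iff])
    filter_upwards [h3] with s hs
    rcases lt_or_gt_of_ne hs with hs | hs
    · simp [heaviside, indicator, hs.le, hs.not_ge]
    · simp [heaviside, indicator, hs.le, hs.not_ge]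
  refine ⟨(A.integrable_comp h1).congr h2, ?_⟩
  have h4 : IntegrableOn (fun s => h s - Λ (h s)) (Ioo a b) := hh.sub (Λ.integrable_comp hh)
  rw [← integral_congr_ae h2, A.integral_comp_comm h1, integral_sub (hh.indicator measurableSet_Iic)
    h4, integral_sub hh (Λ.integrable_comp hh),
    Λ.integral_comp_comm hh, splitPrimitive, intervalIntegral_eq_integral_indicator ht,
    intervalIntegral_eq_integral_Ioo (ht.1.trans ht.2).le]

theorem IsTransition.memLp_splitPrimitive (hU : IsTransition U Z M) (hab : a ≤ b)
    (hh : IntegrableOn h (Ioo a b)) :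
    MemLp (fun t => U t (splitPrimitive Λ a b h t)) 2 (volume.restrict (Ioo a b)) :=
  memLp_two_of_continuousOn (hU.continuousOn_apply (continuousOn_splitPrimitive hab hh))

theorem norm_splitPrimitive_le (hh : IntegrableOn h (Ioo a b)) {t : ℝ} (ht : t ∈ Ioo a b) :
    ‖splitPrimitive Λ a b h t‖ ≤ (2 + ‖Λ‖) * ∫ s in Ioo a b, ‖h s‖ := by
  have hab := (ht.1.trans ht.2).le
  have h1 : ‖∫ s in a..t, h s‖ ≤ ∫ s in Ioo a b, ‖h s‖ := by
    rw [intervalIntegral_eq_integral_indicator ht]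
    refine (norm_integral_le_integral_norm _).trans
      (integral_mono (hh.indicator measurableSet_Iic).norm hh.norm fun s => ?_)
    exact norm_indicator_le_norm_self _ _
  have h2 : ‖∫ s in a..b, h s‖ ≤ ∫ s in Ioo a b, ‖h s‖ := by
    rw [intervalIntegral_eq_integral_Ioo hab]
    exact norm_integral_le_integral_norm _
  have h3 : ‖Λ (∫ s in a..b, h s)‖ ≤ ‖Λ‖ * ∫ s in Ioo a b, ‖h s‖ :=
    (Λ.le_opNorm _).trans (by gcongr)
  calc ‖splitPrimitive Λ a b h t‖
      ≤ ‖∫ s in a..t, h s‖ + (‖∫ s in a..b, h s‖ + ‖Λ (∫ s in a..b, h s)‖) :=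
        (norm_sub_le _ _).trans (by gcongr; exact norm_sub_le _ _)
    _ ≤ _ := by linarith

theorem splitPrimitive_congr {k : ℝ → W} (hab : a ≤ b) (hk : h =ᵐ[volume.restrict (Ioo a b)] k)
    {t : ℝ} (ht : t ∈ Ioo a b) : splitPrimitive Λ a b h t = splitPrimitive Λ a b k t := by
  simp only [splitPrimitive, intervalIntegral_eq_integral_indicator ht,
    intervalIntegral_eq_integral_Ioo hab, integral_congr_ae hk]
  congr 1
  refine integral_congr_ae ?_
  filter_upwards [hk] with s hs
  simp [indicator, hs]

theorem splitPrimitive_add {k : ℝ → W} (hh : IntegrableOn h (Ioo a b))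
    (hk : IntegrableOn k (Ioo a b)) {t : ℝ} (ht : t ∈ Ioo a b) :
    splitPrimitive Λ a b (fun s => h s + k s) t =
      splitPrimitive Λ a b h t + splitPrimitive Λ a b k t := by
  have hab := (ht.1.trans ht.2).le
  have h1 : ∀ {k : ℝ → W}, IntegrableOn k (Ioo a b) → IntervalIntegrable k volume a t := fun hk =>
    (intervalIntegrable_iff_integrableOn_Ioo_of_le ht.1.le).2
      (hk.mono_set (Ioo_subset_Ioo_right ht.2.le))
  have h2 : ∀ {k : ℝ → W}, IntegrableOn k (Ioo a b) → IntervalIntegrable k volume a b := fun hk =>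
    (intervalIntegrable_iff_integrableOn_Ioo_of_le hab).2 hk
  simp only [splitPrimitive]
  rw [intervalIntegral.integral_add (h1 hh) (h1 hk), intervalIntegral.integral_add (h2 hh) (h2 hk),
    map_add]
  abel

theorem splitPrimitive_smul (c : ℂ) (t : ℝ) :
    splitPrimitive Λ a b (fun s => c • h s) t = c • splitPrimitive Λ a b h t := by
  simp only [splitPrimitive, intervalIntegral.integral_smul, map_smul, smul_sub]

/-- Hölder's inequality on an interval of finite length. It lets the sup bound of a primitive be
read as a bound in `L²`. -/
theorem exists_integral_norm_le (a b : ℝ) :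
    ∃ C, 0 ≤ C ∧ ∀ f : L2 W a b, ∫ t in Ioo a b, ‖f t‖ ≤ C * ‖f‖ := by
  refine ⟨((volume.restrict (Ioo a b)) univ ^
    (1 / (1 : ENNReal).toReal - 1 / (2 : ENNReal).toReal)).toReal, ENNReal.toReal_nonneg,
    fun f => ?_⟩
  have h1 := eLpNorm_le_eLpNorm_mul_rpow_measure_univ (p := 1) (q := 2) (by norm_num)
    (Lp.aestronglyMeasurable f)
  rw [integral_norm_eq_lintegral_enorm (Lp.aestronglyMeasurable f),
    ← eLpNorm_one_eq_lintegral_enorm,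
    mul_comm, Lp.norm_def, ← ENNReal.toReal_mul]
  refine ENNReal.toReal_mono (ENNReal.mul_ne_top (Lp.eLpNorm_ne_top f) ?_) h1
  exact ENNReal.rpow_ne_top_of_nonneg (by norm_num) (measure_ne_top _ _)

/-- The operator `f ↦ U (∫ₐᵗ Z f - (1 - Λ) ∫ₐᵇ Z f)` on `L²`. -/
theorem IsTransition.exists_clm_L2 (hU : IsTransition U Z M) (hab : a ≤ b) (Λ : W →L[ℂ] W) :
    ∃ E : L2 W a b →L[ℂ] L2 W a b, ∀ f : L2 W a b, E f =ᵐ[volume.restrict (Ioo a b)]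
      fun t => U t (splitPrimitive Λ a b (fun s => Z s (f s)) t) := by
  have hi : ∀ f : L2 W a b, IntegrableOn (fun s => Z s (f s)) (Ioo a b) := fun f =>
    hU.symm.integrable_apply ((Lp.memLp f).integrable (by norm_num))
  have hM : 0 ≤ M := (norm_nonneg _).trans (hU.norm_le 0)
  obtain ⟨C, hC, hCf⟩ := exists_integral_norm_le (W := W) a b
  refine ⟨LinearMap.mkContinuous
    { toFun := fun f => (hU.memLp_splitPrimitive (Λ := Λ) hab (hi f)).toLp _
      map_add' := fun f g => ?_
      map_smul' := fun c f => ?_ }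
    ((measureUnivNNReal (volume.restrict (Ioo a b)) : ℝ) ^ ((2 : ENNReal).toReal)⁻¹ *
      (M * ((2 + ‖Λ‖) * (M * C)))) fun f => ?_, fun f => ?_⟩
  · refine Lp.ext ?_
    filter_upwards [(hU.memLp_splitPrimitive (Λ := Λ) hab (hi (f + g))).coeFn_toLp,
      (hU.memLp_splitPrimitive (Λ := Λ) hab (hi f)).coeFn_toLp,
      (hU.memLp_splitPrimitive (Λ := Λ) hab (hi g)).coeFn_toLp,
      Lp.coeFn_add ((hU.memLp_splitPrimitive (Λ := Λ) hab (hi f)).toLp _)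
        ((hU.memLp_splitPrimitive (Λ := Λ) hab (hi g)).toLp _),
      ae_restrict_mem measurableSet_Ioo] with t h1 h2 h3 h4 ht
    rw [h1, h4, Pi.add_apply, h2, h3, ← map_add, ← splitPrimitive_add (hi f) (hi g) ht]
    congr 1
    refine splitPrimitive_congr hab ?_ ht
    filter_upwards [Lp.coeFn_add f g] with s hs
    rw [hs, Pi.add_apply, map_add]
  · refine Lp.ext ?_
    filter_upwards [(hU.memLp_splitPrimitive (Λ := Λ) hab (hi (c • f))).coeFn_toLp,
      (hU.memLp_splitPrimitive (Λ := Λ) hab (hi f)).coeFn_toLp,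
      Lp.coeFn_smul c ((hU.memLp_splitPrimitive (Λ := Λ) hab (hi f)).toLp _),
      ae_restrict_mem measurableSet_Ioo] with t h1 h2 h4 ht
    rw [h1, RingHom.id_apply, h4, Pi.smul_apply, h2, ← map_smul, ← splitPrimitive_smul]
    congr 1
    refine splitPrimitive_congr hab ?_ ht
    filter_upwards [Lp.coeFn_smul c f] with s hs
    rw [hs, Pi.smul_apply, map_smul]
  · rw [mul_assoc]
    refine Lp.norm_le_of_ae_bound (by positivity) ?_
    filter_upwards [(hU.memLp_splitPrimitive (Λ := Λ) hab (hi f)).coeFn_toLp,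
      ae_restrict_mem measurableSet_Ioo] with t h1 ht
    refine (le_of_eq (congrArg norm h1)).trans ?_
    refine (hU.norm_apply_le _ _).trans ?_
    rw [mul_assoc, mul_assoc, mul_assoc]
    refine mul_le_mul_of_nonneg_left ?_ hM
    refine (norm_splitPrimitive_le (hi f) ht).trans
      (mul_le_mul_of_nonneg_left ?_ (by positivity))
    calc ∫ s in Ioo a b, ‖Z s (f s)‖ ≤ ∫ s in Ioo a b, M * ‖f s‖ :=
          integral_mono (hi f).norm (((Lp.memLp f).integrable (by norm_num)).norm.const_mul M)
            fun s => hU.symm.norm_apply_le s _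
      _ = M * ∫ s in Ioo a b, ‖f s‖ := integral_const_mul _ _
      _ ≤ _ := mul_le_mul_of_nonneg_left (hCf f) hM
  · exact (hU.memLp_splitPrimitive (Λ := Λ) hab (hi f)).coeFn_toLp

end Transition

end KreinEvolution

namespace KreinEvolution

open Filter Topology

/-! ### Integration by parts for sesquilinear forms -/

section Integration

open scoped InnerProductSpace

variable {W : Type*} [NormedAddCommGroup W] [InnerProductSpace ℂ W] {a b : ℝ} {h k : ℝ → W}

/-- A sesquilinear form as a real bilinear map. -/
theorem exists_real_bilinear (Q : W →L⋆[ℂ] W →L[ℂ] ℂ) :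
    ∃ B : W →L[ℝ] W →L[ℝ] ℂ, ∀ v w, B v w = Q v w :=
  ⟨LinearMap.mkContinuous₂ (LinearMap.mk₂ ℝ (fun v w => Q v w) (fun v v' w => by simp)
    (fun c v w => by
      rw [← Complex.coe_smul, map_smulₛₗ]
      simp) (fun v w w' => by simp)
    (fun c v w => by
      rw [← Complex.coe_smul, map_smul]
      simp)) ‖Q‖ fun v w => Q.le_opNorm₂ v w, fun _ _ => rfl⟩

theorem integrable_form {Q : W →L⋆[ℂ] W →L[ℂ] ℂ} {f g : ℝ → W} {μ : Measure ℝ}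
    (hf : MemLp f 2 μ) (hg : MemLp g 2 μ) : Integrable (fun t => Q (f t) (g t)) μ := by
  have h1 : AEStronglyMeasurable (fun t => Q (f t) (g t)) μ :=
    (continuous_form Q).comp_aestronglyMeasurable (hf.1.prodMk hg.1)
  have h2 : Integrable (fun t => ‖f t‖ * ‖g t‖) μ := hf.norm.integrable_mul hg.norm
  refine (h2.const_mul ‖Q‖).mono' h1 (Eventually.of_forall fun t => ?_)
  rw [← mul_assoc]
  exact Q.le_opNorm₂ _ _

variable [CompleteSpace W]

/-- Integration by parts for a bilinear map and the primitives of two integrable functions. -/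
theorem integral_bilinear_primitive (B : W →L[ℝ] W →L[ℝ] ℂ) (hab : a ≤ b)
    (hh : IntegrableOn h (Ioo a b)) (hk : IntegrableOn k (Ioo a b)) :
    (∫ t in Ioo a b, B (∫ s in a..t, h s) (k t)) + ∫ t in Ioo a b, B (h t) (∫ s in a..t, k s) =
      B (∫ s in a..b, h s) (∫ s in a..b, k s) := by
  set μ := volume.restrict (Ioo a b) with hμ
  -- By Fubini, the two terms on the left are the integrals of this function over the complementary
  -- triangles of the square, and the right-hand side is its integral over the square. No
  -- differentiability of the primitives is needed.
  have hF : Integrable (fun z : ℝ × ℝ => B (h z.1) (k z.2)) (μ.prod μ) :=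
    hh.op_fst_snd (by fun_prop) ⟨‖B‖, B.le_opNorm₂⟩ hk
  have hS : MeasurableSet {z : ℝ × ℝ | z.1 ≤ z.2} := measurableSet_le measurable_fst measurable_snd
  have h1 : ∫ t in Ioo a b, B (∫ s in a..t, h s) (k t) =
      ∫ z in {z : ℝ × ℝ | z.1 ≤ z.2}, B (h z.1) (k z.2) ∂μ.prod μ := by
    rw [← integral_indicator hS, integral_prod_symm _ (hF.indicator hS)]
    refine setIntegral_congr_fun measurableSet_Ioo fun t ht => ?_
    rw [intervalIntegral_eq_integral_indicator ht, ← ContinuousLinearMap.flip_apply,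
      ← ContinuousLinearMap.integral_comp_comm _ (hh.indicator measurableSet_Iic)]
    refine integral_congr_ae (Eventually.of_forall fun s => ?_)
    by_cases hst : s ≤ t <;> simp [indicator, hst]
  have h2 : ∫ t in Ioo a b, B (h t) (∫ s in a..t, k s) =
      ∫ z in {z : ℝ × ℝ | z.1 ≤ z.2}ᶜ, B (h z.1) (k z.2) ∂μ.prod μ := by
    rw [← integral_indicator hS.compl, integral_prod _ (hF.indicator hS.compl)]
    refine setIntegral_congr_fun measurableSet_Ioo fun t ht => ?_
    rw [intervalIntegral_eq_integral_indicator ht,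
      ← ContinuousLinearMap.integral_comp_comm _ (hk.indicator measurableSet_Iic)]
    refine integral_congr_ae ?_
    have h3 : ∀ᵐ s ∂μ, s ≠ t := ae_restrict_of_ae (by simp [ae_iff])
    filter_upwards [h3] with s hs
    rcases lt_or_gt_of_ne hs with hs | hs
    · simp [indicator, hs.le, hs]
    · simp [indicator, hs.le, hs.not_ge]
  rw [h1, h2, integral_add_compl hS hF, integral_prod_bilin B hh hk,
    intervalIntegral_eq_integral_Ioo hab, intervalIntegral_eq_integral_Ioo hab]

variable {Q : W →L⋆[ℂ] W →L[ℂ] ℂ} {Λ Λ' : W →L[ℂ] W}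

/-- With `H` and `K` the full integrals, integration by parts of the plain primitives leaves `Q H
K`. The constants subtracted in the two split primitives contribute `-Q ((1 - Λ) H) K - Q H ((1 -
Λ') K)`, which is `-Q H K` by the relation between `Λ` and `Λ'`. -/
theorem integral_form_splitPrimitive (hab : a ≤ b) (hΛ : ∀ v w, Q (Λ v) w = Q v (w - Λ' w))
    (hh : MemLp h 2 (volume.restrict (Ioo a b))) (hk : MemLp k 2 (volume.restrict (Ioo a b))) :
    ∫ t in Ioo a b, Q (splitPrimitive Λ a b h t) (k t) =
      -∫ t in Ioo a b, Q (h t) (splitPrimitive Λ' a b k t) := by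
  have hh' : IntegrableOn h (Ioo a b) := hh.integrable (by norm_num)
  have hk' : IntegrableOn k (Ioo a b) := hk.integrable (by norm_num)
  have hprim : ∀ {x : ℝ → W}, IntegrableOn x (Ioo a b) →
      MemLp (fun t => ∫ s in a..t, x s) 2 (volume.restrict (Ioo a b)) := fun hx =>
    memLp_two_of_continuousOn (continuousOn_primitive_of_Ioo hab hx)
  obtain ⟨B, hB⟩ := exists_real_bilinear Q
  have h1 := integral_bilinear_primitive B hab hh' hk'
  simp only [hB] at h1
  have h2 : ∀ c, ∫ t in Ioo a b, Q (h t) c = Q (∫ s in a..b, h s) c := fun c => by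
    rw [intervalIntegral_eq_integral_Ioo hab, ← hB, ← ContinuousLinearMap.flip_apply,
      ← ContinuousLinearMap.integral_comp_comm _ hh']
    simp [hB]
  have h3 : ∀ c, ∫ t in Ioo a b, Q c (k t) = Q c (∫ s in a..b, k s) := fun c => by
    rw [intervalIntegral_eq_integral_Ioo hab, ← ContinuousLinearMap.integral_comp_comm _ hk']
  have h4 : ∀ c, ∫ t in Ioo a b, Q ((∫ s in a..t, h s) - c) (k t) =
      (∫ t in Ioo a b, Q (∫ s in a..t, h s) (k t)) - Q c (∫ s in a..b, k s) := fun c => by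
    simp only [map_sub, sub_apply]
    rw [integral_sub (integrable_form (hprim hh') hk) (integrable_form (memLp_const _) hk), h3]
  have h5 : ∀ c, ∫ t in Ioo a b, Q (h t) ((∫ s in a..t, k s) - c) =
      (∫ t in Ioo a b, Q (h t) (∫ s in a..t, k s)) - Q (∫ s in a..b, h s) c := fun c => by
    simp only [map_sub]
    rw [integral_sub (integrable_form hh (hprim hk')) (integrable_form hh (memLp_const _)), h2]
  simp only [splitPrimitive]
  rw [h4, h5]
  simp only [map_sub, sub_apply, hΛ]
  linear_combination h1

/-- The form of `L²` is represented by an invertible bounded operator. -/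
theorem exists_qL2_eq_inner (hQ : IsKrein Q) (a b : ℝ) : ∃ T S : L2 W a b →L[ℂ] L2 W a b,
    (∀ f, S (T f) = f) ∧ (∀ f, T (S f) = f) ∧ ∀ f g, qL2 Q a b f g = ⟪T f, g⟫_ℂ := by
  obtain ⟨Γ, hΓ⟩ := hQ.exists_equiv
  refine ⟨(Γ : W →L[ℂ] W).compLpL 2 _, (Γ.symm : W →L[ℂ] W).compLpL 2 _, fun f => Lp.ext ?_,
    fun f => Lp.ext ?_, fun f g => ?_⟩
  · filter_upwards [(Γ.symm : W →L[ℂ] W).coeFn_compLpL ((Γ : W →L[ℂ] W).compLpL 2 _ f),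
      (Γ : W →L[ℂ] W).coeFn_compLpL f] with t h1 h2
    rw [h1, h2]
    simp
  · filter_upwards [(Γ : W →L[ℂ] W).coeFn_compLpL ((Γ.symm : W →L[ℂ] W).compLpL 2 _ f),
      (Γ.symm : W →L[ℂ] W).coeFn_compLpL f] with t h1 h2
    rw [h1, h2]
    simp
  · rw [MeasureTheory.L2.inner_def, qL2]
    refine integral_congr_ae ?_
    filter_upwards [(Γ : W →L[ℂ] W).coeFn_compLpL f] with t h1
    rw [h1, hΓ]
    rfl

end Integration

end KreinEvolution

namespace KreinEvolution

open Filter Topology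

/-! ### Inverses of bounded operators as unbounded operators, and duality -/

section Inverse

variable {W V : Type*} [NormedAddCommGroup W] [InnerProductSpace ℂ W]
  [NormedAddCommGroup V] [InnerProductSpace ℂ V] {J : V →L[ℂ] W}
  {U Z : ℝ → W →L[ℂ] W} {M a b : ℝ} {h : ℝ → W} {Λ Λ' : W →L[ℂ] W}

theorem IsTransition.memLp_apply (hU : IsTransition U Z M) {μ : Measure ℝ} {x : ℝ → W}
    (hx : MemLp x 2 μ) : MemLp (fun t => U t (x t)) 2 μ :=
  hx.of_le_mul (hU.aestronglyMeasurable_apply hx.1)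
    (Eventually.of_forall fun t => hU.norm_apply_le t _)

theorem pmapApply_eq {B : W →ₗ.[ℂ] W} {x y : W} (h : (x, y) ∈ B.graph) : pmapApply B x = y := by
  obtain ⟨z, rfl, rfl⟩ := B.mem_graph_iff.1 h
  exact dif_pos z.2

/-- Injectivity of `E` makes the flipped graph single-valued, hence the graph of
`LinearPMap.inverse`. -/
theorem mem_graph_inverseOp {E : L2 W a b →L[ℂ] L2 W a b}
    (hE : LinearMap.ker (E : L2 W a b →ₗ[ℂ] L2 W a b) = ⊥) {x y : L2 W a b} :
    (x, y) ∈ (inverseOp E).graph ↔ E y = x := by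
  have h1 : LinearMap.ker ((E : L2 W a b →ₗ[ℂ] L2 W a b).toPMap ⊤).toFun = ⊥ :=
    LinearMap.ker_eq_bot'.2 fun z hz => Subtype.ext (LinearMap.ker_eq_bot'.1 hE z hz)
  rw [inverseOp, LinearPMap.inverse_graph h1]
  constructor
  · rintro ⟨⟨p, q⟩, hp, hpq⟩
    obtain ⟨z, hz, hz'⟩ := (LinearPMap.mem_graph_iff _).1 hp
    simp only [LinearEquiv.coe_coe, LinearEquiv.prodComm_apply, Prod.swap_prod_mk,
      Prod.mk.injEq] at hpq
    rw [← hpq.1, ← hpq.2]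
    exact (congrArg E hz).symm.trans hz'
  · rintro rfl
    exact ⟨(y, E y), (LinearPMap.mem_graph_iff _).2 ⟨⟨y, trivial⟩, rfl, rfl⟩, rfl⟩

theorem domain_inverseOp {E : L2 W a b →L[ℂ] L2 W a b}
    (hE : LinearMap.ker (E : L2 W a b →ₗ[ℂ] L2 W a b) = ⊥) :
    ((inverseOp E).domain : Set (L2 W a b)) = range E := by
  ext x
  rw [SetLike.mem_coe, LinearPMap.mem_domain_iff]
  simp only [mem_graph_inverseOp hE]
  rfl

theorem zero_mem_resolventSet_inverseOp {E : L2 W a b →L[ℂ] L2 W a b}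
    (hE : LinearMap.ker (E : L2 W a b →ₗ[ℂ] L2 W a b) = ⊥) :
    0 ∈ pmapResolventSet (inverseOp E) := by
  have hinv : ∀ v : (inverseOp E).domain, E (inverseOp E v) = v := fun v =>
    (mem_graph_inverseOp hE).1 ((inverseOp E).mem_graph v)
  refine ⟨E, fun f => ?_, fun v => by rw [zero_smul, sub_zero, hinv]⟩
  have h1 : E f ∈ (inverseOp E).domain := by
    rw [← SetLike.mem_coe, domain_inverseOp hE]
    exact mem_range_self f
  refine ⟨h1, ?_⟩
  rw [zero_smul, sub_zero]
  have h2 := hinv ⟨E f, h1⟩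
  exact LinearMap.ker_eq_bot.1 hE h2

theorem isWellPosedRealization_inverseOp {B : ℝ → W →ₗ.[ℂ] W} {E : L2 W a b →L[ℂ] L2 W a b}
    (hE : LinearMap.ker (E : L2 W a b →ₗ[ℂ] L2 W a b) = ⊥) (hd : DenseRange E)
    (hext : ∀ v, IsTestFunction J a b v → ∃ f g : L2 W a b,
      f =ᵐ[volume.restrict (Ioo a b)] (fun t => J (v t)) ∧
      g =ᵐ[volume.restrict (Ioo a b)] evolutionOp J B v ∧ E g = f) :
    IsWellPosedRealization J B (inverseOp E) where
  dense_domain := by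
    rw [domain_inverseOp hE]
    exact hd
  isClosed := by
    have : ((inverseOp E).graph : Set (L2 W a b × L2 W a b)) = {p | E p.2 = p.1} := by
      ext ⟨x, y⟩
      exact mem_graph_inverseOp hE
    rw [LinearPMap.IsClosed, this]
    exact isClosed_eq (E.continuous.comp continuous_snd) continuous_fst
  resolventSet_nonempty := ⟨0, zero_mem_resolventSet_inverseOp hE⟩
  extends_evolutionOp := fun v hv => by
    obtain ⟨f, g, hf, hg, hfg⟩ := hext v hv
    exact ⟨f, g, hf, hg, (mem_graph_inverseOp hE).2 hfg⟩

variable [CompleteSpace W]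

/-- A primitive of the form `splitPrimitive` vanishes almost everywhere only for the zero
function. -/
theorem ae_eq_zero_of_splitPrimitive (hh : IntegrableOn h (Ioo a b)) (hab : a ≤ b)
    (h0 : ∀ᵐ t ∂volume.restrict (Ioo a b), splitPrimitive Λ a b h t = 0) :
    h =ᵐ[volume.restrict (Ioo a b)] 0 := by
  -- Continuity upgrades almost everywhere to everywhere. The derivative of the primitive then
  -- vanishes, while it equals `h` almost everywhere by Lebesgue's differentiation theorem.
  have h1 : EqOn (splitPrimitive Λ a b h) 0 (Ioo a b) :=
    Measure.eqOn_open_of_ae_eq h0 isOpen_Ioo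
      ((continuousOn_splitPrimitive hab hh).mono Ioo_subset_Icc_self) continuousOn_const
  have h2 := ((intervalIntegrable_iff_integrableOn_Ioo_of_le (μ := volume) hab (by simp)
    (by simp)).2 hh).ae_hasDerivAt_integral
  filter_upwards [ae_restrict_of_ae h2, ae_restrict_mem measurableSet_Ioo] with t ht ht'
  have h3 := (ht (by rw [uIcc_of_le hab]; exact Ioo_subset_Icc_self ht') a left_mem_uIcc).sub_const
    ((∫ s in a..b, h s) - Λ (∫ s in a..b, h s))
  have h4 : HasDerivAt (splitPrimitive Λ a b h) 0 t :=
    (hasDerivAt_const t (0 : W)).congr_of_eventuallyEq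
      (h1.eventuallyEq_of_mem (isOpen_Ioo.mem_nhds ht'))
  exact h3.unique h4

theorem ker_eq_bot_of_splitPrimitive (hU : IsTransition U Z M) (hab : a ≤ b)
    {E : L2 W a b →L[ℂ] L2 W a b} (hE : ∀ f : L2 W a b, E f =ᵐ[volume.restrict (Ioo a b)]
      fun t => U t (splitPrimitive Λ a b (fun s => Z s (f s)) t)) :
    LinearMap.ker (E : L2 W a b →ₗ[ℂ] L2 W a b) = ⊥ := by
  refine LinearMap.ker_eq_bot'.2 fun f hf => (Lp.eq_zero_iff_ae_eq_zero).2 ?_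
  have h0 : E f = 0 := hf
  have h1 := ae_eq_zero_of_splitPrimitive (Λ := Λ) (hU.symm.integrable_apply
    ((Lp.memLp f).integrable (by norm_num))) hab (by
      filter_upwards [hE f, (Lp.eq_zero_iff_ae_eq_zero).1 h0] with t h1 h2
      rw [h2] at h1
      have := hU.left_inv t (splitPrimitive Λ a b (fun s => Z s (f s)) t)
      rwa [← h1, Pi.zero_apply, map_zero, eq_comm] at this)
  filter_upwards [h1] with t ht
  rw [← hU.right_inv t (f t), ht, Pi.zero_apply, map_zero]

/-- As `U t` preserves `Q`, both sides can be written in the interaction picture, where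
`integral_form_splitPrimitive` applies. -/
theorem qL2_clm_eq_neg (hU : IsTransition U Z M) (hab : a ≤ b) {Q : W →L⋆[ℂ] W →L[ℂ] ℂ}
    (hQ : ∀ t ∈ Ioo a b, ∀ v w, Q (U t v) (U t w) = Q v w)
    (hΛ : ∀ v w, Q (Λ v) w = Q v (w - Λ' w)) {E E' : L2 W a b →L[ℂ] L2 W a b}
    (hE : ∀ f : L2 W a b, E f =ᵐ[volume.restrict (Ioo a b)]
      fun t => U t (splitPrimitive Λ a b (fun s => Z s (f s)) t))
    (hE' : ∀ f : L2 W a b, E' f =ᵐ[volume.restrict (Ioo a b)]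
      fun t => U t (splitPrimitive Λ' a b (fun s => Z s (f s)) t)) (f g : L2 W a b) :
    qL2 Q a b (E f) g = -qL2 Q a b f (E' g) := by
  have h1 := integral_form_splitPrimitive hab hΛ (hU.symm.memLp_apply (Lp.memLp f))
    (hU.symm.memLp_apply (Lp.memLp g))
  have h2 : qL2 Q a b (E f) g =
      ∫ t in Ioo a b, Q (splitPrimitive Λ a b (fun s => Z s (f s)) t) (Z t (g t)) := by
    refine integral_congr_ae ?_
    filter_upwards [hE f, ae_restrict_mem measurableSet_Ioo] with t ht ht'
    rw [ht, ← hQ t ht' _ (Z t (g t)), hU.right_inv]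
  have h3 : qL2 Q a b f (E' g) =
      ∫ t in Ioo a b, Q (Z t (f t)) (splitPrimitive Λ' a b (fun s => Z s (g s)) t) := by
    refine integral_congr_ae ?_
    filter_upwards [hE' g, ae_restrict_mem measurableSet_Ioo] with t ht ht'
    rw [ht, ← hQ t ht' (Z t (f t)), hU.right_inv]
  rw [h2, h3, h1]

theorem eq_zero_of_qL2 {Q : W →L⋆[ℂ] W →L[ℂ] ℂ} (hQ : IsKrein Q) {f : L2 W a b}
    (hf : ∀ g, qL2 Q a b f g = 0) : f = 0 := by
  obtain ⟨T, S, hST, -, hT⟩ := exists_qL2_eq_inner hQ a b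
  have : T f = 0 := ext_inner_right ℂ fun g => by rw [← hT, hf, inner_zero_left]
  rw [← hST f, this, map_zero]

/-- The `Q`-orthogonal complement of the range of `E` is the kernel of its `Q`-adjoint `-E'`; the
isomorphism `T` translates between `Q` and the Hilbert scalar product. -/
theorem denseRange_of_qL2_eq_neg {Q : W →L⋆[ℂ] W →L[ℂ] ℂ} (hQ : IsKrein Q)
    {E E' : L2 W a b →L[ℂ] L2 W a b} (h : ∀ f g, qL2 Q a b (E' f) g = -qL2 Q a b f (E g))
    (hE' : LinearMap.ker (E' : L2 W a b →ₗ[ℂ] L2 W a b) = ⊥) : DenseRange E := by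
  obtain ⟨T, S, -, hTS, hT⟩ := exists_qL2_eq_inner hQ a b
  have h1 : (LinearMap.range (E : L2 W a b →ₗ[ℂ] L2 W a b))ᗮ = ⊥ := by
    refine (Submodule.eq_bot_iff _).2 fun x hx => ?_
    have h2 : E' (S x) = 0 := eq_zero_of_qL2 hQ fun g => by
      rw [h, hT, hTS, neg_eq_zero]
      exact (Submodule.mem_orthogonal' _ _).1 hx _ ⟨g, rfl⟩
    have h3 : S x = 0 := LinearMap.ker_eq_bot'.1 hE' _ h2
    rw [← hTS x, h3, map_zero]
  have h2 := (Submodule.topologicalClosure_eq_top_iff).2 h1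
  have h3 := (Submodule.dense_iff_topologicalClosure_eq_top).2 h2
  exact h3

/-- Every element of the domain of the inverse has the form `E g`, so the adjoint relation for the
pair `v`, `u` becomes `(E' u | Q g) = -(v | Q g)` for all `g`. Non-degeneracy turns it into `E' u =
-v`. -/
theorem isFormAdjoint_inverseOp {Q : W →L⋆[ℂ] W →L[ℂ] ℂ} (hQ : IsKrein Q)
    {E E' : L2 W a b →L[ℂ] L2 W a b} (h : ∀ f g, qL2 Q a b (E' f) g = -qL2 Q a b f (E g))
    (hE : LinearMap.ker (E : L2 W a b →ₗ[ℂ] L2 W a b) = ⊥)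
    (hE' : LinearMap.ker (E' : L2 W a b →ₗ[ℂ] L2 W a b) = ⊥) :
    IsFormAdjoint (qL2 Q a b) (inverseOp E) (-inverseOp E') := by
  obtain ⟨T, S, -, hTS, hT⟩ := exists_qL2_eq_inner hQ a b
  refine isFormAdjoint_iff.2 fun v u => ?_
  have h1 : (v, u) ∈ (-inverseOp E').graph ↔ E' u = -v := by
    rw [LinearPMap.neg_graph, Submodule.mem_map]
    constructor
    · rintro ⟨⟨x, y⟩, hxy, h2⟩
      have h3 := (mem_graph_inverseOp hE').1 hxy
      simp only [LinearMap.prodMap_apply, LinearMap.id_apply, LinearMap.neg_apply,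
        Prod.mk.injEq] at h2
      rw [← h2.1, ← h2.2, map_neg, h3]
    · intro h2
      refine ⟨(v, -u), (mem_graph_inverseOp hE').2 (by rw [map_neg, h2, neg_neg]), ?_⟩
      simp
  rw [h1]
  constructor
  · rintro h2 w w' hw
    rw [← (mem_graph_inverseOp hE).1 hw, ← neg_eq_iff_eq_neg.2 (h u w'), h2]
    simp only [hT, map_neg, inner_neg_left, neg_neg]
  · intro h2
    refine eq_neg_of_add_eq_zero_left (eq_zero_of_qL2 hQ fun g => ?_)
    have h3 := h2 (E g) g ((mem_graph_inverseOp hE).2 rfl)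
    have h4 := h u g
    simp only [hT, map_add, inner_add_left] at h3 h4 ⊢
    rw [h4, h3, neg_add_cancel]

end Inverse

end KreinEvolution

namespace KreinEvolution

open Filter Topology

/-! ### The left inverse property on test functions -/

section Inverse

variable {W V : Type*} [NormedAddCommGroup W] [InnerProductSpace ℂ W]
  [NormedAddCommGroup V] [InnerProductSpace ℂ V] {J : V →L[ℂ] W}
  {R : ℝ → ℝ → W →L[ℂ] W} {B : ℝ → W →ₗ.[ℂ] W} {A : ℝ → V →L[ℂ] W}
  {U Z : ℝ → W →L[ℂ] W} {M a b : ℝ} {Λ : W →L[ℂ] W} {Zout Zin : Submodule ℂ W} {v : ℝ → V}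

theorem IsTestFunction.evolutionOp_eq (hA : ∀ t ∈ Icc a b, ∀ x, (J x, A t x) ∈ (B t).graph)
    {t : ℝ} (ht : t ∈ Icc a b) : evolutionOp J B v t =
      deriv (fun r => J (v r)) t + Complex.I • A t (v t) := by
  rw [evolutionOp, pmapApply_eq (hA t ht (v t))]

theorem IsTestFunction.continuousOn_evolutionOp (hv : IsTestFunction J a b v)
    (hAc : ContinuousOn A (Icc a b)) (hA : ∀ t ∈ Icc a b, ∀ x, (J x, A t x) ∈ (B t).graph) :
    ContinuousOn (evolutionOp J B v) (Icc a b) := by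
  have h1 : ContinuousOn (fun t => deriv (fun r => J (v r)) t + Complex.I • A t (v t)) (Icc a b) :=
    ((hv.2.continuous_deriv le_rfl).continuousOn).add
      ((hAc.clm_apply hv.1.continuous.continuousOn).const_smul _)
  exact h1.congr fun t ht => IsTestFunction.evolutionOp_eq hA ht

theorem IsCc.eq_zero_left {w : ℝ → V} (hw : IsCc a b w) : w a = 0 :=
  image_eq_zero_of_notMem_tsupport fun h => lt_irrefl _ (hw.tsupport_subset h).1

theorem IsCc.eq_zero_right {w : ℝ → V} (hw : IsCc a b w) : w b = 0 :=
  image_eq_zero_of_notMem_tsupport fun h => lt_irrefl _ (hw.tsupport_subset h).2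

variable [CompleteSpace W]

/-- The product rule joins the backward equation of `R(a, s)` to the `W`-derivative of `J v`;
together they form `∂ₜ + iB`. -/
theorem IsEvolutionGeneratedBy.hasDerivWithinAt_testFunction
    (hR : IsEvolutionGeneratedBy J a b B R)
    (hA : ∀ t ∈ Icc a b, ∀ x, (J x, A t x) ∈ (B t).graph) (hv : IsTestFunction J a b v)
    {t : ℝ} (ht : t ∈ Icc a b) : HasDerivWithinAt (fun s => R a s (J (v s)))
      (R a t (evolutionOp J B v t)) (Icc a b) t := by
  have hab := ht.1.trans ht.2
  have ha := left_mem_Icc.2 hab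
  have hc : ∀ w, ContinuousOn (fun s => R a s w) (Icc a b) := fun w =>
    (hR.continuousOn w).comp (by fun_prop : Continuous fun r : ℝ => (a, r)).continuousOn
      fun r hr => ⟨ha, hr⟩
  obtain ⟨C, -, hC⟩ := exists_norm_le_of_continuousOn isCompact_Icc hc
  have h1 := hasDerivWithinAt_clm_apply (eventually_nhdsWithin_of_forall hC)
    (hR.hasDerivWithinAt a ha t ht (v t) _ (hA t ht _)) (hc _ t ht)
    ((hv.2.differentiable one_ne_zero t).hasDerivAt.hasDerivWithinAt)
  refine h1.congr_deriv ?_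
  rw [IsTestFunction.evolutionOp_eq hA ht, map_add, map_smul, add_comm]

/-- The integrand is the derivative of `Z s (J (v s))`. As `v` vanishes at `a` and `b`, the full
integral is zero and the correction drops out, whatever `Λ` is. -/
theorem IsEvolutionGeneratedBy.splitPrimitive_evolutionOp
    (hR : IsEvolutionGeneratedBy J a b B R)
    (hU : IsTransition U Z M) (hUR : ∀ t ∈ Icc a b, U t = R t a ∧ Z t = R a t)
    (hAc : ContinuousOn A (Icc a b)) (hA : ∀ t ∈ Icc a b, ∀ x, (J x, A t x) ∈ (B t).graph)
    (hv : IsTestFunction J a b v) {t : ℝ} (ht : t ∈ Icc a b) :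
    U t (splitPrimitive Λ a b (fun s => Z s (evolutionOp J B v s)) t) = J (v t) := by
  have hab := ht.1.trans ht.2
  have hg := hU.symm.continuousOn_apply (hv.continuousOn_evolutionOp hAc hA)
  have h1 : ∀ r ∈ Icc a b, ∫ s in a..r, Z s (evolutionOp J B v s) = Z r (J (v r)) :=
    fun r hr => by
    have hsub : Icc a r ⊆ Icc a b := Icc_subset_Icc_right hr.2
    have hc : ContinuousOn (fun s => Z s (J (v s))) (Icc a r) :=
      hU.symm.continuousOn_apply (J.continuous.comp hv.1.continuous).continuousOn
    rw [intervalIntegral.integral_eq_sub_of_hasDerivAt_of_le hr.1 hc (fun s hs => ?_)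
      ((hg.mono (by rwa [uIcc_of_le hr.1])).intervalIntegrable), hv.1.eq_zero_left, map_zero,
      map_zero, sub_zero]
    have hs' : s ∈ Icc a b := hsub (Ioo_subset_Icc_self hs)
    have h2 := hR.hasDerivWithinAt_testFunction hA hv hs'
    rw [← (hUR s hs').2] at h2
    refine (h2.congr (fun x hx => ?_) ?_).hasDerivAt (Icc_mem_nhds hs.1 (hs.2.trans_le hr.2))
    · rw [(hUR x hx).2]
    · rw [(hUR s hs').2]
  rw [splitPrimitive, h1 t ht, h1 b (right_mem_Icc.2 hab), hv.1.eq_zero_right]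
  simp [hU.right_inv]

section Kernel

variable (hU : IsTransition U Z M)
  (hK : ∀ t ∈ Ioo a b, ∀ s ∈ Ioo a b, ∀ w, inverseKernel R a b Zout Zin t s w =
    U t (heaviside (t - s) • Λ (Z s w) - heaviside (s - t) • (Z s w - Λ (Z s w))))

include hU hK

theorem kernelOp_eq_splitPrimitive {w : ℝ → W} (hw : IntegrableOn w (Ioo a b)) {t : ℝ}
    (ht : t ∈ Ioo a b) :
    IntegrableOn (fun s => inverseKernel R a b Zout Zin t s (w s)) (Ioo a b) ∧
      kernelOp a b (inverseKernel R a b Zout Zin) w t =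
        U t (splitPrimitive Λ a b (fun s => Z s (w s)) t) := by
  have h1 := integral_splitKernel (Λ := Λ) (hU.symm.integrable_apply hw) ht (U t)
  have h2 : EqOn (fun s => inverseKernel R a b Zout Zin t s (w s))
      (fun s => U t (heaviside (t - s) • Λ (Z s (w s)) - heaviside (s - t) • (Z s (w s) - Λ (Z s (w s))))) (Ioo a b) :=
    fun s hs => hK t ht s hs (w s)
  exact ⟨h1.1.congr_fun h2.symm measurableSet_Ioo,
    (setIntegral_congr_fun measurableSet_Ioo h2).trans h1.2⟩

theorem mapsCcToC_inverseKernel (hab : a ≤ b) :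
    MapsCcToC a b (inverseKernel R a b Zout Zin) := fun w hw => by
  have hi : IntegrableOn w (Ioo a b) :=
    (hw.continuous.integrableOn_Icc).mono_set Ioo_subset_Icc_self
  refine ⟨fun t ht => (kernelOp_eq_splitPrimitive hU hK hi ht).1, ?_⟩
  have h1 := hU.continuousOn_apply (continuousOn_splitPrimitive (Λ := Λ) hab
    (hU.symm.integrable_apply hi))
  exact (h1.mono Ioo_subset_Icc_self).congr
    fun t ht => (kernelOp_eq_splitPrimitive hU hK hi ht).2

theorem hasKernel_inverseKernel {E : L2 W a b →L[ℂ] L2 W a b}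
    (hE : ∀ f : L2 W a b, E f =ᵐ[volume.restrict (Ioo a b)]
      fun t => U t (splitPrimitive Λ a b (fun s => Z s (f s)) t)) :
    HasKernel a b (inverseKernel R a b Zout Zin) E := fun f => by
  have hi : IntegrableOn f (Ioo a b) := (Lp.memLp f).integrable (by norm_num)
  refine ⟨fun t ht => (kernelOp_eq_splitPrimitive hU hK hi ht).1, ?_⟩
  filter_upwards [hE f, ae_restrict_mem measurableSet_Ioo] with t h1 ht
  rw [h1, (kernelOp_eq_splitPrimitive hU hK hi ht).2]

theorem isLeftInverseKernel_inverseKernel (hR : IsEvolutionGeneratedBy J a b B R)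
    (hUR : ∀ t ∈ Icc a b, U t = R t a ∧ Z t = R a t)
    (hAc : ContinuousOn A (Icc a b)) (hA : ∀ t ∈ Icc a b, ∀ x, (J x, A t x) ∈ (B t).graph) :
    IsLeftInverseKernel J a b B (inverseKernel R a b Zout Zin) := fun v hv t ht => by
  have hi : IntegrableOn (evolutionOp J B v) (Ioo a b) :=
    (memLp_two_of_continuousOn (hv.continuousOn_evolutionOp hAc hA)).integrable (by norm_num)
  rw [(kernelOp_eq_splitPrimitive hU hK hi ht).2,
    hR.splitPrimitive_evolutionOp hU hUR hAc hA hv (Ioo_subset_Icc_self ht)]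

end Kernel

theorem IsEvolutionGeneratedBy.exists_L2_of_testFunction (hR : IsEvolutionGeneratedBy J a b B R)
    (hU : IsTransition U Z M) (hab : a ≤ b)
    (hUR : ∀ t ∈ Icc a b, U t = R t a ∧ Z t = R a t)
    (hAc : ContinuousOn A (Icc a b)) (hA : ∀ t ∈ Icc a b, ∀ x, (J x, A t x) ∈ (B t).graph)
    {E : L2 W a b →L[ℂ] L2 W a b} (hE : ∀ f : L2 W a b, E f =ᵐ[volume.restrict (Ioo a b)]
      fun t => U t (splitPrimitive Λ a b (fun s => Z s (f s)) t)) (hv : IsTestFunction J a b v) :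
    ∃ f g : L2 W a b, f =ᵐ[volume.restrict (Ioo a b)] (fun t => J (v t)) ∧
      g =ᵐ[volume.restrict (Ioo a b)] evolutionOp J B v ∧ E g = f := by
  have h1 := memLp_two_of_continuousOn (hv.continuousOn_evolutionOp hAc hA)
  have h2 : MemLp (fun t => J (v t)) 2 (volume.restrict (Ioo a b)) :=
    memLp_two_of_continuousOn (J.continuous.comp hv.1.continuous).continuousOn
  refine ⟨h2.toLp _, h1.toLp _, h2.coeFn_toLp, h1.coeFn_toLp, Lp.ext ?_⟩
  filter_upwards [hE (h1.toLp _), h2.coeFn_toLp, ae_restrict_mem measurableSet_Ioo]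
    with t h3 h4 ht
  rw [h3, h4, ← hR.splitPrimitive_evolutionOp (Λ := Λ) hU hUR hAc hA hv (Ioo_subset_Icc_self ht)]
  congr 1
  refine splitPrimitive_congr hab ?_ ht
  filter_upwards [h1.coeFn_toLp] with s hs
  rw [hs]

end Inverse

/-! ### The `Q`-adjoint relation between the two projections -/

section QAdjoint

variable {W : Type*} [NormedAddCommGroup W] [InnerProductSpace ℂ W]

/-- The projections of a pair of subspaces and of the pair of their orthogonal complements are
related by `Λ^{*Q} = 1 - Λ'`. -/
theorem form_projection_eq {Q : W →L⋆[ℂ] W →L[ℂ] ℂ} (hQ : IsHermitianForm Q)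
    {X Y : Submodule ℂ W} {Λ Λ' : W →L[ℂ] W} (hX : ∀ w, Λ w ∈ X) (hY : ∀ w, w - Λ w ∈ Y)
    (hX' : ∀ w, Λ' w ∈ qOrthogonal Q X) (hY' : ∀ w, w - Λ' w ∈ qOrthogonal Q Y) (v w : W) :
    Q (Λ v) w = Q v (w - Λ' w) := by
  have h1 : Q (Λ v) (Λ' w) = 0 := by
    rw [← hQ, hX' w _ (hX v), map_zero]
  have h2 : Q (v - Λ v) (w - Λ' w) = 0 := by
    rw [← hQ, hY' w _ (hY v), map_zero]
  rw [map_sub Q, sub_apply] at h2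
  rw [sub_eq_zero.1 h2, map_sub, h1, sub_zero]

end QAdjoint

end KreinEvolution

end

/-! ### The theorem -/

theorem mainTheorem4 {W V : Type*}
    [NormedAddCommGroup W] [InnerProductSpace ℂ W] [CompleteSpace W]
    [NormedAddCommGroup V] [InnerProductSpace ℂ V] [CompleteSpace V]
    (J : V →L[ℂ] W) (hJ : Function.Injective J) (hJd : DenseRange J)
    (a b : ℝ) (hab : a < b)
    (Q : W →L⋆[ℂ] W →L[ℂ] ℂ) (hQ : IsKrein Q)
    (B₀ : ℝ → W →ₗ.[ℂ] W) (hB₀ : KatoHypotheses J a b B₀)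
    (P : ℝ → W →L[ℂ] W) (hP : ContinuousOn P (Set.Icc a b))
    (hB : ∀ t ∈ Set.Icc a b, IsPseudoUnitaryGenerator Q (perturbed B₀ P t)) :
    -- the family `B₀ + P` generates exactly one evolution
    (∃ R, IsEvolutionGeneratedBy J a b (perturbed B₀ P) R) ∧
    (∀ R R', IsEvolutionGeneratedBy J a b (perturbed B₀ P) R →
      IsEvolutionGeneratedBy J a b (perturbed B₀ P) R' →
      ∀ t ∈ Set.Icc a b, ∀ s ∈ Set.Icc a b, R t s = R' t s) ∧
    ∀ R, IsEvolutionGeneratedBy J a b (perturbed B₀ P) R →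
      -- it is pseudo-unitary
      (∀ t ∈ Set.Icc a b, ∀ s ∈ Set.Icc a b, ∀ v w, Q (R t s v) (R t s w) = Q v w) ∧
      ∀ Zout Zin : Submodule ℂ W, IsClosed (Zout : Set W) → IsClosed (Zin : Set W) →
        AsymptoticComplementarity R a b Zout Zin →
        AsymptoticComplementarity R a b (qOrthogonal Q Zout) (qOrthogonal Q Zin) ∧
        -- the operators from `C_c` to `C` and the left inverse property
        MapsCcToC a b (inverseKernel R a b Zout Zin) ∧
        MapsCcToC a b (inverseKernel R a b (qOrthogonal Q Zout) (qOrthogonal Q Zin)) ∧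
        IsLeftInverseKernel J a b (perturbed B₀ P) (inverseKernel R a b Zout Zin) ∧
        IsLeftInverseKernel J a b (perturbed B₀ P)
          (inverseKernel R a b (qOrthogonal Q Zout) (qOrthogonal Q Zin)) ∧
        -- the bounded operators on `L²` and their inverses
        ∃ E E' : L2 W a b →L[ℂ] L2 W a b,
          HasKernel a b (inverseKernel R a b Zout Zin) E ∧
          HasKernel a b (inverseKernel R a b (qOrthogonal Q Zout) (qOrthogonal Q Zin)) E' ∧
          DenseRange E ∧ DenseRange E' ∧
          LinearMap.ker (E : L2 W a b →ₗ[ℂ] L2 W a b) = ⊥ ∧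
          LinearMap.ker (E' : L2 W a b →ₗ[ℂ] L2 W a b) = ⊥ ∧
          IsWellPosedRealization J (perturbed B₀ P) (inverseOp E) ∧
          IsWellPosedRealization J (perturbed B₀ P) (inverseOp E') ∧
          0 ∈ pmapResolventSet (inverseOp E) ∧ 0 ∈ pmapResolventSet (inverseOp E') ∧
          IsFormAdjoint (qL2 Q a b) (inverseOp E) (-inverseOp E') := by
  obtain ⟨hex, huniq, hpu⟩ := hB₀.evolution hJ hJd hab hQ.1 hP hB
  refine ⟨hex, huniq, fun R hR => ⟨hpu R hR, fun Zout Zin hZout hZin hc => ?_⟩⟩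
  have hRe := hR.toIsEvolution
  have ha := left_mem_Icc.2 hab.le
  have hb := right_mem_Icc.2 hab.le
  have hc' := hRe.asymptoticComplementarity_qOrthogonal hab.le hQ (hpu R hR) hc hZout hZin
  obtain ⟨U, Z, M, hU, hUR⟩ := hRe.exists_isTransition hab.le
  obtain ⟨BV, hBV, hBVg⟩ := hB₀.1
  -- On `V`, the perturbed generators form one norm-continuous family in `B(V, W)`; this makes `(∂ₜ
  -- + iB) v` continuous for test functions.
  have hAc : ContinuousOn (fun t => BV t + P t ∘L J) (Icc a b) :=
    hBV.add (hP.clm_comp continuousOn_const)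
  have hA : ∀ t ∈ Icc a b, ∀ x, (J x, (BV t + P t ∘L J) x) ∈ (perturbed B₀ P t).graph :=
    fun t ht x => mem_graph_perturbed.2 (by simpa using hBVg t ht x)
  obtain ⟨Λ, hX, hY, hK⟩ := hRe.exists_projection hab.le hc hZout hZin
  obtain ⟨Λ', hX', hY', hK'⟩ := hRe.exists_projection hab.le hc' (isClosed_qOrthogonal Q Zout)
    (isClosed_qOrthogonal Q Zin)
  -- Pseudo-unitarity identifies the transported complement with the complement of the transported
  -- subspace, so `Λ` and `Λ'` are related by `form_projection_eq`.
  rw [hRe.transport_qOrthogonal ha hb (hpu R hR a ha b hb)] at hX'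
  rw [hRe.transport_qOrthogonal ha ha (hpu R hR a ha a ha)] at hY'
  have hΛ := form_projection_eq hQ.1 hX hY hX' hY'
  have hΛ' : ∀ v w, Q (Λ' v) w = Q v (w - Λ w) := fun v w => by
    have h1 := congrArg (starRingEnd ℂ) (hΛ w v)
    rw [hQ.1, map_sub, map_sub, hQ.1, hQ.1] at h1
    rw [map_sub, h1, sub_sub_cancel]
  have hK₁ : ∀ t ∈ Ioo a b, ∀ s ∈ Ioo a b, ∀ w, inverseKernel R a b Zout Zin t s w =
      U t (heaviside (t - s) • Λ (Z s w) - heaviside (s - t) • (Z s w - Λ (Z s w))) :=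
    fun t ht s hs w => by
      rw [hK t (Ioo_subset_Icc_self ht) s (Ioo_subset_Icc_self hs),
        (hUR t (Ioo_subset_Icc_self ht)).1, (hUR s (Ioo_subset_Icc_self hs)).2]
  have hK₂ : ∀ t ∈ Ioo a b, ∀ s ∈ Ioo a b, ∀ w,
      inverseKernel R a b (qOrthogonal Q Zout) (qOrthogonal Q Zin) t s w =
      U t (heaviside (t - s) • Λ' (Z s w) - heaviside (s - t) • (Z s w - Λ' (Z s w))) :=
    fun t ht s hs w => by
      rw [hK' t (Ioo_subset_Icc_self ht) s (Ioo_subset_Icc_self hs),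
        (hUR t (Ioo_subset_Icc_self ht)).1, (hUR s (Ioo_subset_Icc_self hs)).2]
  have hUQ : ∀ t ∈ Ioo a b, ∀ v w, Q (U t v) (U t w) = Q v w := fun t ht v w => by
    rw [(hUR t (Ioo_subset_Icc_self ht)).1, hpu R hR t (Ioo_subset_Icc_self ht) a ha]
  obtain ⟨E, hE⟩ := hU.exists_clm_L2 hab.le Λ
  obtain ⟨E', hE'⟩ := hU.exists_clm_L2 hab.le Λ'
  have hker := ker_eq_bot_of_splitPrimitive hU hab.le hE
  have hker' := ker_eq_bot_of_splitPrimitive hU hab.le hE'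
  have hEE' := qL2_clm_eq_neg hU hab.le hUQ hΛ hE hE'
  have hE'E := qL2_clm_eq_neg hU hab.le hUQ hΛ' hE' hE
  -- The two operators exchange roles: each has dense range because the other is injective.
  have hd := denseRange_of_qL2_eq_neg hQ hE'E hker'
  have hd' := denseRange_of_qL2_eq_neg hQ hEE' hker
  exact ⟨hc', mapsCcToC_inverseKernel hU hK₁ hab.le, mapsCcToC_inverseKernel hU hK₂ hab.le,
    isLeftInverseKernel_inverseKernel hU hK₁ hR hUR hAc hA,
    isLeftInverseKernel_inverseKernel hU hK₂ hR hUR hAc hA,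
    E, E', hasKernel_inverseKernel hU hK₁ hE, hasKernel_inverseKernel hU hK₂ hE', hd, hd',
    hker, hker',
    isWellPosedRealization_inverseOp hker hd
      fun _ => hR.exists_L2_of_testFunction hU hab.le hUR hAc hA hE,
    isWellPosedRealization_inverseOp hker' hd'
      fun _ => hR.exists_L2_of_testFunction hU hab.le hUR hAc hA hE',
    zero_mem_resolventSet_inverseOp hker, zero_mem_resolventSet_inverseOp hker',
    isFormAdjoint_inverseOp hQ hE'E hker hker'⟩
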